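/- Let $F$ be a field (finite or infinite), let $1<k<n-1$, put $V=F^n$ and assume $|F|>n-k$. Let $\Gamma_k(V)$ be the Grassmann graph (vertices: $k$-dimensional subspaces of $V$; $A,B$ adjacent iff $\dim(A\cap B)=k-1$) and $\Delta_k(V)$ its subgraph induced by the non-degenerate subspaces, i.e. those not contained in any coordinate hyperplane. Then $\Gamma_k(V)$ can be recovered from the graph $\Delta_k(V)$ (and the numbers $n,k,|F|$). Precisely, the following hold. For a $(k-1)$-dimensional $X$ and a $(k+1)$-dimensional $Y$ let $\mathcal S^c(X)$ and $\mathcal T^c(Y)$ be the sets of non-degenerate $k$-dimensional subspaces containing $X$, respectively contained in $Y$. A star (top) is a maximal clique of $\Delta_k(V)$ of the form $\mathcal S^c(X)$ (of the form $\mathcal T^c(Y)$); a maximal star is a set $\mathcal S^c(X)$ with $X$ non-degenerate. A line of a graph is an intersection of two distinct maximal cliques which has more than one vertex. (A) The types of maximal cliques are determined by the graph $\Delta_k(V)$. A maximal clique is a maximal star iff it has exactly $1+q+\dots+q^{n-k}$ vertices (if $|F|=q$ is finite), respectively iff, together with the lines contained in it, it is a projective space (if $F$ is infinite). A maximal clique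 is a star iff it is a maximal star or meets some maximal star in exactly one vertex. It is a top iff it is not a maximal star and meets every maximal star in the empty set or a line. (B) For $x=s$ (stars) or $x=t$ (tops) let $\Delta_x$ be the graph on the cliques of that type in which distinct $\mathcal X_1,\mathcal X_2$ are adjacent iff every vertex of each is adjacent to at least one vertex of the other; let $\Delta'_x$ be its subgraph keeping only the edges with $\mathcal X_1\cap\mathcal X_2=\emptyset$. A set of stars (tops) is special if it is a maximal clique of both $\Delta_x$ and $\Delta'_x$. Let $\Gamma_x$ be the graph whose vertices are those of $\Delta_k(V)$ together with the special sets. Vertices of $\Delta_k(V)$ are adjacent as in $\Delta_k(V)$. A vertex $A$ of $\Delta_k(V)$ and a special set are adjacent iff $A$ belongs to one of the cliques in the set. Two distinct special sets of stars are adjacent iff they have a common star. Two distinct special sets of tops are adjacent iff some star has non-empty intersection with every top of both sets. If $k\ge 3$, there is an isomorphism $\Gamma_s\to\Gamma_k(V)$ which is the identity on $\Delta_k(V)$. If $k\le n-3$, there is an isomorphism $\Gamma_t\to\Gamma_k(V)$ which is the identity on $\Delta_k(V)$. (If $n\ge5$, at least one of these cases occurs.) (C) Let $n=4$ (so $k=2$).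 For a degenerate $2$-dimensional $X$ let $\mathfrak T_X$ be the set of all tops $\mathcal T^c(Y)$ with $X\subset Y$. The sets $\mathfrak T_X$ are maximal cliques of $\Delta'_t$, called linear, and they are determined by the graph $\Delta'_t$ as follows. If $|F|\ge 6$, a maximal clique of $\Delta'_t$ is linear iff it has at least five vertices. If $|F|=q<6$, it is linear iff it meets every other maximal clique of $\Delta'_t$ in at most one vertex, or it intersects some maximal clique which has this property and has exactly $q-1$ vertices. Let $\Gamma'_t$ be defined as $\Gamma_t$, with the linear maximal cliques in place of the special sets of tops. Then there is an isomorphism $\Gamma'_t\to\Gamma_k(V)$ which is the identity on $\Delta_k(V)$. Consequently these constructions, carried out in an arbitrary graph $G$ with an isomorphism $\varphi:G\to\Delta_k(V)$ (cliques being classified by the criteria in (A) and (C)), give a graph containing $G$ and an isomorphism of it onto $\Gamma_k(V)$ extending $\varphi$. -/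

import Mathlib

open Module

/-! ### The Grassmann graph and the subgraph of non-degenerate subspaces -/

/-- The coordinate hyperplane `C_i` of `F^n`: the kernel of the `i`-th coordinate functional. -/
def coordHyperplane (F : Type*) [Field F] {n : ℕ} (i : Fin n) : Submodule F (Fin n → F) :=
  LinearMap.ker (LinearMap.proj i : (Fin n → F) →ₗ[F] F)

/-- A subspace of `F^n` is degenerate if it is contained in some coordinate hyperplane. -/
def IsDegenerate {F : Type*} [Field F] {n : ℕ} (A : Submodule F (Fin n → F)) : Prop :=
  ∃ i : Fin n, A ≤ coordHyperplane F i

/-- The `k`-dimensional subspaces of `F^n`. -/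
abbrev Grass (F : Type*) [Field F] (n k : ℕ) : Type _ :=
  {A : Submodule F (Fin n → F) // finrank F A = k}

/-- The Grassmann graph: `A` and `B` are adjacent iff `A ∩ B` is `(k-1)`-dimensional. -/
def grassmannGraph (F : Type*) [Field F] (n k : ℕ) : SimpleGraph (Grass F n k) where
  Adj A B := finrank F (A.1 ⊓ B.1 : Submodule F (Fin n → F)) + 1 = k
  symm := ⟨fun A B h => by rwa [inf_comm]⟩
  loopless := ⟨fun A h => by rw [inf_idem, A.2] at h; omega⟩

/-- The set of non-degenerate `k`-dimensional subspaces. -/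
def nondegenerate (F : Type*) [Field F] (n k : ℕ) : Set (Grass F n k) :=
  {A | ¬ IsDegenerate A.1}

/-- The graph `Δ_k(F^n)`: the subgraph of the Grassmann graph induced by the set of
non-degenerate subspaces. -/
def nondegGraph (F : Type*) [Field F] (n k : ℕ) : SimpleGraph (nondegenerate F n k) :=
  (grassmannGraph F n k).induce (nondegenerate F n k)

/-- A maximal clique of a (possibly infinite) graph. -/
def IsMaxClique {W : Type*} (G : SimpleGraph W) (K : Set W) : Prop :=
  Maximal G.IsClique K

/-! ### Stars and tops of `Δ_k(F^n)`, described by subspaces -/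

/-- `S^c(X)`: the non-degenerate `k`-dimensional subspaces containing `X`. -/
def starSet {F : Type*} [Field F] {n : ℕ} (k : ℕ) (X : Submodule F (Fin n → F)) :
    Set (nondegenerate F n k) :=
  {A | X ≤ A.1.1}

/-- `T^c(Y)`: the non-degenerate `k`-dimensional subspaces contained in `Y`. -/
def topSet {F : Type*} [Field F] {n : ℕ} (k : ℕ) (Y : Submodule F (Fin n → F)) :
    Set (nondegenerate F n k) :=
  {A | A.1.1 ≤ Y}

/-- The stars of `Δ_k(F^n)`: the maximal cliques of the form `S^c(X)` with `dim X = k - 1`. -/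
def stars (F : Type*) [Field F] (n k : ℕ) : Set (Set (nondegenerate F n k)) :=
  {K | IsMaxClique (nondegGraph F n k) K ∧
    ∃ X : Submodule F (Fin n → F), finrank F X + 1 = k ∧ K = starSet k X}

/-- The maximal stars of `Δ_k(F^n)`: the sets `S^c(X)` with `X` non-degenerate of
dimension `k - 1`. -/
def maximalStars (F : Type*) [Field F] (n k : ℕ) : Set (Set (nondegenerate F n k)) :=
  {K | ∃ X : Submodule F (Fin n → F),
    finrank F X + 1 = k ∧ ¬ IsDegenerate X ∧ K = starSet k X}

/-- The tops of `Δ_k(F^n)`: the maximal cliques of the form `T^c(Y)` with `dim Y = k + 1`. -/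
def tops (F : Type*) [Field F] (n k : ℕ) : Set (Set (nondegenerate F n k)) :=
  {K | IsMaxClique (nondegGraph F n k) K ∧
    ∃ Y : Submodule F (Fin n → F), finrank F Y = k + 1 ∧ K = topSet k Y}

/-- The set of all tops of `Δ_k(F^n)` whose `(k+1)`-dimensional subspaces contain `X`. -/
def topsThrough {F : Type*} [Field F] {n k : ℕ} (X : Grass F n k) : Set (tops F n k) :=
  {T | ∃ Y : Submodule F (Fin n → F), finrank F Y = k + 1 ∧ X.1 ≤ Y ∧ T.1 = topSet k Y}

/-! ### Types of maximal cliques in an abstract graph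

The definitions below see only an abstract graph `G` and the numbers `n`, `k`, `q = |F|`
(with `q = ⊤` if `F` is infinite). -/

section Recovery

variable {W : Type*}

/-- A line of a graph: the intersection of two distinct maximal cliques, if it contains more
than one vertex. -/
def IsLine (G : SimpleGraph W) (l : Set W) : Prop :=
  l.Nontrivial ∧ ∃ K L : Set W, IsMaxClique G K ∧ IsMaxClique G L ∧ K ≠ L ∧ l = K ∩ L

/-- The set of vertices `K` with all lines contained in it is a projective space
(Veblen-Young axioms): two distinct points are on exactly one line, if the line `a b` meets
the line `c d` then the line `a c` meets the line `b d`, and every line has at least three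
points. -/
structure IsProjectiveSpace (G : SimpleGraph W) (K : Set W) : Prop where
  exists_unique_line : ∀ a ∈ K, ∀ b ∈ K, a ≠ b →
    ∃! l : Set W, (IsLine G l ∧ l ⊆ K) ∧ a ∈ l ∧ b ∈ l
  veblen : ∀ a b c d : W, [a, b, c, d].Nodup → ∀ l₁ l₂ m₁ m₂ : Set W,
    (IsLine G l₁ ∧ l₁ ⊆ K) → (IsLine G l₂ ∧ l₂ ⊆ K) →
    (IsLine G m₁ ∧ m₁ ⊆ K) → (IsLine G m₂ ∧ m₂ ⊆ K) →
    a ∈ l₁ → b ∈ l₁ → c ∈ l₂ → d ∈ l₂ → a ∈ m₁ → c ∈ m₁ → b ∈ m₂ → d ∈ m₂ →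
    (l₁ ∩ l₂).Nonempty → (m₁ ∩ m₂).Nonempty
  three_points : ∀ l : Set W, IsLine G l → l ⊆ K → 3 ≤ l.encard

open Classical in
/-- The maximal cliques recognised as maximal stars: for finite `q` those with
`1 + q + ⋯ + q^(n-k)` vertices, for infinite `q` those which are projective spaces. -/
def recMaximalStars (n k : ℕ) (q : ℕ∞) (G : SimpleGraph W) : Set (Set W) :=
  {K | IsMaxClique G K ∧
    if q = ⊤ then IsProjectiveSpace G K
    else K.encard = ∑ i ∈ Finset.range (n - k + 1), q ^ i}

/-- The maximal cliques recognised as stars: the maximal stars, and those meeting some maximal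
star in precisely one vertex. -/
def recStars (n k : ℕ) (q : ℕ∞) (G : SimpleGraph W) : Set (Set W) :=
  {K | IsMaxClique G K ∧
    (K ∈ recMaximalStars n k q G ∨ ∃ S ∈ recMaximalStars n k q G, (K ∩ S).encard = 1)}

/-- The maximal cliques recognised as tops: those which are not maximal stars and meet every
maximal star in the empty set or a line. -/
def recTops (n k : ℕ) (q : ℕ∞) (G : SimpleGraph W) : Set (Set W) :=
  {K | IsMaxClique G K ∧ K ∉ recMaximalStars n k q G ∧
    ∀ S ∈ recMaximalStars n k q G, K ∩ S = ∅ ∨ IsLine G (K ∩ S)}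

/-! ### Graphs of cliques and special sets -/

/-- The graph `Δ_x` on a family of cliques: distinct `K`, `L` are adjacent iff every vertex of
each of them is adjacent to at least one vertex of the other. -/
def cliqueGraph (G : SimpleGraph W) (𝒦 : Set (Set W)) : SimpleGraph 𝒦 where
  Adj K L := K ≠ L ∧ (∀ a ∈ K.1, ∃ b ∈ L.1, G.Adj a b) ∧ (∀ b ∈ L.1, ∃ a ∈ K.1, G.Adj b a)
  symm := ⟨fun _ _ h => ⟨h.1.symm, h.2.2, h.2.1⟩⟩
  loopless := ⟨fun _ h => h.1 rfl⟩

/-- The graph `Δ'_x`: adjacency in `Δ_x` together with empty intersection. -/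
def disjointCliqueGraph (G : SimpleGraph W) (𝒦 : Set (Set W)) : SimpleGraph 𝒦 where
  Adj K L := (cliqueGraph G 𝒦).Adj K L ∧ K.1 ∩ L.1 = ∅
  symm := ⟨fun _ _ h => ⟨h.1.symm, by rw [Set.inter_comm]; exact h.2⟩⟩
  loopless := ⟨fun _ h => h.1.ne rfl⟩

/-- The special sets: maximal cliques of both `Δ_x` and `Δ'_x`. -/
def specialSets (G : SimpleGraph W) (𝒦 : Set (Set W)) : Set (Set 𝒦) :=
  {𝔛 | IsMaxClique (cliqueGraph G 𝒦) 𝔛 ∧ IsMaxClique (disjointCliqueGraph G 𝒦) 𝔛}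

/-- Add to `G` the members of a collection `P` of sets of cliques as new vertices. A vertex `w`
is joined to `𝔛 ∈ P` iff `w` lies in a clique belonging to `𝔛`, and two distinct members of `P`
are joined iff they are related by `R`. -/
def extendGraph (G : SimpleGraph W) {𝒦 : Set (Set W)} (P : Set (Set 𝒦))
    (R : Set 𝒦 → Set 𝒦 → Prop) (hR : ∀ 𝔛 𝔜, R 𝔛 𝔜 → R 𝔜 𝔛) : SimpleGraph (W ⊕ P) where
  Adj
    | .inl a, .inl b => G.Adj a b
    | .inl a, .inr 𝔛 => ∃ K ∈ 𝔛.1, a ∈ K.1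
    | .inr 𝔛, .inl a => ∃ K ∈ 𝔛.1, a ∈ K.1
    | .inr 𝔛, .inr 𝔜 => 𝔛 ≠ 𝔜 ∧ R 𝔛.1 𝔜.1
  symm := ⟨by
    rintro (a | 𝔛) (b | 𝔜) h
    · exact SimpleGraph.Adj.symm (G := G) h
    · exact h
    · exact h
    · exact ⟨h.1.symm, hR _ _ h.2⟩⟩
  loopless := ⟨by
    rintro (a | 𝔛) h
    · exact G.loopless.irrefl a h
    · exact h.1 rfl⟩

/-- The graph `Γ_s`: two distinct special sets of stars are adjacent iff some star belongs to
both. -/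
def recoverByStars (G : SimpleGraph W) (𝒮 : Set (Set W)) :
    SimpleGraph (W ⊕ specialSets G 𝒮) :=
  extendGraph G (specialSets G 𝒮) (fun 𝔛 𝔜 => ∃ S, S ∈ 𝔛 ∧ S ∈ 𝔜)
    (fun _ _ ⟨S, h₁, h₂⟩ => ⟨S, h₂, h₁⟩)

/-- The graphs `Γ_t` (for `P` the special sets of tops) and `Γ'_t` (for `P` the linear maximal
cliques of `Δ'_t`): two distinct members of `P` are adjacent iff some star has non-empty
intersection with every top belonging to either of them. -/
def recoverByTops (G : SimpleGraph W) (𝒮 𝒯 : Set (Set W)) (P : Set (Set 𝒯)) :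
    SimpleGraph (W ⊕ P) :=
  extendGraph G P
    (fun 𝔛 𝔜 => ∃ S ∈ 𝒮, (∀ T ∈ 𝔛, (S ∩ T.1).Nonempty) ∧ (∀ T ∈ 𝔜, (S ∩ T.1).Nonempty))
    (fun _ _ ⟨S, hS, h₁, h₂⟩ => ⟨S, hS, h₂, h₁⟩)

/-! ### Recognition of the linear maximal cliques of `Δ'_t` for `n = 4` -/

/-- Maximal cliques meeting every other maximal clique in at most one vertex (for the graph
`Δ'_t` over a finite field: the linear maximal cliques of types 1 and 2). -/
def IsLinearType12 (H : SimpleGraph W) (K : Set W) : Prop :=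
  IsMaxClique H K ∧ ∀ L : Set W, IsMaxClique H L → L ≠ K → (K ∩ L).encard ≤ 1

/-- The linear maximal cliques of type 2: those of types 1 and 2 with `q - 1` vertices. -/
def IsLinearType2 (q : ℕ∞) (H : SimpleGraph W) (K : Set W) : Prop :=
  IsLinearType12 H K ∧ K.encard + 1 = q

open Classical in
/-- The maximal cliques recognised as linear: if `q ≥ 6`, those with at least five vertices;
otherwise, those of types 1 and 2, and those intersecting one of type 2. -/
def recLinear (q : ℕ∞) (H : SimpleGraph W) : Set (Set W) :=
  {K | IsMaxClique H K ∧
    if 6 ≤ q then 5 ≤ K.encard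
    else IsLinearType12 H K ∨ ∃ L, IsLinearType2 q H L ∧ (K ∩ L).Nonempty}

end Recovery

/-! ### Dimension lemmas and cliques of the full Grassmann graph -/

section LinearAlgebra

variable {F : Type*} [Field F] {V : Type*} [AddCommGroup V] [Module F V] [FiniteDimensional F V]

/-! Pairwise adjacent `k`-subspaces share a `(k-1)`-subspace or lie in a `(k+1)`-subspace
(`exists_common_le_or_le`). Since `|F| > n - k ≥ 2`, enough subspaces are non-degenerate for this to
determine the maximal cliques of `Δ_k`: they are all stars, also those over degenerate `X`, and the
tops under non-degenerate `Y` (`isMaxClique_iff`). Lines are then the sets star ∩ top with more than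
one vertex.

The types are separated as follows. A maximal star is the full projective space of `V/X`, while
other stars and all tops have holes. Over a finite field the holes are seen by counting. Over an
infinite field a Veblen-Young configuration is placed so that its points are non-degenerate but the
required intersection point falls into a hole. A top meets a maximal star in `∅` or a whole line,
never in one vertex. A star over a degenerate `X` meets some maximal star in exactly one vertex.

A degenerate `k`-subspace is recovered from the stars over its hyperplanes or from the tops over it.
Adjacency in `Δ_s` or `Δ_t` is Grassmann adjacency of the defining subspaces in dimension `k - 1` or
`k + 1`; the bound `|F| > n - k` enters through `exists_hyperplane_of_pencil`. Maximal cliques of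
these graphs are controlled by the same clique lemma, and pairwise disjointness both selects the
right kind and says that the `k`-subspace in question is degenerate. The conditions `k ≥ 3` and `k ≤
n - 3` make the cliques attached to `k`-subspaces maximal.

For `n = 4` any two tops are adjacent in `Δ_t`, so only disjointness carries information. A top is
replaced by the normal vector of its hyperplane, a point of the projective 3-space with at least two
nonzero coordinates. Two points are adjacent in `Δ'_t` iff their line passes through a base point.
Linear cliques are lines through base points; any other maximal clique has at most four points, all
with exactly three nonzero coordinates.

All of this is proved for a graph `G` with a map `ρ` to subspaces (`IsNondegModel`), so it applies
to `Δ_k` and to its abstract copies alike. -/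

theorem exists_submodule_finrank_between {A B : Submodule F V} (hAB : A ≤ B) {d : ℕ}
    (hA : finrank F A ≤ d) (hB : d ≤ finrank F B) :
    ∃ C : Submodule F V, A ≤ C ∧ C ≤ B ∧ finrank F C = d := by
  induction d, hA using Nat.le_induction with
  | base => exact ⟨A, le_rfl, hAB, rfl⟩
  | succ d _ ih =>
    obtain ⟨C, hAC, hCB, hC⟩ := ih (by omega)
    have hne : ¬ B ≤ C := fun h => by
      have := Submodule.finrank_mono h
      omega
    obtain ⟨v, hvB, hvC⟩ := SetLike.not_le_iff_exists.1 hne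
    refine ⟨C ⊔ F ∙ v, hAC.trans le_sup_left, sup_le hCB ?_, ?_⟩
    · simpa using hvB
    · rw [Submodule.finrank_sup_span_singleton hvC, hC]

theorem inf_eq_of_le_of_finrank {A B X : Submodule F V} {k : ℕ} (hA : finrank F A = k)
    (hB : finrank F B = k) (hX : finrank F X + 1 = k) (hXA : X ≤ A) (hXB : X ≤ B) (h : A ≠ B) :
    A ⊓ B = X := by
  refine (Submodule.eq_of_le_of_finrank_le (le_inf hXA hXB) ?_).symm
  by_contra hlt
  have h1 := Submodule.finrank_mono (inf_le_left : A ⊓ B ≤ A)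
  have h2 : A ⊓ B = A := Submodule.eq_of_le_of_finrank_le inf_le_left (by omega)
  exact h (Submodule.eq_of_le_of_finrank_le (inf_eq_left.1 h2) (by omega))

theorem sup_eq_of_le_of_finrank {A B Y : Submodule F V} {k : ℕ} (hA : finrank F A = k)
    (hB : finrank F B = k) (hY : finrank F Y = k + 1) (hAY : A ≤ Y) (hBY : B ≤ Y) (h : A ≠ B) :
    A ⊔ B = Y := by
  refine Submodule.eq_of_le_of_finrank_le (sup_le hAY hBY) ?_
  by_contra hlt
  have h1 := Submodule.finrank_mono (le_sup_left : A ≤ A ⊔ B)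
  have h2 : A = A ⊔ B := Submodule.eq_of_le_of_finrank_le le_sup_left (by omega)
  exact h (Submodule.eq_of_le_of_finrank_le (sup_eq_left.1 h2.symm) (by omega)).symm

theorem finrank_inf_add_one_iff {A B : Submodule F V} {k : ℕ} (hA : finrank F A = k)
    (hB : finrank F B = k) :
    finrank F (A ⊓ B : Submodule F V) + 1 = k ↔ finrank F (A ⊔ B : Submodule F V) = k + 1 := by
  have := Submodule.finrank_sup_add_finrank_inf_eq A B
  omega

theorem finrank_inf_add_one_of_le_of_le {A B Y : Submodule F V} {k : ℕ} (hA : finrank F A = k)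
    (hB : finrank F B = k) (hY : finrank F Y = k + 1) (hAY : A ≤ Y) (hBY : B ≤ Y) (h : A ≠ B) :
    finrank F (A ⊓ B : Submodule F V) + 1 = k := by
  rw [finrank_inf_add_one_iff hA hB, sup_eq_of_le_of_finrank hA hB hY hAY hBY h, hY]

/-- A family of `k`-dimensional subspaces any two of which meet in dimension `k - 1` has a common
`(k-1)`-dimensional subspace or is contained in a `(k+1)`-dimensional one. -/
theorem exists_common_le_or_le {k : ℕ} (hk : 1 ≤ k) (hkn : k + 1 ≤ finrank F V)
    (S : Set (Submodule F V)) (hS : ∀ A ∈ S, finrank F A = k)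
    (hadj : ∀ A ∈ S, ∀ B ∈ S, A ≠ B → finrank F (A ⊓ B : Submodule F V) + 1 = k) :
    (∃ X : Submodule F V, finrank F X + 1 = k ∧ ∀ A ∈ S, X ≤ A) ∨
      ∃ Y : Submodule F V, finrank F Y = k + 1 ∧ ∀ A ∈ S, A ≤ Y := by
  rcases S.subsingleton_or_nontrivial with hs | ⟨A, hA, B, hB, hAB⟩
  · obtain ⟨Y, -, -, hY⟩ := exists_submodule_finrank_between (bot_le : (⊥ : Submodule F V) ≤ ⊤)
      (d := k + 1) (by simp) (by simpa using hkn)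
    rcases hs.eq_empty_or_singleton with rfl | ⟨A, rfl⟩
    · exact Or.inr ⟨Y, hY, by simp⟩
    · obtain ⟨Y, hAY, -, hY⟩ := exists_submodule_finrank_between (le_top : A ≤ ⊤)
        (d := k + 1) (by rw [hS A rfl]; omega) (by simpa using hkn)
      exact Or.inr ⟨Y, hY, by simpa using hAY⟩
  by_cases hX : ∀ C ∈ S, A ⊓ B ≤ C
  · exact Or.inl ⟨A ⊓ B, hadj A hA B hB hAB, hX⟩
  right
  push Not at hX
  obtain ⟨C, hC, hXC⟩ := hX
  have hAB' := hadj A hA B hB hAB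
  -- A member not containing `A ⊓ B` meets `A` and `B` in different hyperplanes of itself, and these
  -- span it.
  have key : ∀ D ∈ S, ¬ A ⊓ B ≤ D → D ≤ A ⊔ B := by
    intro D hD hXD
    have hDA : D ≠ A := by rintro rfl; exact hXD inf_le_left
    have hDB : D ≠ B := by rintro rfl; exact hXD inf_le_right
    have h1 := hadj D hD A hA hDA
    have h2 := hadj D hD B hB hDB
    have hne : D ⊓ A ≠ D ⊓ B := by
      intro h
      have hle : D ⊓ A ≤ A ⊓ B := le_inf inf_le_right (h ▸ inf_le_right)
      have := Submodule.eq_of_le_of_finrank_le hle (by omega)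
      exact hXD (this ▸ inf_le_left)
    have hkk : k = (k - 1) + 1 := by omega
    have := sup_eq_of_le_of_finrank (k := k - 1) (A := D ⊓ A) (B := D ⊓ B) (Y := D) (by omega)
      (by omega) (by rw [hS D hD]; omega) inf_le_left inf_le_left hne
    rw [← this]
    exact sup_le_sup inf_le_right inf_le_right
  refine ⟨A ⊔ B, (finrank_inf_add_one_iff (hS A hA) (hS B hB)).1 hAB', fun D hD => ?_⟩
  by_cases hXD : A ⊓ B ≤ D
  -- A member containing `A ⊓ B` is spanned by `A ⊓ B` and its intersection with `C`, which is
  -- already known to lie in `A ⊔ B`.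
  · have hDC : D ≠ C := by rintro rfl; exact hXC hXD
    have h1 := hadj D hD C hC hDC
    have hne : A ⊓ B ≠ D ⊓ C := by
      intro h
      exact hXC (h ▸ inf_le_right)
    have := sup_eq_of_le_of_finrank (k := k - 1) (A := A ⊓ B) (B := D ⊓ C) (Y := D) (by omega)
      (by omega) (by rw [hS D hD]; omega) hXD inf_le_left hne
    rw [← this]
    exact sup_le (inf_le_left.trans le_sup_left) (inf_le_right.trans (key C hC hXC))
  · exact key D hD hXD

end LinearAlgebra

/-! ### Coordinate hyperplanes and the supply of non-degenerate subspaces -/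

section Coordinates

variable {F : Type*} [Field F] {n : ℕ}

theorem mem_coordHyperplane {i : Fin n} {v : Fin n → F} : v ∈ coordHyperplane F i ↔ v i = 0 :=
  Iff.rfl

theorem span_le_coordHyperplane {i : Fin n} {v : Fin n → F} :
    F ∙ v ≤ coordHyperplane F i ↔ v i = 0 :=
  Submodule.span_singleton_le_iff_mem _ _

theorem IsDegenerate.mono {A B : Submodule F (Fin n → F)} (hAB : A ≤ B) (hB : IsDegenerate B) :
    IsDegenerate A :=
  hB.imp fun _ h => hAB.trans h

theorem not_isDegenerate_of_mem {A : Submodule F (Fin n → F)} {v : Fin n → F} (hv : v ∈ A)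
    (h : ∀ i, v i ≠ 0) : ¬ IsDegenerate A := fun ⟨i, hi⟩ => h i (hi hv)

theorem finrank_coordHyperplane (i : Fin n) : finrank F (coordHyperplane F i) + 1 = n := by
  have h := LinearMap.finrank_range_add_finrank_ker (LinearMap.proj i : (Fin n → F) →ₗ[F] F)
  have h2 : LinearMap.range (LinearMap.proj i : (Fin n → F) →ₗ[F] F) = ⊤ :=
    LinearMap.range_eq_top.2 (LinearMap.proj_surjective i)
  rw [h2, finrank_top, finrank_self, finrank_fin_fun] at h
  rw [coordHyperplane]
  omega

theorem finrank_inf_coordHyperplane {Y : Submodule F (Fin n → F)} {i : Fin n}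
    (h : ¬ Y ≤ coordHyperplane F i) :
    finrank F (Y ⊓ coordHyperplane F i : Submodule F (Fin n → F)) + 1 = finrank F Y := by
  have h1 := finrank_coordHyperplane (F := F) i
  have h2 := Submodule.finrank_sup_add_finrank_inf_eq Y (coordHyperplane F i)
  have h3 : finrank F (Y ⊔ coordHyperplane F i : Submodule F (Fin n → F)) = n := by
    refine le_antisymm ((Submodule.finrank_le _).trans (by simp)) ?_
    by_contra hlt
    have := Submodule.eq_of_le_of_finrank_le
      (le_sup_right : coordHyperplane F i ≤ Y ⊔ coordHyperplane F i) (by omega)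
    exact h (sup_eq_right.1 this.symm)
  omega

/-- With a scalar `a` other than `0` and `1`, each basis vector is a multiple of the difference of
two vectors without zero coordinates. Such vectors therefore span the space. -/
theorem exists_forall_ne_zero_notMem (h3 : 3 ≤ ENat.card F) {W : Submodule F (Fin n → F)}
    (hW : W ≠ ⊤) : ∃ v : Fin n → F, v ∉ W ∧ ∀ i, v i ≠ 0 := by
  by_contra! hcon
  have hmem : ∀ v : Fin n → F, (∀ i, v i ≠ 0) → v ∈ W := fun v hv => by
    by_contra h
    obtain ⟨i, hi⟩ := hcon v h
    exact hv i hi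
  obtain ⟨a, ha0, ha1⟩ : ∃ a : F, a ≠ 0 ∧ a ≠ 1 := by
    by_contra! h
    have h2 : ENat.card F ≤ 2 := by
      rw [← Set.encard_univ, ← Set.encard_pair (zero_ne_one (α := F))]
      refine Set.encard_le_encard fun x _ => ?_
      by_cases hx : x = 0
      · simp [hx]
      · simp [h x hx]
    exact absurd (h3.trans h2) (by decide)
  apply hW
  rw [eq_top_iff, ← (Pi.basisFun F (Fin n)).span_eq, Submodule.span_le]
  rintro _ ⟨i, rfl⟩
  have h1 : (fun _ => 1 : Fin n → F) ∈ W := hmem _ fun _ => one_ne_zero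
  have h2 : (Function.update (fun _ => 1) i a : Fin n → F) ∈ W := hmem _ fun j => by
    by_cases hj : j = i
    · subst hj; simpa using ha0
    · simp [hj]
  have h4 : (Pi.basisFun F (Fin n) i : Fin n → F) =
      (a - 1)⁻¹ • ((Function.update (fun _ => 1) i a : Fin n → F) - fun _ => 1) := by
    ext j
    by_cases hj : j = i
    · subst hj; simp [inv_mul_cancel₀ (sub_ne_zero.2 ha1)]
    · simp [hj]
  rw [h4]
  exact W.smul_mem _ (W.sub_mem h2 h1)

theorem add_le_pow_of_three_le {q k : ℕ} (hq : 3 ≤ q) (hk : 2 ≤ k) : q + k ≤ q ^ k := by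
  induction k, hk using Nat.le_induction with
  | base => nlinarith
  | succ k hk ih => rw [pow_succ]; nlinarith

/-- A non-degenerate subspace has many non-degenerate hyperplanes: one of them misses any given
nonzero vector. -/
theorem exists_hyperplane_notMem {k : ℕ} (hk : 1 < k) (hkn : k + 1 < n)
    (hF : ((n - k : ℕ) : ℕ∞) < ENat.card F) {Y : Submodule F (Fin n → F)}
    (hY : finrank F Y = k + 1) (hYd : ¬ IsDegenerate Y) {z : Fin n → F} (hzY : z ∈ Y)
    (hz : z ≠ 0) :
    ∃ A : Submodule F (Fin n → F), A ≤ Y ∧ finrank F A = k ∧ ¬ IsDegenerate A ∧ z ∉ A := by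
  by_contra! hcon
  obtain ⟨i₀, hi₀⟩ := Function.ne_iff.1 hz
  have hzi : z i₀ ≠ 0 := hi₀
  have hnle : ¬ Y ≤ coordHyperplane F i₀ := fun h => hYd ⟨i₀, h⟩
  let A₀ : Submodule F (Fin n → F) := Y ⊓ coordHyperplane F i₀
  have hA₀ : finrank F A₀ = k := by
    have : finrank F A₀ + 1 = finrank F Y := finrank_inf_coordHyperplane hnle
    omega
  have hA₀0 : ∀ a : A₀, (a : Fin n → F) i₀ = 0 := fun a => a.2.2
  have hYle : ∀ i, A₀ ≤ coordHyperplane F i → z i = 0 → False := by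
    intro i hi hzi'
    have hzA : z ∉ A₀ := fun h => hzi h.2
    have hle : A₀ ⊔ F ∙ z ≤ Y := sup_le inf_le_left (by simpa using hzY)
    have : A₀ ⊔ F ∙ z = Y := Submodule.eq_of_le_of_finrank_eq hle
      (by rw [Submodule.finrank_sup_span_singleton hzA, hA₀, hY])
    exact hYd ⟨i, this ▸ sup_le hi (span_le_coordHyperplane.2 hzi')⟩
  -- The complements of `F ∙ z` in `Y` are the graphs `{a + g a • z}` of functionals `g` on `A₀`. If
  -- each lies in some coordinate hyperplane, that coordinate determines `g`, giving `|F| ^ k ≤ n`.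
  -- This contradicts `n < |F| + k ≤ |F| ^ k`.
  let T : Dual F A₀ → A₀ →ₗ[F] (Fin n → F) := fun g => A₀.subtype + g.smulRight z
  have hT : ∀ g a, T g a = a + g a • z := fun g a => rfl
  have hTz : ∀ g a, T g a i₀ = g a * z i₀ := fun g a => by simp [hT, hA₀0]
  have hTinj : ∀ g, LinearMap.ker (T g) = ⊥ := by
    intro g
    rw [LinearMap.ker_eq_bot']
    intro a ha
    have h1 := hTz g a
    rw [ha] at h1
    have h2 : g a = 0 := by simpa [hzi] using h1.symm
    rw [hT, h2, zero_smul, add_zero] at ha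
    exact Subtype.ext ha
  have hdeg : ∀ g, IsDegenerate (LinearMap.range (T g)) := by
    intro g
    by_contra hnd
    have hzmem := hcon (LinearMap.range (T g)) ?_ ?_ hnd
    · obtain ⟨a, ha⟩ := hzmem
      have h1 := hTz g a
      rw [ha] at h1
      have h2 : g a = 1 := (mul_eq_right₀ hzi).1 h1.symm
      rw [hT, h2, one_smul, add_eq_right] at ha
      rw [show a = 0 from Subtype.ext ha, map_zero] at h2
      exact zero_ne_one h2
    · rintro _ ⟨a, rfl⟩
      exact Y.add_mem a.2.1 (Y.smul_mem _ hzY)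
    · rw [LinearMap.finrank_range_of_inj (LinearMap.ker_eq_bot.1 (hTinj g)), hA₀]
  choose c hc using hdeg
  have hca : ∀ (g : Dual F A₀) (a : A₀), (a : Fin n → F) (c g) + g a * z (c g) = 0 := fun g a =>
    hc g (LinearMap.mem_range_self (T g) a)
  have hcz : ∀ g, z (c g) ≠ 0 := fun g h0 => hYle (c g) (fun a ha =>
    mem_coordHyperplane.2 (by simpa [h0] using hca g ⟨a, ha⟩)) h0
  have hcinj : Function.Injective c := by
    intro g g' hgg
    ext a
    have h1 := hca g a
    have h2 := hca g' a
    rw [← hgg] at h2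
    exact mul_right_cancel₀ (hcz g) (by linear_combination h1 - h2)
  have hfin : Finite (Dual F A₀) := Finite.of_injective c hcinj
  have hcard := Nat.card_le_card_of_injective c hcinj
  have hfr : finrank F (Dual F A₀) = k := by rw [Subspace.dual_finrank_eq, hA₀]
  have hnt : Nontrivial (Dual F A₀) := Module.nontrivial_of_finrank_pos (R := F) (by omega)
  obtain ⟨g₀, hg₀⟩ := exists_ne (0 : Dual F A₀)
  have hFf : Finite F := Finite.of_injective (fun r : F => r • g₀) (smul_left_injective F hg₀)
  rw [Module.natCard_eq_pow_finrank (K := F), hfr, Nat.card_fin] at hcard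
  rw [ENat.card_eq_coe_natCard, Nat.cast_lt] at hF
  have := add_le_pow_of_three_le (q := Nat.card F) (k := k) (by omega) hk
  omega

theorem card_le_coordHyperplane (M : Submodule F (Fin n → F)) :
    finrank F M + Nat.card {i : Fin n // M ≤ coordHyperplane F i} ≤ n := by
  classical
  let r := LinearMap.funLeft F F (Subtype.val : {i : Fin n // M ≤ coordHyperplane F i} → Fin n)
  have hr : LinearMap.range r = ⊤ := LinearMap.range_eq_top.2
    (LinearMap.funLeft_surjective_of_injective F F _ Subtype.val_injective)
  have h := LinearMap.finrank_range_add_finrank_ker r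
  rw [hr, finrank_top, finrank_fin_fun, finrank_fintype_fun_eq_card] at h
  have hle : M ≤ LinearMap.ker r := fun v hv => funext fun i => i.2 hv
  have := Submodule.finrank_mono hle
  rw [Nat.card_eq_fintype_card]
  omega

/-- The pencil between `M` and `Y` has `|F| + 1` members. If all were degenerate, they would lie in
different coordinate hyperplanes, since one containing two of them contains `Y`. All these
hyperplanes contain `M`, and there are at most `n - k + 1` such. This is where `|F| > n - k` is
needed exactly. -/
theorem exists_hyperplane_of_pencil {k : ℕ} (hkn : k + 1 < n)
    (hF : ((n - k : ℕ) : ℕ∞) < ENat.card F) {M Y : Submodule F (Fin n → F)} (hMY : M ≤ Y)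
    (hM : finrank F M + 1 = k) (hY : finrank F Y = k + 1) (hYd : ¬ IsDegenerate Y) :
    ∃ B : Submodule F (Fin n → F), M ≤ B ∧ B ≤ Y ∧ finrank F B = k ∧ ¬ IsDegenerate B := by
  by_contra! hcon
  have hMY' : ¬ Y ≤ M := fun h => by
    have := Submodule.finrank_mono h
    omega
  obtain ⟨u, huY, huM⟩ := SetLike.not_le_iff_exists.1 hMY'
  have hMu : finrank F (M ⊔ F ∙ u : Submodule F (Fin n → F)) = k := by
    rw [Submodule.finrank_sup_span_singleton huM, hM]
  have hMuY : ¬ Y ≤ M ⊔ F ∙ u := fun h => by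
    have := Submodule.finrank_mono h
    omega
  obtain ⟨w, hwY, hwM⟩ := SetLike.not_le_iff_exists.1 hMuY
  have hsup : (M ⊔ F ∙ u) ⊔ F ∙ w = Y := by
    refine Submodule.eq_of_le_of_finrank_eq ?_ ?_
    · exact sup_le (sup_le hMY (by simpa using huY)) (by simpa using hwY)
    · rw [Submodule.finrank_sup_span_singleton hwM, hMu, hY]
  -- `none` stands for the point at infinity of the pencil, so that `Option F` indexes all `|F| + 1`
  -- members.
  let p : Option F → (Fin n → F) := fun t => t.elim w fun t => u + t • w
  have hpY : ∀ t, p t ∈ Y := by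
    rintro (_ | t)
    · exact hwY
    · exact Y.add_mem huY (Y.smul_mem t hwY)
  have hpM : ∀ t, p t ∉ M := by
    rintro (_ | t) h
    · exact hwM (Submodule.mem_sup_left h)
    · by_cases ht : t = 0
      · exact huM (by simpa [p, ht] using h)
      · apply hwM
        have h1 : w = t⁻¹ • (p (some t) - u) := by simp [p, ht]
        rw [h1]
        exact Submodule.smul_mem _ _ (Submodule.sub_mem _ (Submodule.mem_sup_left h)
          (Submodule.mem_sup_right (Submodule.mem_span_singleton_self u)))
  have hdeg : ∀ t, IsDegenerate (M ⊔ F ∙ p t) := fun t => by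
    by_contra hnd
    refine hnd (hcon _ le_sup_left (sup_le hMY (by simpa using hpY t)) ?_)
    rw [Submodule.finrank_sup_span_singleton (hpM t), hM]
  choose c hc using hdeg
  have hcM : ∀ t, M ≤ coordHyperplane F (c t) := fun t => le_sup_left.trans (hc t)
  have hcp : ∀ t, p t (c t) = 0 := fun t =>
    hc t (Submodule.mem_sup_right (Submodule.mem_span_singleton_self _))
  have hnot : ∀ i, M ≤ coordHyperplane F i → u i = 0 → w i = 0 → False := fun i hi hu hw =>
    hYd ⟨i, hsup ▸ sup_le (sup_le hi (span_le_coordHyperplane.2 hu)) (span_le_coordHyperplane.2 hw)⟩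
  have hcinj : Function.Injective fun t => (⟨c t, hcM t⟩ :
      {i : Fin n // M ≤ coordHyperplane F i}) := by
    intro s t hst
    have hst' : c s = c t := congrArg Subtype.val hst
    have h1 := hcp s
    have h2 := hcp t
    rw [hst'] at h1
    by_contra hne
    rcases s with _ | s <;> rcases t with _ | t
    · exact hne rfl
    · exact hnot _ (hcM _) (by simpa [p, show w (c (some t)) = 0 from h1] using h2) h1
    · exact hnot _ (hcM _) (by simpa [p, show w (c none) = 0 from h2] using h1) h2
    · have h1' : u (c (some t)) + s * w (c (some t)) = 0 := h1
      have h2' : u (c (some t)) + t * w (c (some t)) = 0 := h2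
      have h3 : w (c (some t)) = 0 := by
        have : (s - t) * w (c (some t)) = 0 := by linear_combination h1' - h2'
        refine (mul_eq_zero.1 this).resolve_left (sub_ne_zero.2 fun h => hne (by rw [h]))
      exact hnot _ (hcM _) (by simpa [h3] using h1') h3
  have hfin : Finite (Option F) := Finite.of_injective _ hcinj
  have hFf : Finite F := Finite.of_injective some (Option.some_injective F)
  have hcard := Nat.card_le_card_of_injective _ hcinj
  rw [ENat.card_eq_coe_natCard, Nat.cast_lt] at hF
  have h1 := card_le_coordHyperplane M
  have h2 : Nat.card (Option F) = Nat.card F + 1 := Finite.card_option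
  omega

/-- A transvection `x ↦ x + f x • y` moves `X` off every coordinate hyperplane containing it: `y` is
the indicator of the coordinates vanishing on `X`, and `f` kills `y` but not a chosen vector of `X`.
The other coordinates are untouched, and the image stays in `X ⊔ F ∙ y`. -/
theorem exists_nondegenerate_adjacent {X : Submodule F (Fin n → F)} (hX0 : X ≠ ⊥)
    (hX : IsDegenerate X) :
    ∃ X' : Submodule F (Fin n → F), finrank F X' = finrank F X ∧ ¬ IsDegenerate X' ∧
      finrank F (X ⊔ X' : Submodule F (Fin n → F)) = finrank F X + 1 := by
  classical
  obtain ⟨i₀, hi₀⟩ := hX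
  obtain ⟨x₀, hx₀, hx₀0⟩ := X.ne_bot_iff.1 hX0
  let y : Fin n → F := fun i => if X ≤ coordHyperplane F i then 1 else 0
  have hyX : y ∉ X := fun h => by
    have : y i₀ = 0 := hi₀ h
    simp [y, hi₀] at this
  have hxy : x₀ ∉ F ∙ y := fun h => by
    obtain ⟨c, rfl⟩ := Submodule.mem_span_singleton.1 h
    have h1 : (c • y) i₀ = 0 := hi₀ hx₀
    have hc : c = 0 := by simpa [y, hi₀] using h1
    exact hx₀0 (by simp [hc])
  obtain ⟨f, hfx, hfy⟩ := Submodule.exists_le_ker_of_notMem hxy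
  have hfy0 : f y = 0 := hfy (Submodule.mem_span_singleton_self y)
  let T : (Fin n → F) →ₗ[F] (Fin n → F) := LinearMap.id + f.smulRight y
  have hT : ∀ x, T x = x + f x • y := fun x => rfl
  have hTinj : Function.Injective T := by
    rw [← LinearMap.ker_eq_bot, LinearMap.ker_eq_bot']
    intro x hx
    rw [hT] at hx
    have h1 : f x = 0 := by simpa [hfy0] using congrArg f hx
    simpa [h1] using hx
  have hr : finrank F (X.map T) = finrank F X := (Submodule.equivMapOfInjective T hTinj X).finrank_eq.symm
  have hnd : ¬ IsDegenerate (X.map T) := by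
    rintro ⟨j, hj⟩
    by_cases hXj : X ≤ coordHyperplane F j
    · have h1 : T x₀ j = 0 := hj (Submodule.mem_map_of_mem hx₀)
      have h2 : x₀ j = 0 := hXj hx₀
      apply hfx
      simpa [hT, h2, y, hXj] using h1
    · apply hXj
      intro x hx
      have h1 : T x j = 0 := hj (Submodule.mem_map_of_mem hx)
      rw [mem_coordHyperplane]
      simpa [hT, y, hXj] using h1
  refine ⟨X.map T, hr, hnd, ?_⟩
  have hle : X.map T ≤ X ⊔ F ∙ y := by
    rintro _ ⟨x, hx, rfl⟩
    rw [hT]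
    exact Submodule.add_mem_sup hx (Submodule.smul_mem _ _ (Submodule.mem_span_singleton_self y))
  have hne : X ≠ X.map T := fun h => hnd (h ▸ ⟨i₀, hi₀⟩)
  rw [sup_eq_of_le_of_finrank rfl hr (Submodule.finrank_sup_span_singleton hyX) le_sup_left hle hne,
    Submodule.finrank_sup_span_singleton hyX]

end Coordinates

/-! ### Maximal cliques, lines and their types in a model of `Δ_k` -/

/-- `ρ` identifies the graph `G` with the graph of non-degenerate `k`-dimensional subspaces of
`F^n`, in the range of parameters where this graph determines the Grassmann graph. -/
structure IsNondegModel {F : Type*} [Field F] {n : ℕ} {W : Type*} (G : SimpleGraph W) (k : ℕ)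
    (ρ : W → Submodule F (Fin n → F)) : Prop where
  one_lt : 1 < k
  add_one_lt : k + 1 < n
  lt_card : ((n - k : ℕ) : ℕ∞) < ENat.card F
  injective : Function.Injective ρ
  finrank_eq : ∀ w, finrank F (ρ w) = k
  nondeg : ∀ w, ¬ IsDegenerate (ρ w)
  surjective : ∀ A : Submodule F (Fin n → F), finrank F A = k → ¬ IsDegenerate A → ∃ w, ρ w = A
  adj_iff : ∀ a b, G.Adj a b ↔ finrank F (ρ a ⊓ ρ b : Submodule F (Fin n → F)) + 1 = k

theorem ne_top_of_finrank_lt {F : Type*} [Field F] {n : ℕ} {U : Submodule F (Fin n → F)}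
    (h : finrank F U < n) : U ≠ ⊤ := by
  rintro rfl
  simp at h

theorem IsLine.encard_ne_one {W : Type*} {G : SimpleGraph W} {l : Set W} (h : IsLine G l) :
    l.encard ≠ 1 := by
  intro h1
  obtain ⟨w, rfl⟩ := Set.encard_eq_one.1 h1
  exact absurd h.1 Set.not_nontrivial_singleton

section Model

variable {F : Type*} [Field F] {n : ℕ} {W : Type*} {G : SimpleGraph W} {k : ℕ}
  {ρ : W → Submodule F (Fin n → F)}

/-- The vertices represented by subspaces containing `X`. -/
def modelStar (ρ : W → Submodule F (Fin n → F)) (X : Submodule F (Fin n → F)) : Set W :=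
  {w | X ≤ ρ w}

/-- The vertices represented by subspaces contained in `Y`. -/
def modelTop (ρ : W → Submodule F (Fin n → F)) (Y : Submodule F (Fin n → F)) : Set W :=
  {w | ρ w ≤ Y}

theorem mem_modelStar {X : Submodule F (Fin n → F)} {w : W} : w ∈ modelStar ρ X ↔ X ≤ ρ w :=
  Iff.rfl

theorem mem_modelTop {Y : Submodule F (Fin n → F)} {w : W} : w ∈ modelTop ρ Y ↔ ρ w ≤ Y :=
  Iff.rfl

namespace IsNondegModel

variable (hM : IsNondegModel G k ρ)
include hM

theorem three_le_card : 3 ≤ ENat.card F := by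
  have h1 := hM.lt_card
  have h2 := hM.add_one_lt
  have h3 : ((2 : ℕ) : ℕ∞) ≤ ((n - k : ℕ) : ℕ∞) := by exact_mod_cast (by omega : 2 ≤ n - k)
  exact Order.add_one_le_of_lt (h3.trans_lt h1)

theorem subspace_ne {a b : W} (h : a ≠ b) : ρ a ≠ ρ b := hM.injective.ne h

theorem eq_of_le {a b : W} (h : ρ a ≤ ρ b) : a = b :=
  hM.injective (Submodule.eq_of_le_of_finrank_eq h (by rw [hM.finrank_eq, hM.finrank_eq]))

theorem inf_eq {a b : W} (hab : a ≠ b) {X : Submodule F (Fin n → F)} (hX : finrank F X + 1 = k)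
    (ha : X ≤ ρ a) (hb : X ≤ ρ b) : ρ a ⊓ ρ b = X :=
  inf_eq_of_le_of_finrank (hM.finrank_eq a) (hM.finrank_eq b) hX ha hb (hM.subspace_ne hab)

theorem sup_eq {a b : W} (hab : a ≠ b) {Y : Submodule F (Fin n → F)} (hY : finrank F Y = k + 1)
    (ha : ρ a ≤ Y) (hb : ρ b ≤ Y) : ρ a ⊔ ρ b = Y :=
  sup_eq_of_le_of_finrank (hM.finrank_eq a) (hM.finrank_eq b) hY ha hb (hM.subspace_ne hab)

/-- Adjoining to `X` a vector without zero coordinates makes it non-degenerate at once, and such a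
vector can be chosen outside any proper subspace. -/
theorem exists_notMem_sup_span {X U : Submodule F (Fin n → F)} (hXU : X ≤ U) (hU : U ≠ ⊤) :
    ∃ Z : Submodule F (Fin n → F), X ≤ Z ∧ finrank F Z = finrank F X + 1 ∧ ¬ IsDegenerate Z ∧
      ¬ Z ≤ U := by
  obtain ⟨v, hv, hv0⟩ := exists_forall_ne_zero_notMem hM.three_le_card hU
  have hvm : v ∈ X ⊔ F ∙ v := Submodule.mem_sup_right (Submodule.mem_span_singleton_self v)
  exact ⟨X ⊔ F ∙ v, le_sup_left,
    Submodule.finrank_sup_span_singleton fun h => hv (hXU h), not_isDegenerate_of_mem hvm hv0,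
    fun h => hv (h hvm)⟩

theorem exists_mem_star {X U : Submodule F (Fin n → F)} (hX : finrank F X + 1 = k) (hXU : X ≤ U)
    (hU : U ≠ ⊤) : ∃ w ∈ modelStar ρ X, ¬ ρ w ≤ U := by
  obtain ⟨Z, hXZ, hZ, hZd, hZU⟩ := hM.exists_notMem_sup_span hXU hU
  obtain ⟨w, rfl⟩ := hM.surjective Z (by omega) hZd
  exact ⟨w, hXZ, hZU⟩

theorem exists_pair_star {X : Submodule F (Fin n → F)} (hX : finrank F X + 1 = k) :
    ∃ a ∈ modelStar ρ X, ∃ b ∈ modelStar ρ X, a ≠ b := by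
  have hkn := hM.add_one_lt
  obtain ⟨a, ha, -⟩ := hM.exists_mem_star hX le_rfl (ne_top_of_finrank_lt (by omega))
  obtain ⟨b, hb, hab⟩ := hM.exists_mem_star hX ha
    (ne_top_of_finrank_lt (by rw [hM.finrank_eq]; omega))
  exact ⟨a, ha, b, hb, fun h => hab (h ▸ le_rfl)⟩

theorem exists_mem_top {Y : Submodule F (Fin n → F)} (hY : finrank F Y = k + 1)
    (hYd : ¬ IsDegenerate Y) {z : Fin n → F} (hz : z ∈ Y) (hz0 : z ≠ 0) :
    ∃ w ∈ modelTop ρ Y, z ∉ ρ w := by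
  obtain ⟨A, hAY, hA, hAd, hzA⟩ :=
    exists_hyperplane_notMem hM.one_lt hM.add_one_lt hM.lt_card hY hYd hz hz0
  obtain ⟨w, rfl⟩ := hM.surjective A hA hAd
  exact ⟨w, hAY, hzA⟩

theorem exists_pair_top {Y : Submodule F (Fin n → F)} (hY : finrank F Y = k + 1)
    (hYd : ¬ IsDegenerate Y) : ∃ a ∈ modelTop ρ Y, ∃ b ∈ modelTop ρ Y, a ≠ b := by
  have hk := hM.one_lt
  obtain ⟨z, hz, hz0⟩ := Y.ne_bot_iff.1 fun h => by rw [h, finrank_bot] at hY; omega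
  obtain ⟨a, ha, -⟩ := hM.exists_mem_top hY hYd hz hz0
  obtain ⟨z, hz, hz0⟩ := (ρ a).ne_bot_iff.1 fun h => by
    have := hM.finrank_eq a
    rw [h, finrank_bot] at this
    omega
  obtain ⟨b, hb, hab⟩ := hM.exists_mem_top hY hYd (ha hz) hz0
  exact ⟨a, ha, b, hb, fun h => hab (h ▸ hz)⟩

theorem adj_of_star {X : Submodule F (Fin n → F)} (hX : finrank F X + 1 = k) {a b : W}
    (ha : a ∈ modelStar ρ X) (hb : b ∈ modelStar ρ X) (hab : a ≠ b) : G.Adj a b := by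
  rw [hM.adj_iff, hM.inf_eq hab hX ha hb, hX]

theorem adj_of_top {Y : Submodule F (Fin n → F)} (hY : finrank F Y = k + 1) {a b : W}
    (ha : a ∈ modelTop ρ Y) (hb : b ∈ modelTop ρ Y) (hab : a ≠ b) : G.Adj a b := by
  rw [hM.adj_iff]
  exact finrank_inf_add_one_of_le_of_le (hM.finrank_eq a) (hM.finrank_eq b) hY ha hb
    (hM.subspace_ne hab)

/-- The centre of a star is the intersection of any two of its members. -/
theorem star_subset_star {X X' : Submodule F (Fin n → F)} (hX : finrank F X + 1 = k)
    (hX' : finrank F X' + 1 = k) (h : modelStar ρ X ⊆ modelStar ρ X') : X = X' := by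
  obtain ⟨a, ha, b, hb, hab⟩ := hM.exists_pair_star hX
  rw [← hM.inf_eq hab hX ha hb, ← hM.inf_eq hab hX' (h ha) (h hb)]

theorem top_subset_top {Y Y' : Submodule F (Fin n → F)} (hY : finrank F Y = k + 1)
    (hY' : finrank F Y' = k + 1) (hYd : ¬ IsDegenerate Y) (h : modelTop ρ Y ⊆ modelTop ρ Y') :
    Y = Y' := by
  obtain ⟨a, ha, b, hb, hab⟩ := hM.exists_pair_top hY hYd
  rw [← hM.sup_eq hab hY ha hb, ← hM.sup_eq hab hY' (h ha) (h hb)]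

theorem not_star_subset_top {X Y : Submodule F (Fin n → F)} (hX : finrank F X + 1 = k)
    (hY : finrank F Y = k + 1) : ¬ modelStar ρ X ⊆ modelTop ρ Y := by
  intro h
  have hkn := hM.add_one_lt
  obtain ⟨a, ha, -⟩ := hM.exists_pair_star hX
  obtain ⟨b, hb, hbY⟩ := hM.exists_mem_star hX (ha.trans (h ha))
    (ne_top_of_finrank_lt (by omega))
  exact hbY (h hb)

theorem not_top_subset_star {X Y : Submodule F (Fin n → F)} (hX : X ≠ ⊥)
    (hY : finrank F Y = k + 1) (hYd : ¬ IsDegenerate Y) : ¬ modelTop ρ Y ⊆ modelStar ρ X := by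
  intro h
  obtain ⟨a, ha, -⟩ := hM.exists_pair_top hY hYd
  obtain ⟨z, hz, hz0⟩ := X.ne_bot_iff.1 hX
  obtain ⟨b, hb, hbz⟩ := hM.exists_mem_top hY hYd (ha (h ha hz)) hz0
  exact hbz (h hb hz)

theorem ne_bot_of_finrank {X : Submodule F (Fin n → F)} (hX : finrank F X + 1 = k) : X ≠ ⊥ := by
  have := hM.one_lt
  rintro rfl
  rw [finrank_bot] at hX
  omega

theorem star_ne_top {X Y : Submodule F (Fin n → F)} (hX : finrank F X + 1 = k)
    (hY : finrank F Y = k + 1) : modelStar ρ X ≠ modelTop ρ Y := fun h =>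
  hM.not_star_subset_top hX hY h.subset

theorem isClique_star {X : Submodule F (Fin n → F)} (hX : finrank F X + 1 = k) :
    G.IsClique (modelStar ρ X) := fun _ ha _ hb hab => hM.adj_of_star hX ha hb hab

theorem isClique_top {Y : Submodule F (Fin n → F)} (hY : finrank F Y = k + 1) :
    G.IsClique (modelTop ρ Y) := fun _ ha _ hb hab => hM.adj_of_top hY ha hb hab

theorem isClique_subset {K : Set W} (hK : G.IsClique K) :
    (∃ X : Submodule F (Fin n → F), finrank F X + 1 = k ∧ K ⊆ modelStar ρ X) ∨
      ∃ Y : Submodule F (Fin n → F), finrank F Y = k + 1 ∧ K ⊆ modelTop ρ Y := by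
  have hk := hM.one_lt
  have hkn := hM.add_one_lt
  rcases exists_common_le_or_le (F := F) (V := Fin n → F) (k := k) hk.le
    (by rw [finrank_fin_fun]; omega) (ρ '' K) (by rintro _ ⟨w, -, rfl⟩; exact hM.finrank_eq w)
    (by
      rintro _ ⟨a, ha, rfl⟩ _ ⟨b, hb, rfl⟩ hab
      exact (hM.adj_iff a b).1 (hK ha hb fun h => hab (h ▸ rfl))) with
    ⟨X, hX, h⟩ | ⟨Y, hY, h⟩
  · exact Or.inl ⟨X, hX, fun w hw => h _ ⟨w, hw, rfl⟩⟩
  · exact Or.inr ⟨Y, hY, fun w hw => h _ ⟨w, hw, rfl⟩⟩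

theorem isMaxClique_star {X : Submodule F (Fin n → F)} (hX : finrank F X + 1 = k) :
    IsMaxClique G (modelStar ρ X) := by
  refine ⟨hM.isClique_star hX, fun K hK hXK => ?_⟩
  rcases hM.isClique_subset hK with ⟨X', hX', h⟩ | ⟨Y, hY, h⟩
  · exact hM.star_subset_star hX hX' (hXK.trans h) ▸ h
  · exact absurd (hXK.trans h) (hM.not_star_subset_top hX hY)

theorem isMaxClique_top {Y : Submodule F (Fin n → F)} (hY : finrank F Y = k + 1)
    (hYd : ¬ IsDegenerate Y) : IsMaxClique G (modelTop ρ Y) := by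
  refine ⟨hM.isClique_top hY, fun K hK hXK => ?_⟩
  rcases hM.isClique_subset hK with ⟨X, hX, h⟩ | ⟨Y', hY', h⟩
  · exact absurd (hXK.trans h) (hM.not_top_subset_star (hM.ne_bot_of_finrank hX) hY hYd)
  · exact hM.top_subset_top hY hY' hYd (hXK.trans h) ▸ h

theorem exists_finrank_star : ∃ X : Submodule F (Fin n → F), finrank F X + 1 = k := by
  have hk := hM.one_lt
  have hkn := hM.add_one_lt
  obtain ⟨X, -, -, hX⟩ := exists_submodule_finrank_between
    (bot_le : (⊥ : Submodule F (Fin n → F)) ≤ ⊤) (d := k - 1) (by simp)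
    (by rw [finrank_top, finrank_fin_fun]; omega)
  exact ⟨X, by omega⟩

/-- The asymmetry between the cases is genuine: a degenerate `X` still has many non-degenerate
subspaces above it, whereas a degenerate `Y` has none below it. -/
theorem isMaxClique_iff {K : Set W} : IsMaxClique G K ↔
    (∃ X : Submodule F (Fin n → F), finrank F X + 1 = k ∧ K = modelStar ρ X) ∨
      ∃ Y : Submodule F (Fin n → F), finrank F Y = k + 1 ∧ ¬ IsDegenerate Y ∧ K = modelTop ρ Y := by
  constructor
  · intro hK
    rcases hM.isClique_subset hK.1 with ⟨X, hX, h⟩ | ⟨Y, hY, h⟩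
    · exact Or.inl ⟨X, hX, h.antisymm (hK.2 (hM.isClique_star hX) h)⟩
    · have hKY := h.antisymm (hK.2 (hM.isClique_top hY) h)
      refine Or.inr ⟨Y, hY, fun hYd => ?_, hKY⟩
      -- The empty set is a clique but not a maximal one, as stars are nonempty.
      have hempty : K = ∅ := by
        rw [Set.eq_empty_iff_forall_notMem]
        exact fun w hw => hM.nondeg w (hYd.mono (h hw))
      obtain ⟨X, hX⟩ := hM.exists_finrank_star
      obtain ⟨a, ha, -⟩ := hM.exists_pair_star hX
      have := hK.2 (hM.isClique_star hX) (by simp [hempty]) ha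
      simp [hempty] at this
  · rintro (⟨X, hX, rfl⟩ | ⟨Y, hY, hYd, rfl⟩)
    · exact hM.isMaxClique_star hX
    · exact hM.isMaxClique_top hY hYd

/-- Two vertices determine their intersection and their sum, so distinct stars, and likewise
distinct tops, share at most one vertex. -/
theorem isLine_iff {l : Set W} : IsLine G l ↔ l.Nontrivial ∧ ∃ X Y : Submodule F (Fin n → F), finrank F X + 1 = k ∧
    finrank F Y = k + 1 ∧ l = modelStar ρ X ∩ modelTop ρ Y := by
  constructor
  · rintro ⟨hl, K, L, hK, hL, hKL, rfl⟩
    refine ⟨hl, ?_⟩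
    obtain ⟨a, ⟨haK, haL⟩, b, ⟨hbK, hbL⟩, hab⟩ := hl
    rcases hM.isMaxClique_iff.1 hK with ⟨X, hX, rfl⟩ | ⟨Y, hY, hYd, rfl⟩ <;>
    rcases hM.isMaxClique_iff.1 hL with ⟨X', hX', rfl⟩ | ⟨Y', hY', hYd', rfl⟩
    · refine absurd ?_ hKL
      rw [← hM.inf_eq hab hX haK hbK, ← hM.inf_eq hab hX' haL hbL]
    · exact ⟨X, Y', hX, hY', rfl⟩
    · exact ⟨X', Y, hX', hY, Set.inter_comm _ _⟩
    · refine absurd ?_ hKL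
      rw [← hM.sup_eq hab hY haK hbK, ← hM.sup_eq hab hY' haL hbL]
  · rintro ⟨hl, X, Y, hX, hY, rfl⟩
    refine ⟨hl, _, _, hM.isMaxClique_star hX, hM.isMaxClique_top hY ?_, hM.star_ne_top hX hY, rfl⟩
    obtain ⟨a, ⟨-, ha⟩, -⟩ := hl
    exact fun h => hM.nondeg a (h.mono ha)

/-- The line of all subspaces between a non-degenerate `X` and `Y`. -/
theorem isLine_of_nondeg {X Y : Submodule F (Fin n → F)} (hX : finrank F X + 1 = k)
    (hXd : ¬ IsDegenerate X) (hY : finrank F Y = k + 1) (hXY : X ≤ Y) :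
    IsLine G (modelStar ρ X ∩ modelTop ρ Y) := by
  refine hM.isLine_iff.2 ⟨?_, X, Y, hX, hY, rfl⟩
  obtain ⟨A, hXA, hAY, hA⟩ := exists_submodule_finrank_between hXY (d := k) (by omega) (by omega)
  have hYA : ¬ Y ≤ A := fun h => by
    have := Submodule.finrank_mono h
    omega
  obtain ⟨v, hvY, hvA⟩ := SetLike.not_le_iff_exists.1 hYA
  obtain ⟨a, rfl⟩ := hM.surjective A hA fun h => hXd (h.mono hXA)
  obtain ⟨b, hb⟩ := hM.surjective (X ⊔ F ∙ v)
    (by rw [Submodule.finrank_sup_span_singleton fun h => hvA (hXA h), hX])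
    fun h => hXd (h.mono le_sup_left)
  refine ⟨a, ⟨hXA, hAY⟩, b, ⟨?_, ?_⟩, ?_⟩
  · rw [mem_modelStar, hb]
    exact le_sup_left
  · rw [mem_modelTop, hb]
    exact sup_le hXY (by simpa using hvY)
  · rintro rfl
    exact hvA (hb ▸ Submodule.mem_sup_right (Submodule.mem_span_singleton_self v))

theorem top_inter_maximalStar {X Y : Submodule F (Fin n → F)} (hX : finrank F X + 1 = k)
    (hXd : ¬ IsDegenerate X) (hY : finrank F Y = k + 1) :
    modelTop ρ Y ∩ modelStar ρ X = ∅ ∨ IsLine G (modelTop ρ Y ∩ modelStar ρ X) := by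
  rw [Set.inter_comm]
  by_cases hXY : X ≤ Y
  · exact Or.inr (hM.isLine_of_nondeg hX hXd hY hXY)
  · left
    rw [Set.eq_empty_iff_forall_notMem]
    exact fun w hw => hXY (hw.1.trans hw.2)

/-- For a non-degenerate `X'` adjacent to `X` in dimension `k - 1`, the only common member of the
two stars is `X ⊔ X'`. -/
theorem exists_maximalStar_inter {X : Submodule F (Fin n → F)} (hX : finrank F X + 1 = k)
    (hXd : IsDegenerate X) : ∃ X' : Submodule F (Fin n → F), finrank F X' + 1 = k ∧
      ¬ IsDegenerate X' ∧ ∃ w, modelStar ρ X ∩ modelStar ρ X' = {w} := by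
  obtain ⟨X', hX', hXd', hsup⟩ := exists_nondegenerate_adjacent (hM.ne_bot_of_finrank hX) hXd
  obtain ⟨w, hw⟩ := hM.surjective (X ⊔ X') (by omega) fun h => hXd' (h.mono le_sup_right)
  refine ⟨X', by omega, hXd', w, ?_⟩
  ext a
  constructor
  · intro ha
    exact (hM.eq_of_le (hw ▸ sup_le ha.1 ha.2)).symm
  · rintro rfl
    exact ⟨mem_modelStar.2 (hw ▸ le_sup_left), mem_modelStar.2 (hw ▸ le_sup_right)⟩

/-- The hypothesis `h` isolates the recognition of maximal stars, which depends on whether `F` is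
finite; the rest of the classification does not. -/
theorem recStars_eq {q : ℕ∞} (h : ∀ K, K ∈ recMaximalStars n k q G ↔
    ∃ X : Submodule F (Fin n → F), finrank F X + 1 = k ∧ ¬ IsDegenerate X ∧ K = modelStar ρ X) (K : Set W) :
    K ∈ recStars n k q G ↔ ∃ X : Submodule F (Fin n → F), finrank F X + 1 = k ∧ K = modelStar ρ X := by
  constructor
  · rintro ⟨hK, hKS⟩
    rcases hM.isMaxClique_iff.1 hK with hX | ⟨Y, hY, hYd, rfl⟩
    · exact hX
    · rcases hKS with hKS | ⟨S, hS, hKS⟩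
      · obtain ⟨X, hX, -, hXK⟩ := (h _).1 hKS
        exact ⟨X, hX, hXK⟩
      · obtain ⟨X, hX, hXd, rfl⟩ := (h _).1 hS
        rcases hM.top_inter_maximalStar hX hXd hY with h0 | h0
        · simp [h0] at hKS
        · exact absurd hKS (h0.encard_ne_one)
  · rintro ⟨X, hX, rfl⟩
    refine ⟨hM.isMaxClique_star hX, ?_⟩
    by_cases hXd : IsDegenerate X
    · obtain ⟨X', hX', hXd', w, hw⟩ := hM.exists_maximalStar_inter hX hXd
      exact Or.inr ⟨_, (h _).2 ⟨X', hX', hXd', rfl⟩, by rw [hw, Set.encard_singleton]⟩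
    · exact Or.inl ((h _).2 ⟨X, hX, hXd, rfl⟩)

theorem recTops_eq {q : ℕ∞} (h : ∀ K, K ∈ recMaximalStars n k q G ↔
    ∃ X : Submodule F (Fin n → F), finrank F X + 1 = k ∧ ¬ IsDegenerate X ∧ K = modelStar ρ X) (K : Set W) :
    K ∈ recTops n k q G ↔ ∃ Y : Submodule F (Fin n → F), finrank F Y = k + 1 ∧ ¬ IsDegenerate Y ∧ K = modelTop ρ Y := by
  constructor
  · rintro ⟨hK, hKS, hKl⟩
    rcases hM.isMaxClique_iff.1 hK with ⟨X, hX, rfl⟩ | hY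
    · by_cases hXd : IsDegenerate X
      · obtain ⟨X', hX', hXd', w, hw⟩ := hM.exists_maximalStar_inter hX hXd
        rcases hKl _ ((h _).2 ⟨X', hX', hXd', rfl⟩) with h0 | h0
        · simp [hw] at h0
        · rw [hw] at h0
          exact absurd (Set.encard_singleton w) (h0.encard_ne_one)
      · exact absurd ((h _).2 ⟨X, hX, hXd, rfl⟩) hKS
    · exact hY
  · rintro ⟨Y, hY, hYd, rfl⟩
    refine ⟨hM.isMaxClique_top hY hYd, fun hKS => ?_, fun S hS => ?_⟩
    · obtain ⟨X, hX, -, hXY⟩ := (h _).1 hKS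
      exact hM.star_ne_top hX hY hXY.symm
    · obtain ⟨X, hX, hXd, rfl⟩ := (h _).1 hS
      exact hM.top_inter_maximalStar hX hXd hY

end IsNondegModel

end Model

/-! ### General position over an infinite field -/

theorem mem_sup_span_singleton_iff {F : Type*} [Field F] {U : Type*} [AddCommGroup U] [Module F U]
    {X : Submodule F U} {u v : U} : u ∈ X ⊔ F ∙ v ↔ ∃ t : F, u - t • v ∈ X := by
  rw [Submodule.mem_sup]
  constructor
  · rintro ⟨x, hx, y, hy, rfl⟩
    obtain ⟨t, rfl⟩ := Submodule.mem_span_singleton.1 hy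
    exact ⟨t, by simpa using hx⟩
  · rintro ⟨t, ht⟩
    exact ⟨_, ht, t • v, Submodule.smul_mem _ _ (Submodule.mem_span_singleton_self _), by simp⟩

section InfiniteField

variable {F : Type*} [Field F] [Infinite F] {U : Type*} [AddCommGroup U] [Module F U]

/-- For each pair `i`, `j` at most one scalar is bad: two would put a nonzero multiple of `v` into
`H i`. -/
theorem exists_smul_add_notMem {ι κ : Type*} [Finite ι] [Finite κ] (H : ι → Submodule F U) {v : U}
    (hv : ∀ i, v ∉ H i) (u : κ → U) : ∃ t : F, t ≠ 0 ∧ ∀ i j, t • v + u j ∉ H i := by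
  have hfin : ({0} ∪ ⋃ p : ι × κ, {t : F | t • v + u p.2 ∈ H p.1}).Finite := by
    refine (Set.finite_singleton _).union (Set.finite_iUnion fun p => ?_)
    refine Set.Subsingleton.finite fun s hs t ht => ?_
    by_contra hst
    apply hv p.1
    have h1 : v = (s - t)⁻¹ • ((s • v + u p.2) - (t • v + u p.2)) := by
      rw [add_sub_add_right_eq_sub, ← sub_smul, smul_smul, inv_mul_cancel₀ (sub_ne_zero.2 hst),
        one_smul]
    rw [h1]
    exact Submodule.smul_mem _ _ (Submodule.sub_mem _ hs ht)
  obtain ⟨t, ht⟩ := hfin.exists_notMem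
  simp only [Set.mem_union, Set.mem_singleton_iff, Set.mem_iUnion, Set.mem_ofPred_eq, not_or,
    not_exists, Prod.forall] at ht
  exact ⟨t, ht⟩

/-- Over an infinite field no space is a finite union of proper subspaces; here `X` is added to the
family `H`. -/
theorem exists_notMem_of_ne_top {ι : Type*} [Finite ι] (H : ι → Submodule F U)
    (hH : ∀ i, H i ≠ ⊤) {X : Submodule F U} (hX : X ≠ ⊤) : ∃ v, v ∉ X ∧ ∀ i, v ∉ H i := by
  by_contra! hcon
  obtain ⟨i, hi⟩ := Subspace.exists_eq_top_of_iUnion_eq_univ (k := F) (E := U)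
    (p := fun o : Option ι => o.elim X H) (by
      refine Set.eq_univ_of_forall fun v => Set.mem_iUnion.2 ?_
      by_cases hv : v ∈ X
      · exact ⟨none, hv⟩
      · obtain ⟨i, hi⟩ := hcon v hv
        exact ⟨some i, hi⟩)
  rcases i with _ | i
  · exact hX hi
  · exact hH i hi

/-- A Veblen-Young configuration in general position with respect to finitely many proper
subspaces, except that the lines `a, a + w` and `b, b + w` meet in the prescribed point `w`. -/
theorem exists_veblen_configuration [FiniteDimensional F U] {ι : Type*} [Finite ι]
    (H : ι → Submodule F U) (hH : ∀ i, H i ≠ ⊤) {X : Submodule F U}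
    (hX : finrank F X + 3 ≤ finrank F U) {w : U} (hw : w ∉ X) :
    ∃ a b : U, (∀ α β γ : F, α • w + β • a + γ • b ∈ X → α = 0 ∧ β = 0 ∧ γ = 0) ∧ ∀ i, a ∉ H i ∧ a + w ∉ H i ∧ b ∉ H i ∧
      b + w ∉ H i ∧ a - b ∉ H i := by
  have hne : ∀ Z : Submodule F U, finrank F Z < finrank F U → Z ≠ ⊤ := by
    rintro _ h rfl
    simp at h
  have h1 := Submodule.finrank_sup_span_singleton hw
  have hscale : ∀ {t : F} {v : U} {Z : Submodule F U}, t ≠ 0 → v ∉ Z → t • v ∉ Z := by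
    intro t v Z ht hv h
    exact hv ((Submodule.smul_mem_iff _ ht).1 h)
  obtain ⟨a₀, ha₀, ha₀H⟩ := exists_notMem_of_ne_top H hH (hne (X ⊔ F ∙ w) (by omega))
  -- Rescaling preserves independence and avoidance of each `H i`, so it is free to be used to keep
  -- the translates out of the `H i` too.
  obtain ⟨t, ht, htH⟩ := exists_smul_add_notMem H ha₀H (fun _ : Unit => w)
  have ha : t • a₀ ∉ X ⊔ F ∙ w := hscale ht ha₀
  have h2 := Submodule.finrank_sup_span_singleton ha
  obtain ⟨b₀, hb₀, hb₀H⟩ := exists_notMem_of_ne_top H hH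
    (hne ((X ⊔ F ∙ w) ⊔ F ∙ (t • a₀)) (by omega))
  -- The two values of `j` take care of `b + w` and of `b - a` simultaneously.
  obtain ⟨r, hr, hrH⟩ := exists_smul_add_notMem H hb₀H (fun j : Bool => if j then w else -(t • a₀))
  have hb : r • b₀ ∉ (X ⊔ F ∙ w) ⊔ F ∙ (t • a₀) := hscale hr hb₀
  have hindep : ∀ α β γ : F, α • w + β • t • a₀ + γ • r • b₀ ∈ X → α = 0 ∧ β = 0 ∧ γ = 0 := by
    intro α β γ h
    have hwm : w ∈ X ⊔ F ∙ w := Submodule.mem_sup_right (Submodule.mem_span_singleton_self _)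
    have hγ : γ = 0 := by
      by_contra hγ
      apply hscale hγ hb
      refine (Submodule.add_mem_iff_right _ (x := α • w + β • t • a₀) ?_).1
        (Submodule.mem_sup_left (Submodule.mem_sup_left h))
      exact Submodule.add_mem _ (Submodule.mem_sup_left (Submodule.smul_mem _ _ hwm))
        (Submodule.smul_mem _ _ (Submodule.mem_sup_right (Submodule.mem_span_singleton_self _)))
    rw [hγ, zero_smul, add_zero] at h
    have hβ : β = 0 := by
      by_contra hβ
      apply hscale hβ ha
      exact (Submodule.add_mem_iff_right _ (Submodule.smul_mem _ α hwm)).1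
        (Submodule.mem_sup_left h)
    rw [hβ, zero_smul, add_zero] at h
    refine ⟨?_, hβ, hγ⟩
    by_contra hα
    exact hscale hα hw h
  refine ⟨t • a₀, r • b₀, hindep, fun i => ⟨hscale ht (ha₀H i), htH i (),
    hscale hr (hb₀H i), by simpa using hrH i true, fun h => hrH i false ?_⟩⟩
  simpa [sub_eq_add_neg, add_comm] using (H i).neg_mem h

end InfiniteField

/-! ### Maximal stars are projective spaces, degenerate stars are not -/

section ProjectiveSpace

variable {F : Type*} [Field F] {n : ℕ} {W : Type*} {G : SimpleGraph W} {k : ℕ}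
  {ρ : W → Submodule F (Fin n → F)}

/-- The vertices on the line through two adjacent vertices. -/
def modelLine (ρ : W → Submodule F (Fin n → F)) (a b : W) : Set W :=
  modelStar ρ (ρ a ⊓ ρ b) ∩ modelTop ρ (ρ a ⊔ ρ b)

theorem modelLine_subset_star {a b : W} {X : Submodule F (Fin n → F)} (ha : a ∈ modelStar ρ X)
    (hb : b ∈ modelStar ρ X) : modelLine ρ a b ⊆ modelStar ρ X :=
  fun _ hc => mem_modelStar.2 ((le_inf ha hb).trans hc.1)

theorem modelLine_subset_top {a b : W} {Y : Submodule F (Fin n → F)} (ha : a ∈ modelTop ρ Y)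
    (hb : b ∈ modelTop ρ Y) : modelLine ρ a b ⊆ modelTop ρ Y :=
  fun _ hc => mem_modelTop.2 (hc.2.trans (sup_le ha hb))

theorem left_mem_modelLine (a b : W) : a ∈ modelLine ρ a b :=
  ⟨mem_modelStar.2 inf_le_left, mem_modelTop.2 le_sup_left⟩

theorem right_mem_modelLine (a b : W) : b ∈ modelLine ρ a b :=
  ⟨mem_modelStar.2 inf_le_right, mem_modelTop.2 le_sup_right⟩

namespace IsNondegModel

variable (hM : IsNondegModel G k ρ)
include hM

theorem isLine_modelLine {a b : W} (h : G.Adj a b) : IsLine G (modelLine ρ a b) := by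
  have h1 := (hM.adj_iff a b).1 h
  exact hM.isLine_iff.2 ⟨⟨a, left_mem_modelLine a b, b, right_mem_modelLine a b, h.ne⟩,
    _, _, h1, (finrank_inf_add_one_iff (hM.finrank_eq a) (hM.finrank_eq b)).1 h1, rfl⟩

theorem eq_modelLine {l : Set W} (hl : IsLine G l) {a b : W} (ha : a ∈ l) (hb : b ∈ l)
    (hab : a ≠ b) : l = modelLine ρ a b := by
  obtain ⟨-, X, Y, hX, hY, rfl⟩ := hM.isLine_iff.1 hl
  rw [modelLine, hM.inf_eq hab hX ha.1 hb.1, hM.sup_eq hab hY ha.2 hb.2]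

/-- Every `k`-subspace through a non-degenerate `X` is non-degenerate, so the star is the whole
projective space of `V/X`. -/
theorem isProjectiveSpace_star {X : Submodule F (Fin n → F)}
    (hX : finrank F X + 1 = k) (hXd : ¬ IsDegenerate X) :
    IsProjectiveSpace G (modelStar ρ X) where
  exists_unique_line a ha b hb hab := by
    refine ⟨modelLine ρ a b, ⟨⟨hM.isLine_modelLine (hM.adj_of_star hX ha hb hab),
      modelLine_subset_star ha hb⟩, left_mem_modelLine a b, right_mem_modelLine a b⟩, ?_⟩
    rintro l ⟨⟨hl, -⟩, hal, hbl⟩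
    exact hM.eq_modelLine hl hal hbl hab
  veblen a b c d hnd l₁ l₂ m₁ m₂ hl₁ hl₂ hm₁ hm₂ ha₁ hb₁ hc₂ hd₂ ha hc hb hd := by
    rintro ⟨p, hp₁, hp₂⟩
    simp only [List.nodup_cons, List.mem_cons, List.not_mem_nil, or_false, not_or] at hnd
    obtain ⟨⟨hab, hac, had⟩, ⟨hbc, hbd⟩, hcd, -⟩ := hnd
    have hX' : ∀ {x y}, x ≠ y → x ∈ modelStar ρ X → y ∈ modelStar ρ X →
        finrank F (ρ x ⊔ ρ y : Submodule F (Fin n → F)) = k + 1 := fun hxy hx hy =>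
      (finrank_inf_add_one_iff (hM.finrank_eq _) (hM.finrank_eq _)).1
        (by rw [hM.inf_eq hxy hX hx hy, hX])
    have haX := hl₁.2 ha₁
    have hbX := hl₁.2 hb₁
    have hcX := hl₂.2 hc₂
    have hdX := hl₂.2 hd₂
    rw [hM.eq_modelLine hl₁.1 ha₁ hb₁ hab] at hp₁
    rw [hM.eq_modelLine hl₂.1 hc₂ hd₂ hcd] at hp₂
    rw [hM.eq_modelLine hm₁.1 ha hc hac, hM.eq_modelLine hm₂.1 hb hd hbd]
    -- The lines `ab` and `cd` share `ρ p`, so all four points span dimension at most `k + 2`. The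
    -- same span then forces `ρ a ⊔ ρ c` and `ρ b ⊔ ρ d` to meet in dimension at least `k`.
    have h1 := Submodule.finrank_sup_add_finrank_inf_eq (ρ a ⊔ ρ b) (ρ c ⊔ ρ d)
    have h2 := Submodule.finrank_sup_add_finrank_inf_eq (ρ a ⊔ ρ c) (ρ b ⊔ ρ d)
    have h3 := Submodule.finrank_mono (le_inf hp₁.2 hp₂.2)
    rw [hX' hab haX hbX, hX' hcd hcX hdX] at h1
    rw [hX' hac haX hcX, hX' hbd hbX hdX, sup_sup_sup_comm] at h2
    rw [hM.finrank_eq] at h3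
    obtain ⟨Z, hXZ, hZ, hZk⟩ := exists_submodule_finrank_between
      (show X ≤ (ρ a ⊔ ρ c) ⊓ (ρ b ⊔ ρ d) from
        le_inf (le_sup_of_le_left haX) (le_sup_of_le_left hbX)) (d := k) (by omega) (by omega)
    obtain ⟨z, rfl⟩ := hM.surjective Z hZk fun h => hXd (h.mono hXZ)
    refine ⟨z, ⟨?_, hZ.trans inf_le_left⟩, ⟨?_, hZ.trans inf_le_right⟩⟩
    · rw [hM.inf_eq hac hX haX hcX]
      exact hXZ
    · rw [hM.inf_eq hbd hX hbX hdX]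
      exact hXZ
  three_points l hl hlX := by
    obtain ⟨a, ha, b, hb, hab⟩ := hl.1
    have haX := hlX ha
    have hbX := hlX hb
    have hinf := hM.inf_eq hab hX haX hbX
    obtain ⟨u, hua, hub⟩ := SetLike.not_le_iff_exists.1 fun h => hab (hM.eq_of_le h)
    obtain ⟨v, hvb, hva⟩ := SetLike.not_le_iff_exists.1 fun h => hab (hM.eq_of_le h).symm
    -- `X ⊔ F ∙ (u + v)` is a third point of the line, since `u + v` lies in neither of the first
    -- two.
    have huva : u + v ∉ ρ a := fun h => hva ((Submodule.add_mem_iff_right _ hua).1 h)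
    have huvb : u + v ∉ ρ b := fun h => hub ((Submodule.add_mem_iff_left _ hvb).1 h)
    obtain ⟨c, hc⟩ := hM.surjective (X ⊔ F ∙ (u + v))
      (by rw [Submodule.finrank_sup_span_singleton fun h => huva (haX h), hX])
      fun h => hXd (h.mono le_sup_left)
    have huvc : u + v ∈ ρ c :=
      hc ▸ Submodule.mem_sup_right (Submodule.mem_span_singleton_self _)
    have hcl : c ∈ l := by
      rw [hM.eq_modelLine hl ha hb hab]
      refine ⟨?_, ?_⟩
      · rw [hinf, mem_modelStar, hc]
        exact le_sup_left
      · rw [mem_modelTop, hc]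
        refine sup_le (le_sup_of_le_left haX) ?_
        rw [Submodule.span_singleton_le_iff_mem]
        exact Submodule.add_mem_sup hua hvb
    have hac : a ≠ c := by rintro rfl; exact huva huvc
    have hbc : b ≠ c := by rintro rfl; exact huvb huvc
    have h3 : ({a, b, c} : Set W).encard = 3 := Set.encard_eq_three.2 ⟨a, b, c, hab, hac, hbc, rfl⟩
    rw [← h3]
    refine Set.encard_le_encard ?_
    rintro x (rfl | rfl | rfl)
    exacts [ha, hb, hcl]

/-- In a projective space, a configuration violating the Veblen-Young axiom cannot exist. -/
theorem exists_mem_modelLine_inter {K : Set W} (hP : IsProjectiveSpace G K) (hK : G.IsClique K)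
    (hline : ∀ a ∈ K, ∀ b ∈ K, modelLine ρ a b ⊆ K) {a b c d p : W} (hnd : [a, b, c, d].Nodup)
    (ha : a ∈ K) (hb : b ∈ K) (hc : c ∈ K) (hd : d ∈ K) (hp₁ : p ∈ modelLine ρ a b)
    (hp₂ : p ∈ modelLine ρ c d) : ∃ z, z ∈ modelLine ρ a c ∧ z ∈ modelLine ρ b d := by
  have hnd' := hnd
  simp only [List.nodup_cons, List.mem_cons, List.not_mem_nil, or_false, not_or] at hnd'
  obtain ⟨⟨hab, hac, had⟩, ⟨hbc, hbd⟩, hcd, -⟩ := hnd'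
  have key : ∀ {x y}, x ∈ K → y ∈ K → x ≠ y → IsLine G (modelLine ρ x y) ∧ modelLine ρ x y ⊆ K :=
    fun hx hy hxy => ⟨hM.isLine_modelLine (hK hx hy hxy), hline _ hx _ hy⟩
  exact hP.veblen a b c d hnd _ _ _ _ (key ha hb hab) (key hc hd hcd) (key ha hc hac)
    (key hb hd hbd) (left_mem_modelLine a b) (right_mem_modelLine a b)
    (left_mem_modelLine c d) (right_mem_modelLine c d) (left_mem_modelLine a c)
    (right_mem_modelLine a c) (left_mem_modelLine b d) (right_mem_modelLine b d)
    ⟨p, hp₁, hp₂⟩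

/-- Take `w` in a coordinate hyperplane `C_i` containing `X`, but not in `X`. Modulo `X` the points
`A = a`, `B = b`, `C = w + a`, `D = w + b` and `P = a - b` can be made non-degenerate. The lines
`AB` and `CD` meet in `P`, but `AC` and `BD` could meet only in `X ⊔ F ∙ w`, which lies in `C_i`. -/
theorem not_isProjectiveSpace_star [Infinite F] {X : Submodule F (Fin n → F)}
    (hX : finrank F X + 1 = k) (hXd : IsDegenerate X) :
    ¬ IsProjectiveSpace G (modelStar ρ X) := by
  intro hP
  have hkn := hM.add_one_lt
  obtain ⟨i, hi⟩ := hXd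
  have hCX : ¬ coordHyperplane F i ≤ X := fun h => by
    have h1 := Submodule.finrank_mono h
    have h2 := finrank_coordHyperplane (F := F) i
    omega
  obtain ⟨w, hwC, hwX⟩ := SetLike.not_le_iff_exists.1 hCX
  obtain ⟨a, b, hI, hH⟩ := exists_veblen_configuration (coordHyperplane F) (fun j => by
    have := finrank_coordHyperplane (F := F) j
    exact ne_top_of_finrank_lt (by omega)) (X := X) (by rw [finrank_fin_fun]; omega) hwX
  have hex : ∀ α β γ : F, (α ≠ 0 ∨ β ≠ 0 ∨ γ ≠ 0) →
      (∀ j, α • w + β • a + γ • b ∉ coordHyperplane F j) →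
      ∃ x, ρ x = X ⊔ F ∙ (α • w + β • a + γ • b) := by
    intro α β γ h hvH
    have hv : α • w + β • a + γ • b ∉ X := fun hv => by
      have := hI α β γ hv
      tauto
    exact hM.surjective _ (by rw [Submodule.finrank_sup_span_singleton hv, hX])
      (not_isDegenerate_of_mem (Submodule.mem_sup_right (Submodule.mem_span_singleton_self _)) hvH)
  have hdist : ∀ {α β γ α' β' γ' : F} {x y : W}, ρ x = X ⊔ F ∙ (α • w + β • a + γ • b) →
      ρ y = X ⊔ F ∙ (α' • w + β' • a + γ' • b) → x = y →
      ∃ t, α = t * α' ∧ β = t * β' ∧ γ = t * γ' := by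
    rintro α β γ α' β' γ' x _ hx hy rfl
    have h1 : α • w + β • a + γ • b ∈ X ⊔ F ∙ (α' • w + β' • a + γ' • b) := by
      rw [← hy, hx]
      exact Submodule.mem_sup_right (Submodule.mem_span_singleton_self _)
    obtain ⟨t, ht⟩ := mem_sup_span_singleton_iff.1 h1
    have h2 := hI (α - t * α') (β - t * β') (γ - t * γ') (by convert ht using 1; module)
    exact ⟨t, sub_eq_zero.1 h2.1, sub_eq_zero.1 h2.2.1, sub_eq_zero.1 h2.2.2⟩
  obtain ⟨A, hA⟩ := hex 0 1 0 (by simp) fun j => by simpa using (hH j).1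
  obtain ⟨C, hC⟩ := hex 1 1 0 (by simp) fun j => by simpa [add_comm] using (hH j).2.1
  obtain ⟨B, hB⟩ := hex 0 0 1 (by simp) fun j => by simpa using (hH j).2.2.1
  obtain ⟨D, hD⟩ := hex 1 0 1 (by simp) fun j => by simpa [add_comm] using (hH j).2.2.2.1
  obtain ⟨P, hP'⟩ := hex 0 1 (-1) (by simp) fun j => by
    simpa [sub_eq_add_neg] using (hH j).2.2.2.2
  have hAB : A ≠ B := fun h => by simpa using hdist hA hB h
  have hAC : A ≠ C := fun h => by simpa using hdist hA hC h
  have hAD : A ≠ D := fun h => by simpa using hdist hA hD h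
  have hBC : B ≠ C := fun h => by simpa using hdist hB hC h
  have hBD : B ≠ D := fun h => by simpa using hdist hB hD h
  have hCD : C ≠ D := fun h => by
    obtain ⟨t, h1, h2, h3⟩ := hdist hC hD h
    simp at h2
  have hXs : ∀ {x v}, ρ x = X ⊔ F ∙ v → x ∈ modelStar ρ X := fun hx => by
    rw [mem_modelStar, hx]
    exact le_sup_left
  have hmem : ∀ {x v}, ρ x = X ⊔ F ∙ v → v ∈ ρ x := fun hx => by
    rw [hx]
    exact Submodule.mem_sup_right (Submodule.mem_span_singleton_self _)
  obtain ⟨Q, hQ₁, hQ₂⟩ := hM.exists_mem_modelLine_inter hP (hM.isClique_star hX)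
    (fun x hx y hy => modelLine_subset_star hx hy) (a := A) (b := B) (c := C) (d := D) (p := P)
    (by simp [hAB, hAC, hAD, hBC, hBD, hCD]) (hXs hA) (hXs hB) (hXs hC) (hXs hD)
    (by
      refine ⟨?_, ?_⟩
      · rw [hM.inf_eq hAB hX (hXs hA) (hXs hB)]
        exact hXs hP'
      · rw [mem_modelTop, hP']
        refine sup_le (le_sup_of_le_left (hXs hA)) ?_
        rw [Submodule.span_singleton_le_iff_mem]
        convert Submodule.add_mem_sup (hmem hA) (Submodule.neg_mem _ (hmem hB)) using 1
        module)
    (by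
      refine ⟨?_, ?_⟩
      · rw [hM.inf_eq hCD hX (hXs hC) (hXs hD)]
        exact hXs hP'
      · rw [mem_modelTop, hP']
        refine sup_le (le_sup_of_le_left (hXs hC)) ?_
        rw [Submodule.span_singleton_le_iff_mem]
        convert Submodule.add_mem_sup (hmem hC) (Submodule.neg_mem _ (hmem hD)) using 1
        module)
  -- Writing `v ∈ ρ Q` along both lines gives multiples of `a` and of `b` that agree modulo `X ⊔ F ∙
  -- w`. Independence makes the coefficient of `a` vanish, so `v ∈ X ⊔ F ∙ w`.
  refine hM.nondeg Q ⟨i, fun v hv => ?_⟩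
  have key : ∀ {x y : W} {u : Fin n → F}, ρ x = X ⊔ F ∙ u → ρ y = X ⊔ F ∙ (w + u) →
      v ∈ ρ x ⊔ ρ y → ∃ t : F, v - t • u ∈ X ⊔ F ∙ w := by
    intro x y u hx hy hv
    rw [← mem_sup_span_singleton_iff]
    have hw : w ∈ X ⊔ F ∙ w ⊔ F ∙ u := Submodule.mem_sup_left
      (Submodule.mem_sup_right (Submodule.mem_span_singleton_self _))
    have hu : u ∈ X ⊔ F ∙ w ⊔ F ∙ u := Submodule.mem_sup_right (Submodule.mem_span_singleton_self _)
    have hXle : X ≤ X ⊔ F ∙ w ⊔ F ∙ u := le_sup_of_le_left le_sup_left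
    have hle : ρ x ⊔ ρ y ≤ X ⊔ F ∙ w ⊔ F ∙ u := by
      rw [hx, hy]
      refine sup_le (sup_le hXle ?_) (sup_le hXle ?_)
      · rwa [Submodule.span_singleton_le_iff_mem]
      · rw [Submodule.span_singleton_le_iff_mem]
        exact Submodule.add_mem _ hw hu
    exact hle hv
  obtain ⟨t, ht⟩ := key (x := A) (y := C) (u := a) (by simpa using hA) (by simpa using hC)
    (hQ₁.2 hv)
  obtain ⟨s, hs⟩ := key (x := B) (y := D) (u := b) (by simpa using hB) (by simpa using hD)
    (hQ₂.2 hv)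
  obtain ⟨r, hr⟩ := mem_sup_span_singleton_iff.1 (Submodule.sub_mem _ ht hs)
  have h0 := (hI (-r) (-t) s (by convert hr using 1; module)).2.1
  rw [neg_eq_zero.1 h0, zero_smul, sub_zero] at ht
  exact sup_le hi ((Submodule.span_singleton_le_iff_mem _ _).2 hwC) ht

end IsNondegModel
end ProjectiveSpace

/-! ### Hyperplanes of `Y` as functionals, and tops over an infinite field -/

section KernelSubmodule

variable {F : Type*} [Field F] {n : ℕ} {Y : Submodule F (Fin n → F)}

/-- The hyperplane of `Y` defined by a functional on `Y`. -/
def kerSubmodule (f : Dual F Y) : Submodule F (Fin n → F) :=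
  (LinearMap.ker f).map Y.subtype

/-- The `i`-th coordinate functional on `Y`. -/
def coordFunctional (Y : Submodule F (Fin n → F)) (i : Fin n) : Dual F Y :=
  (LinearMap.proj i).comp Y.subtype

theorem mem_kerSubmodule {f : Dual F Y} {v : Fin n → F} :
    v ∈ kerSubmodule f ↔ ∃ h : v ∈ Y, f ⟨v, h⟩ = 0 := by
  simp [kerSubmodule]

theorem kerSubmodule_le (f : Dual F Y) : kerSubmodule f ≤ Y := Submodule.map_subtype_le _ _

theorem finrank_kerSubmodule {f : Dual F Y} (hf : f ≠ 0) :
    finrank F (kerSubmodule f) + 1 = finrank F Y := by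
  rw [kerSubmodule, Submodule.finrank_map_subtype_eq]
  exact Module.Dual.finrank_ker_add_one_of_ne_zero hf

theorem exists_smul_eq_of_ker_le {f g : Dual F Y} (h : kerSubmodule f ≤ kerSubmodule g) :
    ∃ t : F, g = t • f := by
  have hle : ⨅ _ : Unit, LinearMap.ker f ≤ LinearMap.ker g := by
    rw [iInf_const]
    intro v hv
    obtain ⟨_, h2⟩ := mem_kerSubmodule.1 (h (mem_kerSubmodule.2 ⟨v.2, hv⟩))
    exact h2
  have := mem_span_of_iInf_ker_le_ker hle
  rw [Set.range_const, Submodule.mem_span_singleton] at this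
  exact this.imp fun _ h => h.symm

theorem exists_eq_add_of_ker_inf_ker_le {V : Type*} [AddCommGroup V] [Module F V]
    {f g h : V →ₗ[F] F} (hle : LinearMap.ker f ⊓ LinearMap.ker g ≤ LinearMap.ker h) :
    ∃ s t : F, h = s • f + t • g := by
  have hle' : ⨅ i, LinearMap.ker (![f, g] i) ≤ LinearMap.ker h := by
    intro v hv
    rw [Submodule.mem_iInf] at hv
    exact hle ⟨hv 0, hv 1⟩
  have := mem_span_of_iInf_ker_le_ker hle'
  rw [Matrix.range_cons, Matrix.range_cons, Matrix.range_empty, Set.union_empty,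
    Set.singleton_union, Submodule.mem_span_pair] at this
  obtain ⟨s, t, h⟩ := this
  exact ⟨s, t, h.symm⟩

theorem exists_eq_add_of_kerSubmodule_inf_le {f g h : Dual F Y}
    (hle : kerSubmodule f ⊓ kerSubmodule g ≤ kerSubmodule h) : ∃ s t : F, h = s • f + t • g := by
  refine exists_eq_add_of_ker_inf_ker_le ?_
  rintro v ⟨hv₁, hv₂⟩
  obtain ⟨_, h2⟩ := mem_kerSubmodule.1 (hle ⟨mem_kerSubmodule.2 ⟨v.2, hv₁⟩,
    mem_kerSubmodule.2 ⟨v.2, hv₂⟩⟩)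
  exact h2

theorem kerSubmodule_coordFunctional (i : Fin n) :
    kerSubmodule (coordFunctional Y i) = Y ⊓ coordHyperplane F i := by
  ext v
  rw [mem_kerSubmodule]
  exact ⟨fun ⟨h1, h2⟩ => ⟨h1, h2⟩, fun h => ⟨h.1, h.2⟩⟩

theorem coordFunctional_ne_zero (hY : ¬ IsDegenerate Y) (i : Fin n) : coordFunctional Y i ≠ 0 :=
  fun h => hY ⟨i, fun v hv => LinearMap.congr_fun h ⟨v, hv⟩⟩

theorem exists_eq_kerSubmodule {A : Submodule F (Fin n → F)} (hAY : A ≤ Y)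
    (hA : finrank F A + 1 = finrank F Y) : ∃ f : Dual F Y, f ≠ 0 ∧ A = kerSubmodule f := by
  have hlt : A.comap Y.subtype < ⊤ := by
    rw [lt_top_iff_ne_top]
    intro h
    have h1 : Y ≤ A := fun v hv => by
      have : (⟨v, hv⟩ : Y) ∈ A.comap Y.subtype := h ▸ Submodule.mem_top
      exact this
    have := Submodule.finrank_mono h1
    omega
  obtain ⟨f, hf, hAf⟩ := Submodule.exists_le_ker_of_lt_top _ hlt
  refine ⟨f, hf, Submodule.eq_of_le_of_finrank_eq ?_ ?_⟩
  · intro v hv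
    exact mem_kerSubmodule.2 ⟨hAY hv, hAf (show (⟨v, hAY hv⟩ : Y) ∈ A.comap Y.subtype from hv)⟩
  · have := finrank_kerSubmodule hf
    omega

end KernelSubmodule

section ProjectiveSpace

variable {F : Type*} [Field F] {n : ℕ} {W : Type*} {G : SimpleGraph W} {k : ℕ}
  {ρ : W → Submodule F (Fin n → F)}

namespace IsNondegModel

variable (hM : IsNondegModel G k ρ)
include hM

/-- This is the configuration used for degenerate stars, in the dual of `Y` and with `w` a
coordinate functional. The functionals `a`, `b`, `w + a`, `w + b`, `a - b` avoid multiples of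
coordinate functionals, so their kernels are vertices. The missing intersection point is the kernel
of `w`, the degenerate hyperplane `Y ⊓ C_i`. -/
theorem not_isProjectiveSpace_top [Infinite F] {Y : Submodule F (Fin n → F)}
    (hY : finrank F Y = k + 1) (hYd : ¬ IsDegenerate Y) :
    ¬ IsProjectiveSpace G (modelTop ρ Y) := by
  intro hP
  have hk := hM.one_lt
  have hkn := hM.add_one_lt
  let i : Fin n := ⟨0, by omega⟩
  set w := coordFunctional Y i with hw
  have hw0 : w ≠ 0 := coordFunctional_ne_zero hYd i
  have hfr : finrank F (Dual F Y) = k + 1 := by rw [Subspace.dual_finrank_eq, hY]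
  obtain ⟨a, b, hI, hH⟩ := exists_veblen_configuration
    (fun j => F ∙ coordFunctional Y j) (fun j h => by
      have h1 := finrank_span_singleton (K := F) (coordFunctional_ne_zero hYd j)
      rw [h, finrank_top, hfr] at h1
      omega) (X := ⊥) (by rw [finrank_bot, hfr]; omega) (by simpa using hw0)
  simp only [Submodule.mem_bot] at hI
  have hex : ∀ α β γ : F, (α ≠ 0 ∨ β ≠ 0 ∨ γ ≠ 0) →
      (∀ j, α • w + β • a + γ • b ∉ F ∙ coordFunctional Y j) →
      ∃ x, ρ x = kerSubmodule (α • w + β • a + γ • b) := by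
    intro α β γ h hvH
    have hv : α • w + β • a + γ • b ≠ 0 := fun hv => by
      have := hI α β γ hv
      tauto
    have hfin := finrank_kerSubmodule hv
    refine hM.surjective _ (by omega) ?_
    rintro ⟨j, hj⟩
    obtain ⟨t, ht⟩ := exists_smul_eq_of_ker_le
      (kerSubmodule_coordFunctional (Y := Y) j ▸ le_inf (kerSubmodule_le _) hj)
    refine hvH j (Submodule.mem_span_singleton.2 ⟨t⁻¹, ?_⟩)
    have ht0 : t ≠ 0 := by
      rintro rfl
      exact coordFunctional_ne_zero hYd j (by simpa using ht)
    rw [ht, smul_smul, inv_mul_cancel₀ ht0, one_smul]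
  have hdist : ∀ {α β γ α' β' γ' : F} {x y : W}, ρ x = kerSubmodule (α • w + β • a + γ • b) →
      ρ y = kerSubmodule (α' • w + β' • a + γ' • b) → x = y →
      ∃ t, α = t * α' ∧ β = t * β' ∧ γ = t * γ' := by
    rintro α β γ α' β' γ' x _ hx hy rfl
    obtain ⟨t, ht⟩ := exists_smul_eq_of_ker_le (hx.symm.trans hy).ge
    have h2 := hI (α - t * α') (β - t * β') (γ - t * γ') (by
      rw [← sub_eq_zero] at ht
      convert ht using 1
      module)
    exact ⟨t, sub_eq_zero.1 h2.1, sub_eq_zero.1 h2.2.1, sub_eq_zero.1 h2.2.2⟩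
  obtain ⟨A, hA⟩ := hex 0 1 0 (by simp) fun j => by simpa using (hH j).1
  obtain ⟨C, hC⟩ := hex 1 1 0 (by simp) fun j => by simpa [add_comm] using (hH j).2.1
  obtain ⟨B, hB⟩ := hex 0 0 1 (by simp) fun j => by simpa using (hH j).2.2.1
  obtain ⟨D, hD⟩ := hex 1 0 1 (by simp) fun j => by simpa [add_comm] using (hH j).2.2.2.1
  obtain ⟨P, hP'⟩ := hex 0 1 (-1) (by simp) fun j => by
    rw [show (0 : F) • w + (1 : F) • a + (-1 : F) • b = a - b by module]
    exact (hH j).2.2.2.2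
  have hAB : A ≠ B := fun h => by simpa using hdist hA hB h
  have hAC : A ≠ C := fun h => by simpa using hdist hA hC h
  have hAD : A ≠ D := fun h => by simpa using hdist hA hD h
  have hBC : B ≠ C := fun h => by simpa using hdist hB hC h
  have hBD : B ≠ D := fun h => by simpa using hdist hB hD h
  have hCD : C ≠ D := fun h => by
    obtain ⟨t, h1, h2, h3⟩ := hdist hC hD h
    simp at h2
  have hYt : ∀ {x} {f : Dual F Y}, ρ x = kerSubmodule f → x ∈ modelTop ρ Y := fun hx => by
    rw [mem_modelTop, hx]
    exact kerSubmodule_le _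
  have hker : ∀ {x y z : W} {f g h : Dual F Y}, ρ x = kerSubmodule f → ρ y = kerSubmodule g →
      ρ z = kerSubmodule h → h = f - g → ρ x ⊓ ρ y ≤ ρ z := by
    rintro x y z f g h hx hy hz rfl v ⟨hv1, hv2⟩
    rw [SetLike.mem_coe, hx, mem_kerSubmodule] at hv1
    rw [SetLike.mem_coe, hy, mem_kerSubmodule] at hv2
    rw [hz, mem_kerSubmodule]
    obtain ⟨h1, h2⟩ := hv1
    obtain ⟨_, h3⟩ := hv2
    exact ⟨h1, by rw [LinearMap.sub_apply, h2, h3, sub_zero]⟩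
  obtain ⟨Q, hQ₁, hQ₂⟩ := hM.exists_mem_modelLine_inter hP (hM.isClique_top hY)
    (fun x hx y hy => modelLine_subset_top hx hy) (a := A) (b := B) (c := C) (d := D) (p := P)
    (by simp [hAB, hAC, hAD, hBC, hBD, hCD]) (hYt hA) (hYt hB) (hYt hC) (hYt hD)
    ⟨mem_modelStar.2 (hker hA hB hP' (by module)),
      mem_modelTop.2 (by rw [hM.sup_eq hAB hY (hYt hA) (hYt hB)]; exact hYt hP')⟩
    ⟨mem_modelStar.2 (hker hC hD hP' (by module)),
      mem_modelTop.2 (by rw [hM.sup_eq hCD hY (hYt hC) (hYt hD)]; exact hYt hP')⟩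
  have hle : ∀ {x y : W} {f : Dual F Y}, ρ x = kerSubmodule f → ρ y = kerSubmodule (w + f) →
      ρ x ⊓ ρ y ≤ Y ⊓ coordHyperplane F i := by
    intro x y f hx hy v ⟨hv1, hv2⟩
    rw [SetLike.mem_coe, hx, mem_kerSubmodule] at hv1
    rw [SetLike.mem_coe, hy, mem_kerSubmodule] at hv2
    obtain ⟨h1, h2⟩ := hv1
    obtain ⟨_, h3⟩ := hv2
    refine ⟨h1, ?_⟩
    rw [LinearMap.add_apply, h2, add_zero] at h3
    exact h3
  have hlAC := hle (f := a) (by simpa using hA) (by simpa using hC)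
  have hlBD := hle (f := b) (by simpa using hB) (by simpa using hD)
  have hfAC := (hM.adj_iff A C).1 (hM.adj_of_top hY (hYt hA) (hYt hC) hAC)
  have hfBD := (hM.adj_iff B D).1 (hM.adj_of_top hY (hYt hB) (hYt hD) hBD)
  have hne : ρ A ⊓ ρ C ≠ ρ B ⊓ ρ D := by
    intro h
    have h1 : kerSubmodule ((0 : F) • w + (1 : F) • a + (0 : F) • b) ⊓
        kerSubmodule ((1 : F) • w + (1 : F) • a + (0 : F) • b) ≤
        kerSubmodule ((0 : F) • w + (0 : F) • a + (1 : F) • b) := by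
      rw [← hA, ← hC, ← hB, h]
      exact inf_le_left
    obtain ⟨s, t, hst⟩ := exists_eq_add_of_kerSubmodule_inf_le h1
    have := (hI (t) (s + t) (-1) (by
      rw [← sub_eq_zero] at hst
      rw [← neg_eq_zero, ← hst]
      module)).2.2
    simp at this
  have hfi : finrank F (Y ⊓ coordHyperplane F i : Submodule F (Fin n → F)) + 1 = k + 1 := by
    rw [finrank_inf_coordHyperplane fun h => hYd ⟨i, h⟩, hY]
  -- The intersections `ρ A ⊓ ρ C` and `ρ B ⊓ ρ D` are distinct hyperplanes of `Y ⊓ C_i`. Their sum,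
  -- which `ρ Q` must contain, is therefore all of it.
  have hsup := sup_eq_of_le_of_finrank (k := k - 1) (by omega) (by omega) (by omega) hlAC hlBD hne
  have hQ : Y ⊓ coordHyperplane F i ≤ ρ Q := hsup ▸ sup_le hQ₁.1 hQ₂.1
  have := Submodule.eq_of_le_of_finrank_eq hQ (by rw [hM.finrank_eq]; omega)
  exact hM.nondeg Q ⟨i, this ▸ inf_le_right⟩

end IsNondegModel

end ProjectiveSpace

/-! ### Cardinalities of stars and tops over a finite field -/

section Counting

variable {F : Type*} [Field F] {n : ℕ}

/-- These subspaces are the points of the projective space of `V/X`; `d` is its vector space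
dimension `n - k + 1`. -/
theorem ncard_setOf_le_finrank [Finite F] {X : Submodule F (Fin n → F)} {k d : ℕ}
    (hX : finrank F X + 1 = k) (hd : k + d = n + 1) :
    {Z : Submodule F (Fin n → F) | X ≤ Z ∧ finrank F Z = k}.ncard =
      ∑ i ∈ Finset.range d, Nat.card F ^ i := by
  let f : Projectivization F ((Fin n → F) ⧸ X) → Submodule F (Fin n → F) := fun p => p.submodule.comap X.mkQ
  have hf : Function.Injective f := fun p q h => Projectivization.submodule_injective
    (Submodule.comap_injective_of_surjective X.mkQ_surjective h)
  have hfv : ∀ v (hv : X.mkQ v ≠ 0), f (Projectivization.mk F (X.mkQ v) hv) = X ⊔ F ∙ v := by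
    intro v hv
    rw [← Submodule.comap_map_mkQ, Submodule.map_span, Set.image_singleton]
    simp [f, Projectivization.submodule_mk]
  have hrange : {Z : Submodule F (Fin n → F) | X ≤ Z ∧ finrank F Z = k} = Set.range f := by
    ext Z
    constructor
    · rintro ⟨hXZ, hZ⟩
      obtain ⟨v, hvZ, hvX⟩ := SetLike.not_le_iff_exists.1 fun h : Z ≤ X => by
        have := Submodule.finrank_mono h
        omega
      refine ⟨Projectivization.mk F (X.mkQ v) (by simpa using hvX), ?_⟩
      rw [hfv]
      refine Submodule.eq_of_le_of_finrank_eq (sup_le hXZ (by simpa using hvZ)) ?_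
      rw [Submodule.finrank_sup_span_singleton hvX, hX, hZ]
    · rintro ⟨p, rfl⟩
      induction p using Projectivization.ind with | h u hu =>
      obtain ⟨v, rfl⟩ := X.mkQ_surjective u
      rw [hfv]
      exact ⟨le_sup_left, by
        rw [Submodule.finrank_sup_span_singleton (by simpa using hu), hX]⟩
  rw [hrange, Set.ncard_range_of_injective hf, Projectivization.card_of_finrank]
  have := X.finrank_quotient_add_finrank
  rw [finrank_fin_fun] at this
  omega

/-- Hyperplanes of `Y` are the points of the projective space of its dual. -/
theorem ncard_setOf_le_top_finrank [Finite F] {Y : Submodule F (Fin n → F)} {k : ℕ}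
    (hY : finrank F Y = k + 1) :
    {A : Submodule F (Fin n → F) | A ≤ Y ∧ finrank F A = k}.ncard =
      ∑ i ∈ Finset.range (k + 1), Nat.card F ^ i := by
  let f : Projectivization F (Dual F Y) → Submodule F (Fin n → F) := fun p => kerSubmodule p.rep
  have hf : Function.Injective f := fun p q h => by
    obtain ⟨t, ht⟩ := exists_smul_eq_of_ker_le (show kerSubmodule p.rep ≤ kerSubmodule q.rep from
      le_of_eq h)
    rw [← p.mk_rep, ← q.mk_rep, Projectivization.mk_eq_mk_iff']
    have ht0 : t ≠ 0 := fun h0 => q.rep_nonzero (by rw [ht, h0, zero_smul])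
    exact ⟨t⁻¹, by rw [ht, smul_smul, inv_mul_cancel₀ ht0, one_smul]⟩
  have hrange : {A : Submodule F (Fin n → F) | A ≤ Y ∧ finrank F A = k} = Set.range f := by
    ext A
    constructor
    · rintro ⟨hAY, hA⟩
      obtain ⟨g, hg, rfl⟩ := exists_eq_kerSubmodule hAY (by omega)
      refine ⟨Projectivization.mk F g hg, ?_⟩
      obtain ⟨c, hc⟩ := Projectivization.exists_smul_eq_mk_rep F g hg
      have hle : kerSubmodule g ≤ kerSubmodule (Projectivization.mk F g hg).rep := fun v hv => by
        obtain ⟨h1, h2⟩ := mem_kerSubmodule.1 hv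
        rw [← hc]
        exact mem_kerSubmodule.2 ⟨h1, by simp [h2]⟩
      refine (Submodule.eq_of_le_of_finrank_eq hle ?_).symm
      have h1 := finrank_kerSubmodule hg
      have h2 := finrank_kerSubmodule (Projectivization.mk F g hg).rep_nonzero
      omega
    · rintro ⟨p, rfl⟩
      have := finrank_kerSubmodule p.rep_nonzero
      exact ⟨kerSubmodule_le _, by change finrank F (kerSubmodule p.rep) = k; omega⟩
  rw [hrange, Set.ncard_range_of_injective hf, Projectivization.card_of_finrank]
  rw [Subspace.dual_finrank_eq, hY]

end Counting

/-! ### Recognition of maximal stars, stars and tops -/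

section MaximalStars

variable {F : Type*} [Field F] {n : ℕ} {W : Type*} {G : SimpleGraph W} {k : ℕ}
  {ρ : W → Submodule F (Fin n → F)}

namespace IsNondegModel

variable (hM : IsNondegModel G k ρ)
include hM

theorem ncard_star_of_nondeg [Finite F] {X : Submodule F (Fin n → F)} (hX : finrank F X + 1 = k)
    (hXd : ¬ IsDegenerate X) :
    (modelStar ρ X).ncard = ∑ i ∈ Finset.range (n - k + 1), Nat.card F ^ i := by
  have hkn := hM.add_one_lt
  rw [← ncard_setOf_le_finrank hX (by omega), ← Set.ncard_image_of_injective _ hM.injective]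
  congr 1
  ext Z
  constructor
  · rintro ⟨w, hw, rfl⟩
    exact ⟨hw, hM.finrank_eq w⟩
  · rintro ⟨h1, h2⟩
    obtain ⟨w, rfl⟩ := hM.surjective Z h2 fun h => hXd (h.mono h1)
    exact ⟨w, h1, rfl⟩

theorem ncard_star_of_isDegenerate [Finite F] {X : Submodule F (Fin n → F)}
    (hX : finrank F X + 1 = k) (hXd : IsDegenerate X) :
    (modelStar ρ X).ncard < ∑ i ∈ Finset.range (n - k + 1), Nat.card F ^ i := by
  have hkn := hM.add_one_lt
  rw [← ncard_setOf_le_finrank hX (by omega), ← Set.ncard_image_of_injective _ hM.injective]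
  refine Set.ncard_lt_ncard ⟨?_, fun h => ?_⟩ (Set.toFinite _)
  · rintro _ ⟨w, hw, rfl⟩
    exact ⟨hw, hM.finrank_eq w⟩
  · obtain ⟨i, hi⟩ := hXd
    have h1 := finrank_coordHyperplane (F := F) i
    obtain ⟨Z, hXZ, hZi, hZ⟩ := exists_submodule_finrank_between hi (d := k) (by omega) (by omega)
    obtain ⟨w, -, rfl⟩ := h ⟨hXZ, hZ⟩
    exact hM.nondeg w ⟨i, hZi⟩

theorem ncard_top_lt [Finite F] {Y : Submodule F (Fin n → F)} (hY : finrank F Y = k + 1)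
    (hYd : ¬ IsDegenerate Y) :
    (modelTop ρ Y).ncard < ∑ i ∈ Finset.range (k + 1), Nat.card F ^ i := by
  have hkn := hM.add_one_lt
  rw [← ncard_setOf_le_top_finrank hY, ← Set.ncard_image_of_injective _ hM.injective]
  refine Set.ncard_lt_ncard ⟨?_, fun h => ?_⟩ (Set.toFinite _)
  · rintro _ ⟨w, hw, rfl⟩
    exact ⟨hw, hM.finrank_eq w⟩
  · let i : Fin n := ⟨0, by omega⟩
    have h1 := finrank_inf_coordHyperplane (fun h => hYd ⟨i, h⟩)
    obtain ⟨w, -, hw⟩ := h ⟨(inf_le_left : Y ⊓ coordHyperplane F i ≤ Y), by omega⟩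
    exact hM.nondeg w ⟨i, hw ▸ inf_le_right⟩

/-- The only hyperplanes of `Y` missing from the top are the at most `n` subspaces `Y ⊓ C_i`. -/
theorem le_ncard_top [Finite F] {Y : Submodule F (Fin n → F)} (hY : finrank F Y = k + 1)
    (hYd : ¬ IsDegenerate Y) :
    ∑ i ∈ Finset.range (k + 1), Nat.card F ^ i ≤ (modelTop ρ Y).ncard + n := by
  rw [← ncard_setOf_le_top_finrank hY, ← Set.ncard_image_of_injective _ hM.injective]
  have hr : (Set.range fun i => Y ⊓ coordHyperplane F i).ncard ≤ n := by
    rw [← Set.image_univ]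
    refine (Set.ncard_image_le (Set.toFinite _)).trans ?_
    simp [Set.ncard_univ]
  refine le_trans (Set.ncard_le_ncard ?_ (Set.toFinite _))
    ((Set.ncard_union_le _ _).trans (Nat.add_le_add_left hr _))
  rintro A ⟨hAY, hA⟩
  by_cases hAd : IsDegenerate A
  · obtain ⟨i, hi⟩ := hAd
    have h1 := finrank_inf_coordHyperplane (fun h => hYd ⟨i, h⟩)
    exact Or.inr ⟨i, (Submodule.eq_of_le_of_finrank_eq (le_inf hAY hi) (by omega)).symm⟩
  · obtain ⟨w, rfl⟩ := hM.surjective A hA hAd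
    exact Or.inl ⟨w, hAY, rfl⟩

/-- If `k ≤ n - k`, the top is too small, as it misses at least one hyperplane of `Y`. If `n - k <
k`, equality would require the term `q ^ k` to be absorbed by at most `n` missing hyperplanes, but
`q ^ k ≥ q + k > n`. -/
theorem ncard_top_ne [Finite F] {Y : Submodule F (Fin n → F)} (hY : finrank F Y = k + 1)
    (hYd : ¬ IsDegenerate Y) :
    (modelTop ρ Y).ncard ≠ ∑ i ∈ Finset.range (n - k + 1), Nat.card F ^ i := by
  have h1 := hM.ncard_top_lt hY hYd
  have h2 := hM.le_ncard_top hY hYd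
  have hk := hM.one_lt
  have hkn := hM.add_one_lt
  have hF := hM.lt_card
  rw [ENat.card_eq_coe_natCard, Nat.cast_lt] at hF
  rcases Nat.lt_or_ge (n - k) k with h | h
  · have h3 := Finset.sum_le_sum_of_subset (f := fun i => Nat.card F ^ i)
      (Finset.range_subset_range.2 (show n - k + 1 ≤ k by omega))
    have h4 := add_le_pow_of_three_le (q := Nat.card F) (k := k) (by omega) hk
    rw [Finset.sum_range_succ] at h2
    omega
  · have h3 := Finset.sum_le_sum_of_subset (f := fun i => Nat.card F ^ i)
      (Finset.range_subset_range.2 (show k + 1 ≤ n - k + 1 by omega))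
    omega

theorem mem_recMaximalStars_iff (K : Set W) : K ∈ recMaximalStars n k (ENat.card F) G ↔
    ∃ X : Submodule F (Fin n → F), finrank F X + 1 = k ∧ ¬ IsDegenerate X ∧
      K = modelStar ρ X := by
  rw [recMaximalStars, Set.mem_ofPred_eq]
  rcases finite_or_infinite F with hF | hF
  · have hW : Finite W := Finite.of_injective ρ hM.injective
    have hcard : (K.encard = ∑ i ∈ Finset.range (n - k + 1), ENat.card F ^ i) ↔
        K.ncard = ∑ i ∈ Finset.range (n - k + 1), Nat.card F ^ i := by
      rw [← (Set.toFinite K).cast_ncard_eq, ENat.card_eq_coe_natCard]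
      norm_cast
    rw [if_neg (by simp [ENat.card_eq_coe_natCard]), hcard]
    constructor
    · rintro ⟨hK, hc⟩
      rcases hM.isMaxClique_iff.1 hK with ⟨X, hX, rfl⟩ | ⟨Y, hY, hYd, rfl⟩
      · exact ⟨X, hX, fun hXd => (hM.ncard_star_of_isDegenerate hX hXd).ne hc, rfl⟩
      · exact absurd hc (hM.ncard_top_ne hY hYd)
    · rintro ⟨X, hX, hXd, rfl⟩
      exact ⟨hM.isMaxClique_star hX, hM.ncard_star_of_nondeg hX hXd⟩
  · rw [if_pos (by simp)]
    constructor
    · rintro ⟨hK, hc⟩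
      rcases hM.isMaxClique_iff.1 hK with ⟨X, hX, rfl⟩ | ⟨Y, hY, hYd, rfl⟩
      · exact ⟨X, hX, fun hXd => hM.not_isProjectiveSpace_star hX hXd hc, rfl⟩
      · exact absurd hc (hM.not_isProjectiveSpace_top hY hYd)
    · rintro ⟨X, hX, hXd, rfl⟩
      exact ⟨hM.isMaxClique_star hX, hM.isProjectiveSpace_star hX hXd⟩

theorem mem_recStars_iff (K : Set W) : K ∈ recStars n k (ENat.card F) G ↔
    ∃ X : Submodule F (Fin n → F), finrank F X + 1 = k ∧ K = modelStar ρ X :=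
  hM.recStars_eq hM.mem_recMaximalStars_iff K

theorem mem_recTops_iff (K : Set W) : K ∈ recTops n k (ENat.card F) G ↔
    ∃ Y : Submodule F (Fin n → F), finrank F Y = k + 1 ∧ ¬ IsDegenerate Y ∧ K = modelTop ρ Y :=
  hM.recTops_eq hM.mem_recMaximalStars_iff K

end IsNondegModel

end MaximalStars

/-! ### Recovery from special sets of stars -/

section Hyperplanes

variable {F : Type*} [Field F] {n : ℕ}

theorem exists_ker_hyperplane_notMem {A : Submodule F (Fin n → F)} {z : Fin n → F} (hz : z ∈ A)
    (hz0 : z ≠ 0) : ∃ X ≤ A, finrank F X + 1 = finrank F A ∧ z ∉ X := by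
  obtain ⟨f, hf, -⟩ := Submodule.exists_le_ker_of_notMem (p := (⊥ : Submodule F A))
    (v := ⟨z, hz⟩) (by simpa using hz0)
  refine ⟨kerSubmodule f, kerSubmodule_le f, finrank_kerSubmodule ?_, fun h => ?_⟩
  · rintro rfl
    exact hf rfl
  · exact hf (mem_kerSubmodule.1 h).2

theorem exists_pair_hyperplanes {A : Submodule F (Fin n → F)} {k : ℕ} (hk : 1 < k)
    (hA : finrank F A = k) : ∃ X₁ ≤ A, ∃ X₂ ≤ A, finrank F X₁ + 1 = k ∧ finrank F X₂ + 1 = k ∧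
      X₁ ≠ X₂ := by
  obtain ⟨z, hz, hz0⟩ := A.ne_bot_iff.1 fun h => by rw [h, finrank_bot] at hA; omega
  obtain ⟨X₁, hX₁A, hX₁, -⟩ := exists_ker_hyperplane_notMem hz hz0
  obtain ⟨z, hz, hz0⟩ := X₁.ne_bot_iff.1 fun h => by rw [h, finrank_bot] at hX₁; omega
  obtain ⟨X₂, hX₂A, hX₂, hzX⟩ := exists_ker_hyperplane_notMem (hX₁A hz) hz0
  exact ⟨X₁, hX₁A, X₂, hX₂A, by omega, by omega, fun h => hzX (h ▸ hz)⟩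

end Hyperplanes

section Recovery

variable {F : Type*} [Field F] {n : ℕ} {W : Type*} {G : SimpleGraph W} {k : ℕ}
  {ρ : W → Submodule F (Fin n → F)}

namespace IsNondegModel

variable (hM : IsNondegModel G k ρ)
include hM

/-- The common final step of all three reconstructions: `f` encodes degenerate `k`-subspaces
bijectively by the members of `P`, compatibly with both new kinds of adjacency. -/
theorem exists_extendGraph_iso {𝒦 : Set (Set W)} (P : Set (Set 𝒦)) (R : Set 𝒦 → Set 𝒦 → Prop)
    (hR : ∀ 𝔛 𝔜, R 𝔛 𝔜 → R 𝔜 𝔛) (f : Submodule F (Fin n → F) → Set 𝒦)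
    (hP : ∀ 𝔛, 𝔛 ∈ P ↔ ∃ X : Submodule F (Fin n → F), (finrank F X = k ∧ IsDegenerate X) ∧ 𝔛 = f X)
    (hinj : ∀ X X' : Submodule F (Fin n → F), (finrank F X = k ∧ IsDegenerate X) → (finrank F X' = k ∧ IsDegenerate X') →
      f X = f X' → X = X')
    (hinc : ∀ w (X : Submodule F (Fin n → F)), (finrank F X = k ∧ IsDegenerate X) →
      ((∃ K ∈ f X, w ∈ K.1) ↔ finrank F (ρ w ⊓ X : Submodule F (Fin n → F)) + 1 = k))
    (hRR : ∀ X X' : Submodule F (Fin n → F), (finrank F X = k ∧ IsDegenerate X) → (finrank F X' = k ∧ IsDegenerate X') →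
      X ≠ X' → (R (f X) (f X') ↔ finrank F (X ⊓ X' : Submodule F (Fin n → F)) + 1 = k)) :
    ∃ Φ : extendGraph G P R hR ≃g grassmannGraph F n k, ∀ w, (Φ (Sum.inl w)).1 = ρ w := by
  choose g hg hgf using fun 𝔛 : P => (hP 𝔛.1).1 𝔛.2
  let φ : W ⊕ P → Grass F n k :=
    Sum.elim (fun w => ⟨ρ w, hM.finrank_eq w⟩) fun 𝔛 => ⟨g 𝔛, (hg 𝔛).1⟩
  have hginj : Function.Injective g := fun 𝔛 𝔜 h => Subtype.ext (by rw [hgf 𝔛, hgf 𝔜, h])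
  have hφ : Function.Bijective φ := by
    constructor
    · rintro (a | 𝔛) (b | 𝔜) h
      · exact congrArg Sum.inl (hM.injective (congrArg Subtype.val h))
      · have h' : ρ a = g 𝔜 := congrArg Subtype.val h
        exact absurd (h' ▸ (hg 𝔜).2) (hM.nondeg a)
      · have h' : g 𝔛 = ρ b := congrArg Subtype.val h
        exact absurd (h' ▸ (hg 𝔛).2) (hM.nondeg b)
      · exact congrArg Sum.inr (hginj (congrArg Subtype.val h))
    · rintro ⟨A, hA⟩
      by_cases hAd : IsDegenerate A
      · refine ⟨Sum.inr ⟨f A, (hP _).2 ⟨A, ⟨hA, hAd⟩, rfl⟩⟩, Subtype.ext ?_⟩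
        exact hinj _ _ (hg _) ⟨hA, hAd⟩ (hgf _).symm
      · obtain ⟨w, rfl⟩ := hM.surjective A hA hAd
        exact ⟨Sum.inl w, rfl⟩
  refine ⟨⟨Equiv.ofBijective φ hφ, ?_⟩, fun w => rfl⟩
  rintro (a | 𝔛) (b | 𝔜)
  · exact (hM.adj_iff a b).symm
  · change _ ↔ ∃ K ∈ 𝔜.1, a ∈ K.1
    rw [hgf 𝔜, hinc a _ (hg 𝔜)]
    rfl
  · change _ ↔ ∃ K ∈ 𝔛.1, b ∈ K.1
    rw [hgf 𝔛, hinc b _ (hg 𝔛), inf_comm]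
    rfl
  · change finrank F (g 𝔛 ⊓ g 𝔜 : Submodule F (Fin n → F)) + 1 = k ↔ 𝔛 ≠ 𝔜 ∧ R 𝔛.1 𝔜.1
    constructor
    · intro h
      have hne : 𝔛 ≠ 𝔜 := by
        rintro rfl
        rw [inf_idem, (hg 𝔛).1] at h
        omega
      rw [hgf 𝔛, hgf 𝔜, hRR _ _ (hg 𝔛) (hg 𝔜) (hginj.ne hne)]
      exact ⟨hne, h⟩
    · rintro ⟨hne, h⟩
      rwa [hgf 𝔛, hgf 𝔜, hRR _ _ (hg 𝔛) (hg 𝔜) (hginj.ne hne)] at h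

/-! ### Stars -/

/-- If `ρ a` does not contain `X₂`, then `ρ a ⊔ X₂` has dimension `k + 1` and is non-degenerate
because it contains `ρ a`. The pencil between it and `X₂` supplies the neighbour. -/
theorem exists_adj_of_star {X₁ X₂ : Submodule F (Fin n → F)} (h₂ : finrank F X₂ + 1 = k)
    (h : finrank F (X₁ ⊓ X₂ : Submodule F (Fin n → F)) + 2 = k) {a : W} (ha : a ∈ modelStar ρ X₁) :
    ∃ b ∈ modelStar ρ X₂, G.Adj a b := by
  by_cases hX : X₂ ≤ ρ a
  · obtain ⟨b, hb, c, hc, hbc⟩ := hM.exists_pair_star h₂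
    by_cases hab : a = b
    · exact ⟨c, hc, hM.adj_of_star h₂ hX hc (hab ▸ hbc)⟩
    · exact ⟨b, hb, hM.adj_of_star h₂ hX hb hab⟩
  · have h1 := Submodule.finrank_mono (inf_le_inf_right X₂ ha : X₁ ⊓ X₂ ≤ ρ a ⊓ X₂)
    have h2 : finrank F (ρ a ⊓ X₂ : Submodule F (Fin n → F)) < finrank F X₂ :=
      Submodule.finrank_lt_finrank_of_lt (lt_of_le_of_ne inf_le_right fun h => hX (inf_eq_right.1 h))
    have h3 := Submodule.finrank_sup_add_finrank_inf_eq (ρ a) X₂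
    have ha' := hM.finrank_eq a
    have hY : finrank F (ρ a ⊔ X₂ : Submodule F (Fin n → F)) = k + 1 := by omega
    obtain ⟨B, hXB, hBY, hB, hBd⟩ := exists_hyperplane_of_pencil hM.add_one_lt hM.lt_card
      (le_sup_right : X₂ ≤ ρ a ⊔ X₂) h₂ hY fun h => hM.nondeg a (h.mono le_sup_left)
    obtain ⟨b, rfl⟩ := hM.surjective B hB hBd
    refine ⟨b, hXB, hM.adj_of_top hY (mem_modelTop.2 le_sup_left) hBY ?_⟩
    rintro rfl
    exact hX hXB

/-- If `X₁ ⊓ X₂` were smaller, a neighbour of `a` through `X₂` would make `ρ a ⊓ X₂` so large that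
with `X₁` it spans `ρ a`. The whole star of `X₁` would lie in `X₁ ⊔ X₂`, of dimension at most `k + 1
< n`, but stars leave every proper subspace. -/
theorem finrank_inf_of_forall_exists_adj {X₁ X₂ : Submodule F (Fin n → F)}
    (h₁ : finrank F X₁ + 1 = k) (h₂ : finrank F X₂ + 1 = k) (hne : X₁ ≠ X₂)
    (h : ∀ a ∈ modelStar ρ X₁, ∃ b ∈ modelStar ρ X₂, G.Adj a b) :
    finrank F (X₁ ⊓ X₂ : Submodule F (Fin n → F)) + 2 = k := by
  have hkn := hM.add_one_lt
  have h1 : finrank F (X₁ ⊓ X₂ : Submodule F (Fin n → F)) < finrank F X₁ := by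
    refine Submodule.finrank_lt_finrank_of_lt (lt_of_le_of_ne inf_le_left fun h => hne ?_)
    exact Submodule.eq_of_le_of_finrank_eq (inf_eq_left.1 h) (by omega)
  by_contra hlt
  have hX := Submodule.finrank_sup_add_finrank_inf_eq X₁ X₂
  have key : ∀ a ∈ modelStar ρ X₁, ρ a ≤ X₁ ⊔ X₂ ∧
      finrank F (X₁ ⊔ X₂ : Submodule F (Fin n → F)) ≤ k + 1 := by
    intro a ha
    obtain ⟨b, hb, hab⟩ := h a ha
    have ha' := hM.finrank_eq a
    have hab' := (finrank_inf_add_one_iff (hM.finrank_eq a) (hM.finrank_eq b)).1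
      ((hM.adj_iff a b).1 hab)
    have h2 := Submodule.finrank_mono (sup_le_sup_left hb (ρ a))
    have h3 := Submodule.finrank_sup_add_finrank_inf_eq (ρ a) X₂
    have h4 := Submodule.finrank_sup_add_finrank_inf_eq X₁ (ρ a ⊓ X₂)
    have h5 : X₁ ⊓ (ρ a ⊓ X₂) = X₁ ⊓ X₂ := by
      rw [← inf_assoc, (inf_eq_left.2 ha : X₁ ⊓ ρ a = X₁)]
    rw [h5] at h4
    have h6 : X₁ ⊔ (ρ a ⊓ X₂) = ρ a :=
      Submodule.eq_of_le_of_finrank_le (sup_le ha inf_le_left) (by omega)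
    refine ⟨h6 ▸ sup_le_sup_left inf_le_right _, ?_⟩
    exact (Submodule.finrank_mono (sup_le_sup_right ha X₂)).trans (by omega)
  obtain ⟨a, ha, -⟩ := hM.exists_pair_star h₁
  obtain ⟨b, hb, hbU⟩ := hM.exists_mem_star h₁ (le_sup_left : X₁ ≤ X₁ ⊔ X₂)
    (ne_top_of_finrank_lt ((key a ha).2.trans_lt hkn))
  exact hbU (key b hb).1

/-- Applied to the family of all stars, this identifies `Δ_s` with the full Grassmann graph of
`(k-1)`-subspaces. -/
theorem cliqueGraph_stars_adj_iff {𝒮 : Set (Set W)} {K L : 𝒮} {X₁ X₂ : Submodule F (Fin n → F)}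
    (h₁ : finrank F X₁ + 1 = k) (h₂ : finrank F X₂ + 1 = k) (hK : K.1 = modelStar ρ X₁)
    (hL : L.1 = modelStar ρ X₂) :
    (cliqueGraph G 𝒮).Adj K L ↔ finrank F (X₁ ⊓ X₂ : Submodule F (Fin n → F)) + 2 = k := by
  constructor
  · rintro ⟨hne, h, -⟩
    refine hM.finrank_inf_of_forall_exists_adj h₁ h₂ (fun hX => hne (Subtype.ext ?_))
      (by rwa [hK, hL] at h)
    rw [hK, hL, hX]
  · intro h
    refine ⟨?_, ?_, ?_⟩
    · rintro rfl
      have := hM.star_subset_star h₁ h₂ (hK.symm.trans hL).subset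
      rw [this, inf_idem] at h
      omega
    · rw [hK, hL]
      exact fun a ha => hM.exists_adj_of_star h₂ h ha
    · rw [hK, hL]
      exact fun a ha => hM.exists_adj_of_star h₁ (inf_comm X₁ X₂ ▸ h) ha

end IsNondegModel

/-- The stars defined by the hyperplanes of `A`. -/
def starsBelow (ρ : W → Submodule F (Fin n → F)) (k : ℕ) (𝒮 : Set (Set W))
    (A : Submodule F (Fin n → F)) : Set 𝒮 :=
  {K | ∃ X ≤ A, finrank F X + 1 = k ∧ K.1 = modelStar ρ X}

/-- The tops defined by the subspaces through `X`. -/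
def topsAbove (ρ : W → Submodule F (Fin n → F)) (k : ℕ) (𝒯 : Set (Set W))
    (X : Submodule F (Fin n → F)) : Set 𝒯 :=
  {K | ∃ Y, X ≤ Y ∧ finrank F Y = k + 1 ∧ ¬ IsDegenerate Y ∧ K.1 = modelTop ρ Y}

namespace IsNondegModel

variable (hM : IsNondegModel G k ρ)
include hM

theorem isClique_starsBelow {𝒮 : Set (Set W)} {A : Submodule F (Fin n → F)} (hA : finrank F A = k) :
    (cliqueGraph G 𝒮).IsClique (starsBelow ρ k 𝒮 A) := by
  rintro K ⟨X₁, h₁A, h₁, hK⟩ L ⟨X₂, h₂A, h₂, hL⟩ hne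
  have hX : X₁ ≠ X₂ := fun h => hne (Subtype.ext (by rw [hK, hL, h]))
  rw [hM.cliqueGraph_stars_adj_iff h₁ h₂ hK hL]
  have := finrank_inf_add_one_of_le_of_le (k := k - 1) (by omega) (by omega) (by omega) h₁A h₂A hX
  omega

section Stars

variable {𝒮 : Set (Set W)}
  (h𝒮 : ∀ K, K ∈ 𝒮 ↔ ∃ X : Submodule F (Fin n → F), finrank F X + 1 = k ∧ K = modelStar ρ X)
include h𝒮

/-- If `X'` is not below `A` but adjacent to every hyperplane of `A`, then each of these contains `A
⊓ X'`, of dimension `k - 2`. This is nonzero for `k ≥ 3`, so some hyperplane of `A` misses one of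
its vectors. -/
theorem isMaxClique_starsBelow (hk : 3 ≤ k) {A : Submodule F (Fin n → F)} (hA : finrank F A = k) :
    IsMaxClique (cliqueGraph G 𝒮) (starsBelow ρ k 𝒮 A) := by
  refine ⟨hM.isClique_starsBelow hA, fun t ht hAt K' hK' => ?_⟩
  obtain ⟨X', hX', hK'X⟩ := (h𝒮 _).1 K'.2
  refine ⟨X', ?_, hX', hK'X⟩
  by_contra hX'A
  have key : ∀ X ≤ A, finrank F X + 1 = k →
      finrank F (X ⊓ X' : Submodule F (Fin n → F)) + 2 = k ∧ A ⊓ X' ≤ X := by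
    intro X hXA hX
    let K : 𝒮 := ⟨modelStar ρ X, (h𝒮 _).2 ⟨X, hX, rfl⟩⟩
    have hne : K ≠ K' := by
      rintro rfl
      exact hX'A ((hM.star_subset_star hX' hX hK'X.symm.subset) ▸ hXA)
    have h1 := (hM.cliqueGraph_stars_adj_iff hX hX' rfl hK'X).1
      (ht (hAt ⟨X, hXA, hX, rfl⟩) hK' hne)
    have h2 : finrank F (A ⊓ X' : Submodule F (Fin n → F)) < finrank F X' :=
      Submodule.finrank_lt_finrank_of_lt
        (lt_of_le_of_ne inf_le_right fun h => hX'A (inf_eq_right.1 h))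
    have h3 := Submodule.eq_of_le_of_finrank_le (inf_le_inf_right X' hXA) (by omega)
    exact ⟨h1, h3 ▸ inf_le_left⟩
  obtain ⟨X₁, hX₁A, -, -, hX₁, -⟩ := exists_pair_hyperplanes hM.one_lt hA
  have h1 := (key X₁ hX₁A hX₁).1
  have h2 : A ⊓ X' ≠ ⊥ := fun h => by
    have h3 := Submodule.finrank_mono (inf_le_inf_right X' hX₁A)
    rw [h, finrank_bot] at h3
    omega
  obtain ⟨z, hz, hz0⟩ := (A ⊓ X').ne_bot_iff.1 h2
  obtain ⟨X, hXA, hX, hzX⟩ := exists_ker_hyperplane_notMem hz.1 hz0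
  exact hzX ((key X hXA (by omega)).2 hz)

theorem mem_specialSets_stars_iff (hk : 3 ≤ k) (𝔛 : Set 𝒮) : 𝔛 ∈ specialSets G 𝒮 ↔
    ∃ A : Submodule F (Fin n → F), (finrank F A = k ∧ IsDegenerate A) ∧
      𝔛 = starsBelow ρ k 𝒮 A := by
  have hkn := hM.add_one_lt
  constructor
  · rintro ⟨h𝔛, h𝔛'⟩
    have hdisj : ∀ {X₁ X₂ : Submodule F (Fin n → F)} {K L : 𝒮}, finrank F X₁ + 1 = k →
        finrank F X₂ + 1 = k → X₁ ≠ X₂ → K.1 = modelStar ρ X₁ → L.1 = modelStar ρ X₂ → K ∈ 𝔛 →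
        L ∈ 𝔛 → ∀ w, X₁ ≤ ρ w → X₂ ≤ ρ w → False := by
      intro X₁ X₂ K L h₁ h₂ hne hK hL hK𝔛 hL𝔛 w hw₁ hw₂
      have hKL : K ≠ L := by
        rintro rfl
        exact hne (hM.star_subset_star h₁ h₂ (hK.symm.trans hL).subset)
      have := (h𝔛'.1 hK𝔛 hL𝔛 hKL).2
      rw [hK, hL] at this
      exact Set.notMem_empty w (this ▸ ⟨hw₁, hw₂⟩)
    rcases exists_common_le_or_le (F := F) (V := Fin n → F) (k := k - 1) (by omega)
      (by rw [finrank_fin_fun]; omega)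
      {X | finrank F X + 1 = k ∧ ∃ K ∈ 𝔛, K.1 = modelStar ρ X}
      (by rintro X ⟨hX, -⟩; omega)
      (by
        rintro X₁ ⟨h₁, K, hK𝔛, hK⟩ X₂ ⟨h₂, L, hL𝔛, hL⟩ hne
        have hKL : K ≠ L := by
          rintro rfl
          exact hne (hM.star_subset_star h₁ h₂ (hK.symm.trans hL).subset)
        have := (hM.cliqueGraph_stars_adj_iff h₁ h₂ hK hL).1 (h𝔛.1 hK𝔛 hL𝔛 hKL)
        omega) with ⟨Z, hZ, hZ𝔛⟩ | ⟨A, hA, hA𝔛⟩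
    -- All stars whose centre contains `Z` would belong to `𝔛`. Among them are two, one with
    -- non-degenerate centre, that share the vertex given by the sum of their centres.
    · exfalso
      let 𝔜 : Set 𝒮 := {K | ∃ X, Z ≤ X ∧ finrank F X + 1 = k ∧ K.1 = modelStar ρ X}
      have h𝔜 : (cliqueGraph G 𝒮).IsClique 𝔜 := by
        rintro K ⟨X₁, hZ₁, h₁, hK⟩ L ⟨X₂, hZ₂, h₂, hL⟩ hne
        have hX : X₁ ≠ X₂ := fun h => hne (Subtype.ext (by rw [hK, hL, h]))
        rw [hM.cliqueGraph_stars_adj_iff h₁ h₂ hK hL, inf_eq_of_le_of_finrank (k := k - 1)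
          (by omega) (by omega) (by omega) hZ₁ hZ₂ hX]
        omega
      have hsub : 𝔜 ⊆ 𝔛 := h𝔛.2 h𝔜 fun K hK => by
        obtain ⟨X, hX, hKX⟩ := (h𝒮 _).1 K.2
        exact ⟨X, hZ𝔛 X ⟨hX, K, hK, hKX⟩, hX, hKX⟩
      obtain ⟨X₁, hZ₁, h₁, h₁d, -⟩ :=
        hM.exists_notMem_sup_span (le_refl Z) (ne_top_of_finrank_lt (by omega))
      obtain ⟨X₂, hZ₂, h₂, -, h₂₁⟩ :=
        hM.exists_notMem_sup_span hZ₁ (ne_top_of_finrank_lt (by omega))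
      have hne : X₁ ≠ X₂ := fun h => h₂₁ h.ge
      have h₁' : finrank F X₁ + 1 = k := by omega
      have h₂' : finrank F X₂ + 1 = k := by omega
      have hinf := inf_eq_of_le_of_finrank (k := k - 1) (by omega) (by omega) (by omega) hZ₁ hZ₂ hne
      have hsup := Submodule.finrank_sup_add_finrank_inf_eq X₁ X₂
      rw [hinf] at hsup
      obtain ⟨w, hw⟩ := hM.surjective (X₁ ⊔ X₂) (by omega) fun h => h₁d (h.mono le_sup_left)
      exact hdisj h₁' h₂' hne (K := ⟨modelStar ρ X₁, (h𝒮 _).2 ⟨X₁, h₁', rfl⟩⟩)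
        (L := ⟨modelStar ρ X₂, (h𝒮 _).2 ⟨X₂, h₂', rfl⟩⟩) rfl rfl (hsub ⟨X₁, hZ₁, h₁', rfl⟩)
        (hsub ⟨X₂, hZ₂, h₂', rfl⟩) w (hw ▸ le_sup_left) (hw ▸ le_sup_right)
    · have hA' : finrank F A = k := by omega
      have hsub : 𝔛 ⊆ starsBelow ρ k 𝒮 A := fun K hK => by
        obtain ⟨X, hX, hKX⟩ := (h𝒮 _).1 K.2
        exact ⟨X, hA𝔛 X ⟨hX, K, hK, hKX⟩, hX, hKX⟩
      have hsup := h𝔛.2 (hM.isClique_starsBelow hA') hsub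
      refine ⟨A, ⟨hA', ?_⟩, hsub.antisymm hsup⟩
      -- A non-degenerate `A` would be a vertex common to all these stars.
      by_contra hAd
      obtain ⟨w, hw⟩ := hM.surjective A hA' hAd
      obtain ⟨X₁, h₁A, X₂, h₂A, h₁, h₂, hne⟩ := exists_pair_hyperplanes hM.one_lt hA'
      exact hdisj h₁ h₂ hne (K := ⟨modelStar ρ X₁, (h𝒮 _).2 ⟨X₁, h₁, rfl⟩⟩)
        (L := ⟨modelStar ρ X₂, (h𝒮 _).2 ⟨X₂, h₂, rfl⟩⟩) rfl rfl (hsup ⟨X₁, h₁A, h₁, rfl⟩)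
        (hsup ⟨X₂, h₂A, h₂, rfl⟩) w (hw ▸ h₁A) (hw ▸ h₂A)
  · rintro ⟨A, ⟨hA, hAd⟩, rfl⟩
    have hmax := hM.isMaxClique_starsBelow h𝒮 hk hA
    -- Cliques of the subgraph are cliques of the larger graph, so maximality passes down once
    -- disjointness is known. Two distinct hyperplanes span `A`, which leaves `A` as the only
    -- candidate for a common vertex.
    refine ⟨hmax, fun K hK L hL hne => ⟨hmax.1 hK hL hne, ?_⟩, fun t ht => hmax.2
      fun K hK L hL hne => (ht hK hL hne).1⟩
    obtain ⟨X₁, h₁A, h₁, hK'⟩ := hK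
    obtain ⟨X₂, h₂A, h₂, hL'⟩ := hL
    rw [hK', hL', Set.eq_empty_iff_forall_notMem]
    rintro w ⟨hw₁, hw₂⟩
    have hX : X₁ ≠ X₂ := fun h => hne (Subtype.ext (by rw [hK', hL', h]))
    have hsup := sup_eq_of_le_of_finrank (k := k - 1) (by omega) (by omega) (by omega) h₁A h₂A hX
    have hle : A ≤ ρ w := hsup ▸ sup_le hw₁ hw₂
    rw [Submodule.eq_of_le_of_finrank_eq hle (by rw [hA, hM.finrank_eq])] at hAd
    exact hM.nondeg w hAd

theorem exists_recoverByStars_iso (hk : 3 ≤ k) :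
    ∃ Φ : recoverByStars G 𝒮 ≃g grassmannGraph F n k, ∀ w, (Φ (Sum.inl w)).1 = ρ w := by
  have hmem : ∀ {X A : Submodule F (Fin n → F)} (hX : finrank F X + 1 = k), X ≤ A →
      (⟨modelStar ρ X, (h𝒮 _).2 ⟨X, hX, rfl⟩⟩ : 𝒮) ∈ starsBelow ρ k 𝒮 A :=
    fun {X A} hX hXA => ⟨X, hXA, hX, rfl⟩
  refine hM.exists_extendGraph_iso _ _ _ (starsBelow ρ k 𝒮)
    (hM.mem_specialSets_stars_iff h𝒮 hk) ?_ ?_ ?_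
  · rintro A A' ⟨hA, -⟩ ⟨hA', -⟩ h
    obtain ⟨X₁, h₁A, X₂, h₂A, h₁, h₂, hne⟩ := exists_pair_hyperplanes hM.one_lt hA
    have key : ∀ X ≤ A, finrank F X + 1 = k → X ≤ A' := by
      intro X hXA hX
      obtain ⟨X', hX'A, hX', heq⟩ := h ▸ hmem hX hXA
      rwa [hM.star_subset_star hX hX' (show modelStar ρ X = _ from heq).subset]
    have hsup := sup_eq_of_le_of_finrank (k := k - 1) (by omega) (by omega) (by omega) h₁A h₂A hne
    refine Submodule.eq_of_le_of_finrank_eq ?_ (by rw [hA, hA'])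
    rw [← hsup]
    exact sup_le (key X₁ h₁A h₁) (key X₂ h₂A h₂)
  · rintro w A ⟨hA, hAd⟩
    have hwA : ρ w ≠ A := fun h => hM.nondeg w (h ▸ hAd)
    constructor
    · rintro ⟨K, ⟨X, hXA, hX, hKX⟩, hwK⟩
      rw [hKX] at hwK
      rw [inf_eq_of_le_of_finrank (hM.finrank_eq w) hA hX hwK hXA hwA, hX]
    · intro h
      exact ⟨_, hmem h inf_le_right, mem_modelStar.2 inf_le_left⟩
  · rintro A A' ⟨hA, -⟩ ⟨hA', -⟩ hne
    constructor
    · rintro ⟨S, ⟨X, hXA, hX, hSX⟩, ⟨X', hXA', hX', hSX'⟩⟩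
      have := hM.star_subset_star hX hX' (hSX.symm.trans hSX').subset
      subst this
      rw [inf_eq_of_le_of_finrank hA hA' hX hXA hXA' hne, hX]
    · intro h
      exact ⟨_, hmem h inf_le_left, hmem h inf_le_right⟩

end Stars

end IsNondegModel

end Recovery

/-! ### Recovery from special sets of tops -/

section Recovery

variable {F : Type*} [Field F] {n : ℕ} {W : Type*} {G : SimpleGraph W} {k : ℕ}
  {ρ : W → Submodule F (Fin n → F)}

namespace IsNondegModel

variable (hM : IsNondegModel G k ρ)
include hM

/-- If `ρ a` is not below `Y₂`, then `ρ a ⊓ Y₂` has dimension `k - 1`, and its pencil in `Y₂` has a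
non-degenerate member. -/
theorem exists_adj_of_top {Y₁ Y₂ : Submodule F (Fin n → F)} (h₁ : finrank F Y₁ = k + 1)
    (h₂ : finrank F Y₂ = k + 1) (h₂d : ¬ IsDegenerate Y₂)
    (h : finrank F (Y₁ ⊓ Y₂ : Submodule F (Fin n → F)) = k) {a : W} (ha : a ∈ modelTop ρ Y₁) :
    ∃ b ∈ modelTop ρ Y₂, G.Adj a b := by
  by_cases hY : ρ a ≤ Y₂
  · obtain ⟨b, hb, c, hc, hbc⟩ := hM.exists_pair_top h₂ h₂d
    by_cases hab : a = b
    · exact ⟨c, hc, hM.adj_of_top h₂ hY hc (hab ▸ hbc)⟩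
    · exact ⟨b, hb, hM.adj_of_top h₂ hY hb hab⟩
  · have h1 := Submodule.finrank_mono (sup_le_sup_right ha Y₂ : ρ a ⊔ Y₂ ≤ Y₁ ⊔ Y₂)
    have h2 : finrank F Y₂ < finrank F (ρ a ⊔ Y₂ : Submodule F (Fin n → F)) :=
      Submodule.finrank_lt_finrank_of_lt
        (lt_of_le_of_ne le_sup_right fun h => hY (sup_eq_right.1 h.symm))
    have h3 := Submodule.finrank_sup_add_finrank_inf_eq (ρ a) Y₂
    have h4 := Submodule.finrank_sup_add_finrank_inf_eq Y₁ Y₂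
    have ha' := hM.finrank_eq a
    have hX : finrank F (ρ a ⊓ Y₂ : Submodule F (Fin n → F)) + 1 = k := by omega
    obtain ⟨B, hXB, hBY, hB, hBd⟩ := exists_hyperplane_of_pencil hM.add_one_lt hM.lt_card
      (inf_le_right : ρ a ⊓ Y₂ ≤ Y₂) hX h₂ h₂d
    obtain ⟨b, rfl⟩ := hM.surjective B hB hBd
    refine ⟨b, hBY, hM.adj_of_star hX (mem_modelStar.2 inf_le_left) hXB ?_⟩
    rintro rfl
    exact hY hBY

/-- If `Y₁ ⊓ Y₂` were smaller, it would equal `ρ a ⊓ ρ b` for every `a` in the first top and its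
neighbour `b` in the second. The first top would then lie in a star. -/
theorem finrank_inf_of_forall_exists_adj_top {Y₁ Y₂ : Submodule F (Fin n → F)}
    (h₁ : finrank F Y₁ = k + 1) (h₁d : ¬ IsDegenerate Y₁) (h₂ : finrank F Y₂ = k + 1)
    (hne : Y₁ ≠ Y₂) (h : ∀ a ∈ modelTop ρ Y₁, ∃ b ∈ modelTop ρ Y₂, G.Adj a b) :
    finrank F (Y₁ ⊓ Y₂ : Submodule F (Fin n → F)) = k := by
  have hk := hM.one_lt
  have h1 : finrank F (Y₁ ⊓ Y₂ : Submodule F (Fin n → F)) < finrank F Y₁ := by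
    refine Submodule.finrank_lt_finrank_of_lt (lt_of_le_of_ne inf_le_left fun h => hne ?_)
    exact Submodule.eq_of_le_of_finrank_eq (inf_eq_left.1 h) (by omega)
  by_contra hlt
  have key : ∀ a ∈ modelTop ρ Y₁, finrank F (Y₁ ⊓ Y₂ : Submodule F (Fin n → F)) + 1 = k ∧
      Y₁ ⊓ Y₂ ≤ ρ a := by
    intro a ha
    obtain ⟨b, hb, hab⟩ := h a ha
    have h2 := (hM.adj_iff a b).1 hab
    have hle : ρ a ⊓ ρ b ≤ Y₁ ⊓ Y₂ := inf_le_inf ha hb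
    have h3 := Submodule.finrank_mono hle
    have h4 := Submodule.eq_of_le_of_finrank_le hle (by omega)
    exact ⟨by omega, h4 ▸ inf_le_left⟩
  obtain ⟨a, ha, -⟩ := hM.exists_pair_top h₁ h₁d
  exact hM.not_top_subset_star (hM.ne_bot_of_finrank (key a ha).1) h₁ h₁d
    fun b hb => (key b hb).2

theorem top_eq_iff {Y₁ Y₂ : Submodule F (Fin n → F)} (h₁ : finrank F Y₁ = k + 1)
    (h₁d : ¬ IsDegenerate Y₁) (h₂ : finrank F Y₂ = k + 1) :
    modelTop ρ Y₁ = modelTop ρ Y₂ ↔ Y₁ = Y₂ :=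
  ⟨fun h => hM.top_subset_top h₁ h₂ h₁d h.subset, fun h => h ▸ rfl⟩

theorem cliqueGraph_tops_adj_iff {𝒯 : Set (Set W)} {K L : 𝒯} {Y₁ Y₂ : Submodule F (Fin n → F)}
    (h₁ : finrank F Y₁ = k + 1) (h₂ : finrank F Y₂ = k + 1) (h₁d : ¬ IsDegenerate Y₁)
    (h₂d : ¬ IsDegenerate Y₂) (hK : K.1 = modelTop ρ Y₁) (hL : L.1 = modelTop ρ Y₂) :
    (cliqueGraph G 𝒯).Adj K L ↔ finrank F (Y₁ ⊓ Y₂ : Submodule F (Fin n → F)) = k := by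
  constructor
  · rintro ⟨hne, h, -⟩
    refine hM.finrank_inf_of_forall_exists_adj_top h₁ h₁d h₂ (fun hY => hne (Subtype.ext ?_))
      (by rwa [hK, hL] at h)
    rw [hK, hL, hY]
  · intro h
    refine ⟨?_, ?_, ?_⟩
    · rintro rfl
      have := (hM.top_eq_iff h₁ h₁d h₂).1 (hK.symm.trans hL)
      rw [this, inf_idem] at h
      omega
    · rw [hK, hL]
      exact fun a ha => hM.exists_adj_of_top h₁ h₂ h₂d h ha
    · rw [hK, hL]
      exact fun a ha => hM.exists_adj_of_top h₂ h₁ h₁d (inf_comm Y₁ Y₂ ▸ h) ha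

theorem modelTop_inter_eq_empty_iff {Y₁ Y₂ : Submodule F (Fin n → F)}
    (h : finrank F (Y₁ ⊓ Y₂ : Submodule F (Fin n → F)) = k) :
    modelTop ρ Y₁ ∩ modelTop ρ Y₂ = ∅ ↔ IsDegenerate (Y₁ ⊓ Y₂) := by
  rw [Set.eq_empty_iff_forall_notMem]
  constructor
  · intro hemp
    by_contra hd
    obtain ⟨w, hw⟩ := hM.surjective _ h hd
    exact hemp w ⟨mem_modelTop.2 (hw ▸ inf_le_left), mem_modelTop.2 (hw ▸ inf_le_right)⟩
  · rintro hd w ⟨h₁, h₂⟩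
    exact hM.nondeg w
      (Submodule.eq_of_le_of_finrank_eq (le_inf h₁ h₂) (by rw [h, hM.finrank_eq]) ▸ hd)

/-- This makes `X` recoverable, even when degenerate, as an intersection of non-degenerate subspaces
defining tops. -/
theorem exists_pair_above {X : Submodule F (Fin n → F)} (hX : finrank F X = k) :
    ∃ Y₁ Y₂ : Submodule F (Fin n → F), X ≤ Y₁ ∧ X ≤ Y₂ ∧ finrank F Y₁ = k + 1 ∧
      finrank F Y₂ = k + 1 ∧ ¬ IsDegenerate Y₁ ∧ ¬ IsDegenerate Y₂ ∧ Y₁ ≠ Y₂ ∧ Y₁ ⊓ Y₂ = X := by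
  have hkn := hM.add_one_lt
  obtain ⟨Y₁, hX₁, h₁, h₁d, -⟩ :=
    hM.exists_notMem_sup_span (le_refl X) (ne_top_of_finrank_lt (by omega))
  obtain ⟨Y₂, hX₂, h₂, h₂d, h₂₁⟩ :=
    hM.exists_notMem_sup_span hX₁ (ne_top_of_finrank_lt (by omega))
  have hne : Y₁ ≠ Y₂ := fun h => h₂₁ h.ge
  exact ⟨Y₁, Y₂, hX₁, hX₂, by omega, by omega, h₁d, h₂d, hne,
    inf_eq_of_le_of_finrank h₁ h₂ rfl hX₁ hX₂ hne⟩

section Tops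

variable {𝒯 : Set (Set W)}
  (h𝒯 : ∀ K, K ∈ 𝒯 ↔ ∃ Y : Submodule F (Fin n → F), finrank F Y = k + 1 ∧ ¬ IsDegenerate Y ∧
    K = modelTop ρ Y)
include h𝒯

/-- Leaving `P` arbitrary serves both special sets and linear cliques. A star with centre `Z` meets
every top above `X` iff `Z ≤ X`: two of these tops have defining subspaces intersecting in `X`, and
conversely the pencil lemma gives a common vertex. The centre `X ⊓ X'` is degenerate, so general
stars are needed here. -/
theorem exists_recoverByTops_iso {𝒮 : Set (Set W)}
    (h𝒮 : ∀ K, K ∈ 𝒮 ↔ ∃ X : Submodule F (Fin n → F), finrank F X + 1 = k ∧ K = modelStar ρ X)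
    (P : Set (Set 𝒯)) (hP : ∀ 𝔛, 𝔛 ∈ P ↔ ∃ X : Submodule F (Fin n → F),
      (finrank F X = k ∧ IsDegenerate X) ∧ 𝔛 = topsAbove ρ k 𝒯 X) :
    ∃ Φ : recoverByTops G 𝒮 𝒯 P ≃g grassmannGraph F n k, ∀ w, (Φ (Sum.inl w)).1 = ρ w := by
  have hmem : ∀ {X Y : Submodule F (Fin n → F)} (hY : finrank F Y = k + 1)
      (hYd : ¬ IsDegenerate Y), X ≤ Y →
      (⟨modelTop ρ Y, (h𝒯 _).2 ⟨Y, hY, hYd, rfl⟩⟩ : 𝒯) ∈ topsAbove ρ k 𝒯 X :=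
    fun {X Y} hY hYd hXY => ⟨Y, hXY, hY, hYd, rfl⟩
  refine hM.exists_extendGraph_iso _ _ _ (topsAbove ρ k 𝒯) hP ?_ ?_ ?_
  · rintro X X' ⟨hX, -⟩ ⟨hX', -⟩ h
    obtain ⟨Y₁, Y₂, hX₁, hX₂, h₁, h₂, h₁d, h₂d, hne, hinf⟩ := hM.exists_pair_above hX
    have key : ∀ Y, X ≤ Y → finrank F Y = k + 1 → ¬ IsDegenerate Y → X' ≤ Y := by
      intro Y hXY hY hYd
      obtain ⟨Y', hX'Y, hY', -, heq⟩ := h ▸ hmem hY hYd hXY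
      rwa [(hM.top_eq_iff hY hYd hY').1 heq]
    refine (Submodule.eq_of_le_of_finrank_eq ?_ (by rw [hX, hX'])).symm
    rw [← hinf]
    exact le_inf (key Y₁ hX₁ h₁ h₁d) (key Y₂ hX₂ h₂ h₂d)
  · rintro w X ⟨hX, hXd⟩
    have hwX : ρ w ≠ X := fun h => hM.nondeg w (h ▸ hXd)
    constructor
    · rintro ⟨K, ⟨Y, hXY, hY, -, hKY⟩, hwK⟩
      rw [hKY] at hwK
      exact finrank_inf_add_one_of_le_of_le (hM.finrank_eq w) hX hY hwK hXY hwX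
    · intro h
      exact ⟨_, hmem ((finrank_inf_add_one_iff (hM.finrank_eq w) hX).1 h)
        (fun h => hM.nondeg w (h.mono le_sup_left)) le_sup_right, mem_modelTop.2 le_sup_left⟩
  · rintro X X' ⟨hX, -⟩ ⟨hX', -⟩ hne
    constructor
    · rintro ⟨S, hS, hSX, hSX'⟩
      obtain ⟨Z, hZ, rfl⟩ := (h𝒮 S).1 hS
      have key : ∀ V : Submodule F (Fin n → F), finrank F V = k →
          (∀ T ∈ topsAbove ρ k 𝒯 V, (modelStar ρ Z ∩ T.1).Nonempty) → Z ≤ V := by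
        intro V hV hSV
        obtain ⟨Y₁, Y₂, hV₁, hV₂, h₁, h₂, h₁d, h₂d, -, hinf⟩ := hM.exists_pair_above hV
        rw [← hinf]
        obtain ⟨a, haZ, haY⟩ := hSV _ (hmem h₁ h₁d hV₁)
        obtain ⟨b, hbZ, hbY⟩ := hSV _ (hmem h₂ h₂d hV₂)
        exact le_inf (haZ.trans haY) (hbZ.trans hbY)
      rw [inf_eq_of_le_of_finrank hX hX' hZ (key X hX hSX) (key X' hX' hSX') hne, hZ]
    · intro h
      have key : ∀ V : Submodule F (Fin n → F), X ⊓ X' ≤ V → ∀ T ∈ topsAbove ρ k 𝒯 V,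
          (modelStar ρ (X ⊓ X') ∩ T.1).Nonempty := by
        rintro V hV T ⟨Y, hVY, hY, hYd, hTY⟩
        obtain ⟨B, hXB, hBY, hB, hBd⟩ := exists_hyperplane_of_pencil hM.add_one_lt hM.lt_card
          (hV.trans hVY) h hY hYd
        obtain ⟨b, rfl⟩ := hM.surjective B hB hBd
        exact ⟨b, hXB, hTY ▸ hBY⟩
      exact ⟨_, (h𝒮 _).2 ⟨X ⊓ X', h, rfl⟩, key X inf_le_left, key X' inf_le_right⟩

/-- If `Y'` does not contain `X` but is adjacent to all non-degenerate `Y` above `X`, then all these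
`Y` lie in `X ⊔ Y'`, of dimension `k + 2`. This is a proper subspace when `k + 3 ≤ n`. -/
theorem isMaxClique_topsAbove (hkn : k + 3 ≤ n) {X : Submodule F (Fin n → F)}
    (hX : finrank F X = k) : IsMaxClique (cliqueGraph G 𝒯) (topsAbove ρ k 𝒯 X) := by
  refine ⟨?_, fun t ht hXt K' hK' => ?_⟩
  · rintro K ⟨Y₁, hX₁, h₁, h₁d, hK⟩ L ⟨Y₂, hX₂, h₂, h₂d, hL⟩ hne
    have hY : Y₁ ≠ Y₂ := fun h => hne (Subtype.ext (by rw [hK, hL, h]))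
    rw [hM.cliqueGraph_tops_adj_iff h₁ h₂ h₁d h₂d hK hL,
      inf_eq_of_le_of_finrank h₁ h₂ (by rw [hX]) hX₁ hX₂ hY, hX]
  obtain ⟨Y', hY', hY'd, hK'Y⟩ := (h𝒯 _).1 K'.2
  refine ⟨Y', ?_, hY', hY'd, hK'Y⟩
  by_contra hXY'
  have h1 : finrank F Y' < finrank F (X ⊔ Y' : Submodule F (Fin n → F)) :=
    Submodule.finrank_lt_finrank_of_lt
      (lt_of_le_of_ne le_sup_right fun h => hXY' (sup_eq_right.1 h.symm))
  have key : ∀ Y, X ≤ Y → finrank F Y = k + 1 → ¬ IsDegenerate Y →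
      finrank F (X ⊔ Y' : Submodule F (Fin n → F)) ≤ k + 2 ∧ Y ≤ X ⊔ Y' := by
    intro Y hXY hY hYd
    let K : 𝒯 := ⟨modelTop ρ Y, (h𝒯 _).2 ⟨Y, hY, hYd, rfl⟩⟩
    have hne : K ≠ K' := by
      rintro rfl
      exact hXY' ((hM.top_eq_iff hY hYd hY').1 hK'Y ▸ hXY)
    have h2 := (hM.cliqueGraph_tops_adj_iff hY hY' hYd hY'd rfl hK'Y).1
      (ht (hXt ⟨Y, hXY, hY, hYd, rfl⟩) hK' hne)
    have h3 := Submodule.finrank_sup_add_finrank_inf_eq Y Y'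
    have hle : X ⊔ Y' ≤ Y ⊔ Y' := sup_le_sup_right hXY Y'
    have h4 := Submodule.finrank_mono hle
    exact ⟨by omega, (Submodule.eq_of_le_of_finrank_le hle (by omega)).symm ▸ le_sup_left⟩
  obtain ⟨Y₁, -, hX₁, -, h₁, -, h₁d, -⟩ := hM.exists_pair_above hX
  have h2 := (key Y₁ hX₁ h₁ h₁d).1
  obtain ⟨Y, hXY, hY, hYd, hYU⟩ := hM.exists_notMem_sup_span (le_sup_left : X ≤ X ⊔ Y')
    (ne_top_of_finrank_lt (by omega))
  exact hYU (key Y hXY (by omega) hYd).2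

theorem mem_specialSets_tops_iff (hkn : k + 3 ≤ n) (𝔛 : Set 𝒯) : 𝔛 ∈ specialSets G 𝒯 ↔
    ∃ X : Submodule F (Fin n → F), (finrank F X = k ∧ IsDegenerate X) ∧
      𝔛 = topsAbove ρ k 𝒯 X := by
  constructor
  · rintro ⟨h𝔛, h𝔛'⟩
    have hdisj : ∀ {Y₁ Y₂ : Submodule F (Fin n → F)} {K L : 𝒯}, Y₁ ≠ Y₂ →
        finrank F Y₁ = k + 1 → ¬ IsDegenerate Y₁ → finrank F Y₂ = k + 1 →
        K.1 = modelTop ρ Y₁ → L.1 = modelTop ρ Y₂ → K ∈ 𝔛 → L ∈ 𝔛 →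
        ∀ w, ρ w ≤ Y₁ → ρ w ≤ Y₂ → False := by
      intro Y₁ Y₂ K L hne h₁ h₁d h₂ hK hL hK𝔛 hL𝔛 w hw₁ hw₂
      have hKL : K ≠ L := by
        rintro rfl
        exact hne ((hM.top_eq_iff h₁ h₁d h₂).1 (hK.symm.trans hL))
      have := (h𝔛'.1 hK𝔛 hL𝔛 hKL).2
      rw [hK, hL] at this
      exact Set.notMem_empty w (this ▸ ⟨hw₁, hw₂⟩)
    rcases exists_common_le_or_le (F := F) (V := Fin n → F) (k := k + 1) (by omega)
      (by rw [finrank_fin_fun]; omega)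
      {Y | finrank F Y = k + 1 ∧ ¬ IsDegenerate Y ∧ ∃ K ∈ 𝔛, K.1 = modelTop ρ Y}
      (by rintro Y ⟨hY, -⟩; exact hY)
      (by
        rintro Y₁ ⟨h₁, h₁d, K, hK𝔛, hK⟩ Y₂ ⟨h₂, h₂d, L, hL𝔛, hL⟩ hne
        have hKL : K ≠ L := by
          rintro rfl
          exact hne ((hM.top_eq_iff h₁ h₁d h₂).1 (hK.symm.trans hL))
        rw [(hM.cliqueGraph_tops_adj_iff h₁ h₂ h₁d h₂d hK hL).1 (h𝔛.1 hK𝔛 hL𝔛 hKL)])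
      with ⟨X, hX, hX𝔛⟩ | ⟨Z, hZ, hZ𝔛⟩
    · have hX' : finrank F X = k := by omega
      have hsub : 𝔛 ⊆ topsAbove ρ k 𝒯 X := fun K hK => by
        obtain ⟨Y, hY, hYd, hKY⟩ := (h𝒯 _).1 K.2
        exact ⟨Y, hX𝔛 Y ⟨hY, hYd, K, hK, hKY⟩, hY, hYd, hKY⟩
      have hsup := h𝔛.2 (hM.isMaxClique_topsAbove h𝒯 hkn hX').1 hsub
      refine ⟨X, ⟨hX', ?_⟩, hsub.antisymm hsup⟩
      by_contra hXd
      obtain ⟨w, hw⟩ := hM.surjective X hX' hXd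
      obtain ⟨Y₁, Y₂, hX₁, hX₂, h₁, h₂, h₁d, h₂d, hne, -⟩ := hM.exists_pair_above hX'
      exact hdisj hne h₁ h₁d h₂ (K := ⟨modelTop ρ Y₁, (h𝒯 _).2 ⟨Y₁, h₁, h₁d, rfl⟩⟩)
        (L := ⟨modelTop ρ Y₂, (h𝒯 _).2 ⟨Y₂, h₂, h₂d, rfl⟩⟩) rfl rfl
        (hsup ⟨Y₁, hX₁, h₁, h₁d, rfl⟩) (hsup ⟨Y₂, hX₂, h₂, h₂d, rfl⟩) w (hw ▸ hX₁) (hw ▸ hX₂)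
    · exfalso
      let 𝔜 : Set 𝒯 := {K | ∃ Y ≤ Z, finrank F Y = k + 1 ∧ ¬ IsDegenerate Y ∧ K.1 = modelTop ρ Y}
      have h𝔜 : (cliqueGraph G 𝒯).IsClique 𝔜 := by
        rintro K ⟨Y₁, hZ₁, h₁, h₁d, hK⟩ L ⟨Y₂, hZ₂, h₂, h₂d, hL⟩ hne
        have hY : Y₁ ≠ Y₂ := fun h => hne (Subtype.ext (by rw [hK, hL, h]))
        have := finrank_inf_add_one_of_le_of_le h₁ h₂ hZ hZ₁ hZ₂ hY
        rw [hM.cliqueGraph_tops_adj_iff h₁ h₂ h₁d h₂d hK hL]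
        omega
      have hsub : 𝔛 ⊆ 𝔜 := fun K hK => by
        obtain ⟨Y, hY, hYd, hKY⟩ := (h𝒯 _).1 K.2
        exact ⟨Y, hZ𝔛 Y ⟨hY, hYd, K, hK, hKY⟩, hY, hYd, hKY⟩
      have hsup := h𝔛.2 h𝔜 hsub
      -- If `Z` is degenerate, then `𝔜` is empty and yields no contradiction by itself; nonemptiness
      -- of `𝔛` provides a vertex below `Z`, through which two tops of `𝔜` can be drawn.
      have hne𝔛 : 𝔛.Nonempty := by
        by_contra hemp
        rw [Set.not_nonempty_iff_eq_empty] at hemp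
        obtain ⟨X, -, -, hX⟩ := exists_submodule_finrank_between
          (bot_le : (⊥ : Submodule F (Fin n → F)) ≤ ⊤) (d := k) (by simp)
          (by rw [finrank_top, finrank_fin_fun]; omega)
        obtain ⟨Y, -, -, -, hY, -, hYd, -⟩ := hM.exists_pair_above hX
        let K : 𝒯 := ⟨modelTop ρ Y, (h𝒯 _).2 ⟨Y, hY, hYd, rfl⟩⟩
        have : K ∈ 𝔛 := h𝔛.2 (y := {K}) (by simp) (by simp [hemp]) rfl
        simp [hemp] at this
      obtain ⟨K, hK⟩ := hne𝔛
      obtain ⟨Y, hYZ, hY, hYd, -⟩ := hsub hK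
      obtain ⟨w, hw, -⟩ := hM.exists_pair_top hY hYd
      have hwk := hM.finrank_eq w
      obtain ⟨Y₁, h₁w, h₁Z, h₁⟩ := exists_submodule_finrank_between (hw.trans hYZ) (d := k + 1)
        (by omega) (by omega)
      obtain ⟨v, hvZ, hv₁⟩ := SetLike.not_le_iff_exists.1 fun h : Z ≤ Y₁ => by
        have := Submodule.finrank_mono h
        omega
      have h₂ : finrank F (ρ w ⊔ F ∙ v : Submodule F (Fin n → F)) = k + 1 := by
        rw [Submodule.finrank_sup_span_singleton fun h => hv₁ (h₁w h), hwk]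
      have h₂Z : ρ w ⊔ F ∙ v ≤ Z := sup_le (hw.trans hYZ) (by simpa using hvZ)
      have h₁d : ¬ IsDegenerate Y₁ := fun h => hM.nondeg w (h.mono h₁w)
      have h₂d : ¬ IsDegenerate (ρ w ⊔ F ∙ v) := fun h => hM.nondeg w (h.mono le_sup_left)
      have hne : Y₁ ≠ ρ w ⊔ F ∙ v := fun h =>
        hv₁ (h ▸ Submodule.mem_sup_right (Submodule.mem_span_singleton_self v))
      exact hdisj hne h₁ h₁d h₂ (K := ⟨modelTop ρ Y₁, (h𝒯 _).2 ⟨Y₁, h₁, h₁d, rfl⟩⟩)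
        (L := ⟨modelTop ρ _, (h𝒯 _).2 ⟨_, h₂, h₂d, rfl⟩⟩) rfl rfl
        (hsup ⟨Y₁, h₁Z, h₁, h₁d, rfl⟩) (hsup ⟨_, h₂Z, h₂, h₂d, rfl⟩) w h₁w le_sup_left
  · rintro ⟨X, ⟨hX, hXd⟩, rfl⟩
    have hmax := hM.isMaxClique_topsAbove h𝒯 hkn hX
    refine ⟨hmax, fun K hK L hL hne => ⟨hmax.1 hK hL hne, ?_⟩, fun t ht => hmax.2
      fun K hK L hL hne => (ht hK hL hne).1⟩
    obtain ⟨Y₁, hX₁, h₁, h₁d, hK'⟩ := hK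
    obtain ⟨Y₂, hX₂, h₂, h₂d, hL'⟩ := hL
    have hY : Y₁ ≠ Y₂ := fun h => hne (Subtype.ext (by rw [hK', hL', h]))
    have hinf := inf_eq_of_le_of_finrank h₁ h₂ (by rw [hX]) hX₁ hX₂ hY
    rwa [hK', hL', hM.modelTop_inter_eq_empty_iff (by rw [hinf, hX]), hinf]

end Tops

end IsNondegModel

end Recovery

/-! ### Cliques of points joined through base points, in projective 3-space -/

section Normals

variable {F : Type*} [Field F] {T : Type*} {H : SimpleGraph T} {a : T → Fin 4 → F}

/-- The vectors `a s` and `a t` are proportional outside the `i`-th coordinate. -/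
def ProportionalOff (a : T → Fin 4 → F) (i : Fin 4) (s t : T) : Prop :=
  ∃ c : F, ∀ j, j ≠ i → a s j = c * a t j

/-- The vertices of `H` are represented, bijectively up to scalars, by the vectors of `F^4` with at
least two nonzero coordinates. Two distinct vertices are adjacent iff the line through the
corresponding points of the projective space contains a base point. -/
structure IsNormalModel (H : SimpleGraph T) (a : T → Fin 4 → F) : Prop where
  three_le_card : 3 ≤ ENat.card F
  exists_ne_zero : ∀ t i, ∃ j, j ≠ i ∧ a t j ≠ 0
  eq_of_smul : ∀ s t (c : F), a s = c • a t → s = t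
  surjective : ∀ v : Fin 4 → F, (∀ i, ∃ j, j ≠ i ∧ v j ≠ 0) → ∃ t, ∃ c : F, c ≠ 0 ∧ a t = c • v
  adj_iff : ∀ s t, H.Adj s t ↔ s ≠ t ∧ ∃ i, ProportionalOff a i s t

/-- The points on the line joining `a t` to the `i`-th base point. -/
def linearClass (a : T → Fin 4 → F) (i : Fin 4) (t : T) : Set T := {s | ProportionalOff a i s t}

/-- No line through a base point contains the three points. -/
def Noncollinear (a : T → Fin 4 → F) (s t u : T) : Prop :=
  ∀ i, ¬ (ProportionalOff a i s t ∧ ProportionalOff a i s u)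

/-- Apart from the `i`-th, the vector `v` has precisely one nonzero coordinate. -/
def IsSide (v : Fin 4 → F) (i : Fin 4) : Prop := ∃ j, j ≠ i ∧ ∀ m, m ≠ i → m ≠ j → v m = 0

theorem ProportionalOff.refl (i : Fin 4) (t : T) : ProportionalOff a i t t :=
  ⟨1, fun _ _ => (one_mul _).symm⟩

theorem ProportionalOff.trans {i : Fin 4} {s t u : T} (h₁ : ProportionalOff a i s t)
    (h₂ : ProportionalOff a i t u) : ProportionalOff a i s u := by
  obtain ⟨c, hc⟩ := h₁
  obtain ⟨d, hd⟩ := h₂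
  exact ⟨c * d, fun j hj => by rw [hc j hj, hd j hj, mul_assoc]⟩

theorem mem_linearClass (a : T → Fin 4 → F) (i : Fin 4) (t : T) : t ∈ linearClass a i t :=
  .refl i t

theorem eq_or_of_pairwise_ne {i j l m : Fin 4} (hij : i ≠ j) (hil : i ≠ l) (him : i ≠ m)
    (hjl : j ≠ l) (hjm : j ≠ m) (hlm : l ≠ m) (x : Fin 4) : x = i ∨ x = j ∨ x = l ∨ x = m := by
  omega

namespace IsNormalModel

variable (hN : IsNormalModel H a)
include hN

theorem scalar_ne_zero {i : Fin 4} {s t : T} {c : F} (h : ∀ j, j ≠ i → a s j = c * a t j) :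
    c ≠ 0 := by
  rintro rfl
  obtain ⟨j, hj, hj0⟩ := hN.exists_ne_zero s i
  exact hj0 (by rw [h j hj, zero_mul])

theorem symm {i : Fin 4} {s t : T} (h : ProportionalOff a i s t) : ProportionalOff a i t s := by
  obtain ⟨c, hc⟩ := h
  have hc0 := hN.scalar_ne_zero hc
  exact ⟨c⁻¹, fun j hj => by rw [hc j hj, inv_mul_cancel_left₀ hc0]⟩

theorem eq_zero_iff {i j : Fin 4} {s t : T} (h : ProportionalOff a i s t) (hj : j ≠ i) :
    a s j = 0 ↔ a t j = 0 := by
  obtain ⟨c, hc⟩ := h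
  rw [hc j hj, mul_eq_zero, or_iff_right (hN.scalar_ne_zero hc)]

theorem isSide_iff {i : Fin 4} {s t : T} (h : ProportionalOff a i s t) :
    IsSide (a s) i ↔ IsSide (a t) i :=
  exists_congr fun _ => and_congr_right fun _ => forall_congr' fun _ =>
    forall_congr' fun hm => imp_congr_right fun _ => hN.eq_zero_iff h hm

theorem linearClass_eq {i : Fin 4} {s t : T} (h : ProportionalOff a i s t) :
    linearClass a i s = linearClass a i t :=
  Set.ext fun _ => ⟨fun hu => hu.trans h, fun hu => hu.trans (hN.symm h)⟩

/-- If `a s` and `a t` are proportional off `i` and off `j`, then they are supported on `{i, j}`. -/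
theorem eq_zero_of_two_labels {i j : Fin 4} {s t : T} (hst : s ≠ t) (hij : i ≠ j)
    (hi : ProportionalOff a i s t) (hj : ProportionalOff a j s t) {m : Fin 4} (hmi : m ≠ i)
    (hmj : m ≠ j) : a t m = 0 := by
  obtain ⟨c, hc⟩ := hi
  obtain ⟨d, hd⟩ := hj
  by_contra hm
  have hcd : c = d := mul_right_cancel₀ hm ((hc m hmi).symm.trans (hd m hmj))
  subst hcd
  refine hst (hN.eq_of_smul s t c (funext fun x => ?_))
  by_cases hx : x = i
  · exact hd x (hx ▸ hij)
  · exact hc x hx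

/-- Here `s` and `t` lie on the line joining base points `i` and `j`, so the line through `t` and
one of them also contains the other. -/
theorem of_two_labels {i j : Fin 4} {s t u : T} (hst : s ≠ t) (hij : i ≠ j)
    (hi : ProportionalOff a i s t) (hj : ProportionalOff a j s t) (hu : ProportionalOff a j u t) :
    ProportionalOff a i u t := by
  have ht : ∀ m, m ≠ i → m ≠ j → a t m = 0 := fun m hmi hmj =>
    hN.eq_zero_of_two_labels hst hij hi hj hmi hmj
  have htj : a t j ≠ 0 := by
    obtain ⟨x, hxi, hx⟩ := hN.exists_ne_zero t i
    by_cases hxj : x = j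
    · exact hxj ▸ hx
    · exact absurd (ht x hxi hxj) hx
  refine ⟨a u j / a t j, fun m hm => ?_⟩
  by_cases hmj : m = j
  · rw [hmj, div_mul_cancel₀ _ htj]
  · rw [ht m hm hmj, mul_zero, hN.eq_zero_iff hu hmj, ht m hm hmj]

theorem noncollinear_of_not {i : Fin 4} {s t u : T} (hst : s ≠ t) (hi : ProportionalOff a i s t)
    (hu : ¬ ProportionalOff a i u s) : Noncollinear a s t u := by
  rintro m ⟨hm, hmu⟩
  by_cases hmi : i = m
  · subst hmi
    exact hu (hN.symm hmu)
  · exact hu (hN.of_two_labels hst.symm hmi (hN.symm hi) (hN.symm hm) (hN.symm hmu))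

/-- Write `t = b s + β e_i`, `u = c t + γ e_j`, `u = d s + δ e_l` with `β`, `γ`, `δ` nonzero. Then
`(d - c b) s = c β e_i + γ e_j - δ e_l`. As the labels differ, the right side has exactly these
three nonzero coordinates, and hence so has `s`. -/
theorem labels_of_noncollinear {s t u : T} (h : Noncollinear a s t u) {i j l : Fin 4}
    (hi : ProportionalOff a i t s) (hj : ProportionalOff a j u t) (hl : ProportionalOff a l u s) :
    i ≠ j ∧ j ≠ l ∧ i ≠ l ∧ ∀ m, a s m = 0 ↔ m ≠ i ∧ m ≠ j ∧ m ≠ l := by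
  have hij : i ≠ j := by
    rintro rfl
    exact h i ⟨hN.symm hi, hN.symm (hj.trans hi)⟩
  have hjl : j ≠ l := by
    rintro rfl
    exact h j ⟨(hN.symm hl).trans hj, hN.symm hl⟩
  have hil : i ≠ l := by
    rintro rfl
    exact h i ⟨hN.symm hi, hN.symm hl⟩
  refine ⟨hij, hjl, hil, ?_⟩
  have hts : t ≠ s := fun e => h l ⟨e ▸ .refl _ _, hN.symm hl⟩
  have hut : u ≠ t := fun e => h i ⟨hN.symm hi, e ▸ hN.symm hi⟩
  have hus : u ≠ s := fun e => h i ⟨hN.symm hi, e ▸ .refl _ _⟩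
  obtain ⟨b, hb⟩ := hi
  obtain ⟨c, hc⟩ := hj
  obtain ⟨d, hd⟩ := hl
  have hc0 := hN.scalar_ne_zero hc
  have hd0 := hN.scalar_ne_zero hd
  have hbi : a t i ≠ b * a s i := fun e => hts <| hN.eq_of_smul t s b <| funext fun x => by
    by_cases hx : x = i
    · exact hx ▸ e
    · exact hb x hx
  have hcj : a u j ≠ c * a t j := fun e => hut <| hN.eq_of_smul u t c <| funext fun x => by
    by_cases hx : x = j
    · exact hx ▸ e
    · exact hc x hx
  have hdl : a u l ≠ d * a s l := fun e => hus <| hN.eq_of_smul u s d <| funext fun x => by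
    by_cases hx : x = l
    · exact hx ▸ e
    · exact hd x hx
  have hi' : c * a t i = d * a s i := (hc i hij).symm.trans (hd i hil)
  intro m
  constructor
  · refine fun hm => ⟨?_, ?_, ?_⟩
    · rintro rfl
      rw [hm, mul_zero] at hi' hbi
      exact hbi ((mul_eq_zero.1 hi').resolve_left hc0)
    · rintro rfl
      rw [hd m hjl, hb m hij.symm, hm] at hcj
      simp at hcj
    · rintro rfl
      rw [hc m hjl.symm, hb m hil.symm, hm] at hdl
      simp at hdl
  · rintro ⟨hmi, hmj, hml⟩
    by_contra hm
    have h1 : d * a s m = c * (b * a s m) := by rw [← hb m hmi, ← hc m hmj, hd m hml]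
    have h2 : d = c * b := mul_right_cancel₀ hm (by rw [h1, mul_assoc])
    rw [h2, mul_assoc] at hi'
    exact hbi (mul_left_cancel₀ hc0 hi')

theorem exists_label {K : Set T} (hK : H.IsClique K) {s t : T} (hs : s ∈ K) (ht : t ∈ K) :
    ∃ i, ProportionalOff a i s t := by
  by_cases hst : s = t
  · exact ⟨0, hst ▸ .refl _ _⟩
  · exact ((hN.adj_iff s t).1 (hK hs ht hst)).2

/-! ### Cliques containing a noncollinear triple -/

section NoncollinearClique

variable {K : Set T} (hK : H.IsClique K) {s₀ t₀ u₀ : T} (hs₀ : s₀ ∈ K) (ht₀ : t₀ ∈ K) (hu₀ : u₀ ∈ K)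
  (hnc : Noncollinear a s₀ t₀ u₀)

include hs₀ ht₀ hu₀ hnc

theorem exists_notMem_class (i : Fin 4) (t : T) : ∃ u ∈ K, ¬ ProportionalOff a i u t := by
  by_contra! hcon
  exact hnc i ⟨(hcon _ hs₀).trans (hN.symm (hcon _ ht₀)),
    (hcon _ hs₀).trans (hN.symm (hcon _ hu₀))⟩

include hK

/-- A member of `K` off the line `s t` completes these two points to a noncollinear triple. -/
theorem support_of_mem {s t : T} (hs : s ∈ K) (ht : t ∈ K) (hst : s ≠ t) {i : Fin 4}
    (hi : ProportionalOff a i s t) : ∃ j l, i ≠ j ∧ j ≠ l ∧ i ≠ l ∧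
      ∀ m, a s m = 0 ↔ m ≠ i ∧ m ≠ j ∧ m ≠ l := by
  obtain ⟨u, hu, hui⟩ := hN.exists_notMem_class hs₀ ht₀ hu₀ hnc i s
  obtain ⟨j, hj⟩ := hN.exists_label hK hu ht
  obtain ⟨l, hl⟩ := hN.exists_label hK hu hs
  exact ⟨j, l, hN.labels_of_noncollinear (hN.noncollinear_of_not hst hi hui) (hN.symm hi) hj hl⟩

/-- For `v` in `K` off the line, let `p`, `q`, `r` label its joins to `s`, `t`, `u`. The support of
`s` is both `{i, p, q}` and `{i, p, r}`, while the triple `t`, `u`, `v` gives `q ≠ r`. -/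
theorem not_three_collinear {s t u : T} (hs : s ∈ K) (ht : t ∈ K) (hu : u ∈ K) (hst : s ≠ t)
    (hsu : s ≠ u) (htu : t ≠ u) {i : Fin 4} (hi : ProportionalOff a i s t)
    (hi' : ProportionalOff a i s u) : False := by
  obtain ⟨v, hv, hvi⟩ := hN.exists_notMem_class hs₀ ht₀ hu₀ hnc i s
  obtain ⟨p, hp⟩ := hN.exists_label hK hv hs
  obtain ⟨q, hq⟩ := hN.exists_label hK hv ht
  obtain ⟨r, hr⟩ := hN.exists_label hK hv hu
  obtain ⟨hiq, hqp, hip, h1⟩ := hN.labels_of_noncollinear (hN.noncollinear_of_not hst hi hvi)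
    (hN.symm hi) hq hp
  obtain ⟨hir, hrp, -, h2⟩ := hN.labels_of_noncollinear (hN.noncollinear_of_not hsu hi' hvi)
    (hN.symm hi') hr hp
  have htui := (hN.symm hi).trans hi'
  obtain ⟨-, hrq, -⟩ := hN.labels_of_noncollinear
    (hN.noncollinear_of_not htu htui fun h => hvi (h.trans (hN.symm hi))) (hN.symm htui) hr hq
  have h3 : a s q ≠ 0 := fun h => ((h1 q).1 h).2.1 rfl
  exact h3 ((h2 q).2 ⟨hiq.symm, hrq.symm, hqp⟩)

/-- Seen from `s₀`, the other members carry distinct labels, all in its three-element support; the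
remaining index `m` is assigned to `s₀` itself. -/
theorem encard_le_four : K.encard ≤ 4 := by
  classical
  obtain ⟨t₁, ht₁, ht₁s⟩ : ∃ t ∈ K, t ≠ s₀ := by
    obtain ⟨u, hu, h⟩ := hN.exists_notMem_class hs₀ ht₀ hu₀ hnc 0 s₀
    exact ⟨u, hu, fun e => h (e ▸ .refl _ _)⟩
  have hlab : ∀ t : K, ∃ i, ProportionalOff a i s₀ t ∧ (t.1 ≠ s₀ → a s₀ i ≠ 0) := by
    intro t
    obtain ⟨i, hi⟩ := hN.exists_label hK hs₀ t.2
    refine ⟨i, hi, fun hne h0 => ?_⟩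
    obtain ⟨j, l, -, -, -, h⟩ := hN.support_of_mem hK hs₀ ht₀ hu₀ hnc hs₀ t.2 hne.symm hi
    exact ((h i).1 h0).1 rfl
  choose f hf hf0 using hlab
  obtain ⟨m, hm⟩ : ∃ m, a s₀ m = 0 := by
    obtain ⟨j, l, -, -, -, h⟩ := hN.support_of_mem hK hs₀ ht₀ hu₀ hnc hs₀ ht₁ ht₁s.symm
      (hf ⟨t₁, ht₁⟩)
    have : ∀ i j l : Fin 4, ∃ m, m ≠ i ∧ m ≠ j ∧ m ≠ l := by decide
    obtain ⟨m, hm⟩ := this (f ⟨t₁, ht₁⟩) j l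
    exact ⟨m, (h m).2 hm⟩
  let g : K → Fin 4 := fun t => if t.1 = s₀ then m else f t
  have hg : Function.Injective g := by
    intro t t' h
    by_cases ht : t.1 = s₀ <;> by_cases ht' : t'.1 = s₀
    · exact Subtype.ext (ht.trans ht'.symm)
    · simp only [g, ht, ht', if_true, if_false] at h
      exact absurd (h ▸ hm) (hf0 t' ht')
    · simp only [g, ht, ht', if_true, if_false] at h
      exact absurd (h.symm ▸ hm) (hf0 t ht)
    · simp only [g, ht, ht', if_false] at h
      by_contra hne
      exact hN.not_three_collinear hK hs₀ ht₀ hu₀ hnc hs₀ t.2 t'.2 (Ne.symm ht) (Ne.symm ht')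
        (fun e => hne (Subtype.ext e)) (hf t) (h ▸ hf t')
  have := ENat.card_le_card_of_injective hg
  simpa using this

end NoncollinearClique

/-! ### Linear cliques -/

/-- Points of the line other than the base point correspond to the values `x` of the `i`-th
coordinate. On a side the value `0` gives a second base point and is lost. -/
theorem encard_linearClass (i : Fin 4) (t : T) :
    (IsSide (a t) i → (linearClass a i t).encard + 1 = ENat.card F) ∧
      (¬ IsSide (a t) i → (linearClass a i t).encard = ENat.card F) := by
  let P : F → Prop := fun x => ∀ i', ∃ j, j ≠ i' ∧ Function.update (a t) i x j ≠ 0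
  choose f c hc hf using fun x : {x // P x} => hN.surjective _ x.2
  have hfi : ∀ x, a (f x) i = c x * x := fun x => by rw [hf]; simp
  have hfj : ∀ x j, j ≠ i → a (f x) j = c x * a t j := fun x j hj => by rw [hf]; simp [hj]
  have hfinj : Function.Injective f := by
    intro x y hxy
    obtain ⟨j, hj, hj0⟩ := hN.exists_ne_zero t i
    have h1 : c x = c y := mul_right_cancel₀ hj0 (by rw [← hfj x j hj, ← hfj y j hj, hxy])
    have h2 := hfi x
    rw [hxy, hfi y, h1] at h2
    exact Subtype.ext (mul_left_cancel₀ (hc y) h2).symm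
  have hrange : Set.range f = linearClass a i t := by
    ext s
    constructor
    · rintro ⟨x, rfl⟩
      exact ⟨c x, hfj x⟩
    · rintro ⟨d, hd⟩
      have hd0 := hN.scalar_ne_zero hd
      have hs : a s = d • Function.update (a t) i (d⁻¹ * a s i) := by
        ext j
        by_cases hj : j = i
        · subst hj; simp [hd0]
        · simp [hj, hd j hj]
      have hP : P (d⁻¹ * a s i) := by
        intro i'
        obtain ⟨j, hj, hj0⟩ := hN.exists_ne_zero s i'
        refine ⟨j, hj, fun h0 => hj0 ?_⟩
        rw [hs, Pi.smul_apply, h0, smul_zero]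
      refine ⟨⟨_, hP⟩, hN.eq_of_smul _ _ (c ⟨_, hP⟩ * d⁻¹) ?_⟩
      rw [hf, mul_smul]
      congr 1
      rw [eq_inv_smul_iff₀ hd0]
      exact hs.symm
  have hcard : (linearClass a i t).encard = {x | P x}.encard := by
    rw [← hrange, ← Set.image_univ, hfinj.encard_image, Set.encard_univ]
    rfl
  obtain ⟨j, hj, hj0⟩ := hN.exists_ne_zero t i
  constructor
  · rintro ⟨l, hl, hl0⟩
    have hjl : j = l := by
      by_contra h
      exact hj0 (hl0 j hj h)
    have hP : {x | P x} = {0}ᶜ := by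
      ext x
      constructor
      · rintro hx rfl
        obtain ⟨m, hm, hm0⟩ := hx l
        by_cases hmi : m = i
        · simp [hmi] at hm0
        · simp [hmi, hl0 m hmi hm] at hm0
      · intro hx i'
        by_cases hi' : i' = i
        · exact ⟨j, hi' ▸ hj, by simpa [hj] using hj0⟩
        · exact ⟨i, Ne.symm hi', by simpa using hx⟩
    rw [hcard, hP, ← Set.encard_singleton (0 : F), add_comm, Set.encard_add_encard_compl,
      Set.encard_univ]
  · intro hside
    have hP : {x | P x} = Set.univ := by
      refine Set.eq_univ_of_forall fun x i' => ?_
      by_cases hi' : i' = j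
      · subst hi'
        by_contra! hcon
        refine hside ⟨i', hj, fun m hmi hmj => ?_⟩
        simpa [hmi] using hcon m hmj
      · exact ⟨j, Ne.symm hi', by simpa [hj] using hj0⟩
    rw [hcard, hP, Set.encard_univ]

theorem isClique_linearClass (i : Fin 4) (t : T) : H.IsClique (linearClass a i t) :=
  fun s hs u hu hne => (hN.adj_iff s u).2 ⟨hne, i, hs.trans (hN.symm hu)⟩

theorem exists_ne_mem_linearClass (i : Fin 4) (t : T) : ∃ s ∈ linearClass a i t, s ≠ t := by
  by_contra! hcon
  have h1 : (linearClass a i t).encard ≤ 1 :=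
    Set.encard_le_one_iff.2 fun s u hs hu => (hcon s hs).trans (hcon u hu).symm
  have h2 : ENat.card F ≤ 2 := by
    by_cases hside : IsSide (a t) i
    · rw [← (hN.encard_linearClass i t).1 hside]
      exact add_le_add_left h1 1
    · rw [← (hN.encard_linearClass i t).2 hside]
      exact h1.trans (by decide)
  exact absurd (hN.three_le_card.trans h2) (by decide)

/-- A further point would create a noncollinear triple, so `t` would have exactly three nonzero
coordinates. The line is then not a side and has `|F| ≥ 3` points, too many collinear ones for such
a clique. -/
theorem isMaxClique_linearClass (i : Fin 4) (t : T) : IsMaxClique H (linearClass a i t) := by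
  refine ⟨hN.isClique_linearClass i t, fun K hK hsub u hu => ?_⟩
  by_contra hut
  have ht := hsub (mem_linearClass a i t)
  obtain ⟨s, hs, hst⟩ := hN.exists_ne_mem_linearClass i t
  have hnc := hN.noncollinear_of_not hst.symm (hN.symm hs) hut
  obtain ⟨j, l, hij, hjl, hil, hsupp⟩ :=
    hN.support_of_mem hK ht (hsub hs) hu hnc ht (hsub hs) hst.symm (hN.symm hs)
  have hside : ¬ IsSide (a t) i := by
    rintro ⟨m, hm, hm0⟩
    by_cases hmj : m = j
    · exact ((hsupp l).1 (hm0 l hil.symm (hmj ▸ hjl.symm))).2.2 rfl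
    · exact ((hsupp j).1 (hm0 j hij.symm (Ne.symm hmj))).2.1 rfl
  have h3 : ¬ (linearClass a i t).encard ≤ 2 := fun h => by
    rw [(hN.encard_linearClass i t).2 hside] at h
    exact absurd (hN.three_le_card.trans h) (by decide)
  apply h3
  rw [← Set.encard_pair hst]
  refine Set.encard_le_encard fun r hr => ?_
  by_contra hrst
  simp only [Set.mem_insert_iff, Set.mem_singleton_iff, not_or] at hrst
  exact hN.not_three_collinear hK ht (hsub hs) hu hnc ht (hsub hs) (hsub hr) hst.symm
    (Ne.symm hrst.2) (Ne.symm hrst.1) (hN.symm hs) (hN.symm hr)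

theorem linear_or_noncollinear {K : Set T} (hK : IsMaxClique H K) :
    (∃ i t, K = linearClass a i t) ∨ ∃ s ∈ K, ∃ t ∈ K, ∃ u ∈ K, Noncollinear a s t u := by
  by_cases hlin : ∃ i t, K ⊆ linearClass a i t
  · obtain ⟨i, t, h⟩ := hlin
    exact Or.inl ⟨i, t, h.antisymm (hK.2 (hN.isClique_linearClass i t) h)⟩
  · right
    have hex : ∀ i t, ∃ u ∈ K, ¬ ProportionalOff a i u t := fun i t => by
      by_contra! h
      exact hlin ⟨i, t, h⟩
    obtain ⟨t', -, -⟩ := hN.surjective (fun _ => 1) fun i => by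
      obtain ⟨j, hj⟩ := exists_ne i
      exact ⟨j, hj, one_ne_zero⟩
    obtain ⟨s, hs, -⟩ := hex 0 t'
    obtain ⟨t, ht, hts⟩ := hex 0 s
    have hst : s ≠ t := fun h => hts (h ▸ .refl _ _)
    obtain ⟨i, hi⟩ := ((hN.adj_iff s t).1 (hK.1 hs ht hst)).2
    obtain ⟨u, hu, hus⟩ := hex i s
    exact ⟨s, hs, t, ht, u, hu, hN.noncollinear_of_not hst hi hus⟩

/-- A noncollinear clique shares two points with the linear clique through any two of its members.
-/
theorem linear_of_isLinearType12 {K : Set T} (h : IsLinearType12 H K) :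
    ∃ i t, K = linearClass a i t := by
  rcases hN.linear_or_noncollinear h.1 with hlin | ⟨s₀, hs₀, t₀, ht₀, u₀, hu₀, hnc⟩
  · exact hlin
  exfalso
  obtain ⟨t, ht, hts⟩ := hN.exists_notMem_class hs₀ ht₀ hu₀ hnc 0 s₀
  have hst : s₀ ≠ t := fun h => hts (h ▸ .refl _ _)
  obtain ⟨i, hi⟩ := hN.exists_label h.1.1 hs₀ ht
  obtain ⟨u, hu, hut⟩ := hN.exists_notMem_class hs₀ ht₀ hu₀ hnc i t
  have hle := h.2 _ (hN.isMaxClique_linearClass i t) fun e => hut (e.symm.subset hu)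
  exact hst (Set.encard_le_one_iff.1 hle s₀ t ⟨hs₀, hi⟩ ⟨ht, mem_linearClass a i t⟩)

/-- A noncollinear clique meeting the line twice forces its points there to have exactly three
nonzero coordinates, one of them the `i`-th. That leaves precisely two nonzero coordinates off `i`,
whereas the hypothesis gives one or three. -/
theorem isLinearType12_linearClass {i : Fin 4} {t : T}
    (h : IsSide (a t) i ∨ ∀ j, j ≠ i → a t j ≠ 0) : IsLinearType12 H (linearClass a i t) := by
  refine ⟨hN.isMaxClique_linearClass i t, fun L hL hne => ?_⟩
  rw [Set.encard_le_one_iff]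
  rintro s r ⟨hs, hsL⟩ ⟨hr, hrL⟩
  by_contra hsr
  have hi : ProportionalOff a i s r := hs.trans (hN.symm hr)
  rcases hN.linear_or_noncollinear hL with ⟨m, u, rfl⟩ | ⟨s₀, hs₀, t₀, ht₀, u₀, hu₀, hnc⟩
  · have hm : ProportionalOff a m s r := ProportionalOff.trans hsL (hN.symm hrL)
    apply hne
    rw [← hN.linearClass_eq hrL, ← hN.linearClass_eq hr]
    by_cases him : i = m
    · rw [him]
    · exact Set.ext fun v => ⟨fun hv => hN.of_two_labels hsr him hi hm hv,
        fun hv => hN.of_two_labels hsr (Ne.symm him) hm hi hv⟩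
  · obtain ⟨j, l, hij, hjl, hil, hsupp⟩ :=
      hN.support_of_mem hL.1 hs₀ ht₀ hu₀ hnc hsL hrL hsr hi
    rcases h with h | h
    · obtain ⟨m, hm, hm0⟩ := (hN.isSide_iff hs).2 h
      by_cases hmj : m = j
      · exact ((hsupp l).1 (hm0 l hil.symm (hmj ▸ hjl.symm))).2.2 rfl
      · exact ((hsupp j).1 (hm0 j hij.symm (Ne.symm hmj))).2.1 rfl
    · have : ∀ i j l : Fin 4, ∃ m, m ≠ i ∧ m ≠ j ∧ m ≠ l := by decide
      obtain ⟨m, hm⟩ := this i j l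
      exact h m hm.1 ((hN.eq_zero_iff hs hm.1).1 ((hsupp m).2 hm))

theorem exists_side_of_isLinearType2 {K : Set T} (h : IsLinearType2 (ENat.card F) H K)
    (hF : ENat.card F ≠ ⊤) : ∃ i t, IsSide (a t) i ∧ K = linearClass a i t := by
  obtain ⟨i, t, rfl⟩ := hN.linear_of_isLinearType12 h.1
  refine ⟨i, t, ?_, rfl⟩
  by_contra hside
  have h2 := h.2
  rw [(hN.encard_linearClass i t).2 hside] at h2
  lift ENat.card F to ℕ using hF with q
  norm_cast at h2
  omega

theorem mem_recLinear_iff (K : Set T) :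
    K ∈ recLinear (ENat.card F) H ↔ ∃ i t, K = linearClass a i t := by
  rw [recLinear, Set.mem_ofPred_eq]
  by_cases h6 : 6 ≤ ENat.card F
  · rw [if_pos h6]
    constructor
    · rintro ⟨hK, h5⟩
      rcases hN.linear_or_noncollinear hK with hlin | ⟨s₀, hs₀, t₀, ht₀, u₀, hu₀, hnc⟩
      · exact hlin
      · exact absurd (h5.trans (hN.encard_le_four hK.1 hs₀ ht₀ hu₀ hnc)) (by decide)
    · rintro ⟨i, t, rfl⟩
      refine ⟨hN.isMaxClique_linearClass i t, ?_⟩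
      by_cases hside : IsSide (a t) i
      · rw [← (hN.encard_linearClass i t).1 hside] at h6
        rw [show (6 : ℕ∞) = 5 + 1 by norm_num] at h6
        exact (ENat.add_le_add_iff_right ENat.one_ne_top).1 h6
      · rw [(hN.encard_linearClass i t).2 hside]
        exact le_trans (by decide) h6
  · rw [if_neg h6]
    have hF : ENat.card F ≠ ⊤ := fun h => h6 (h ▸ le_top)
    constructor
    · rintro ⟨hK, h12 | ⟨L, hL, s, hsK, hsL⟩⟩
      · exact hN.linear_of_isLinearType12 h12
      · rcases hN.linear_or_noncollinear hK with hlin | ⟨s₀, hs₀, t₀, ht₀, u₀, hu₀, hnc⟩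
        · exact hlin
        exfalso
        obtain ⟨i, t, hside, rfl⟩ := hN.exists_side_of_isLinearType2 hL hF
        -- A point on a side has support in `{i, p}`, too small for a member of a noncollinear
        -- clique.
        obtain ⟨p, hp, hp0⟩ := (hN.isSide_iff hsL).2 hside
        obtain ⟨r, hr, hrs⟩ := hN.exists_notMem_class hs₀ ht₀ hu₀ hnc 0 s
        obtain ⟨m, hm⟩ := hN.exists_label hK.1 hsK hr
        obtain ⟨j, l, hmj, hjl, hml, hsupp⟩ := hN.support_of_mem hK.1 hs₀ ht₀ hu₀ hnc hsK hr
          (fun h => hrs (h ▸ .refl _ _)) hm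
        have : ∀ m j l i p : Fin 4, m ≠ j → j ≠ l → m ≠ l →
            ∃ x, x ≠ i ∧ x ≠ p ∧ ¬ (x ≠ m ∧ x ≠ j ∧ x ≠ l) := by decide
        obtain ⟨x, hxi, hxp, hx⟩ := this m j l i p hmj hjl hml
        exact hx ((hsupp x).1 (hp0 x hxi hxp))
    · rintro ⟨i, t, rfl⟩
      refine ⟨hN.isMaxClique_linearClass i t, ?_⟩
      by_cases hside : IsSide (a t) i
      · exact Or.inl (hN.isLinearType12_linearClass (Or.inl hside))
      by_cases hall : ∀ j, j ≠ i → a t j ≠ 0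
      · exact Or.inl (hN.isLinearType12_linearClass (Or.inr hall))
      right
      push Not at hall
      obtain ⟨m, hmi, hm0⟩ := hall
      obtain ⟨j, hji, hj0⟩ := hN.exists_ne_zero t i
      -- Exactly two coordinates off `i` are nonzero in the remaining case. The point of the line
      -- with vanishing `i`-th coordinate therefore lies on a side.
      obtain ⟨r, c, hc, hr⟩ := hN.surjective (Function.update (a t) i 0) fun i' => by
        by_cases hi' : i' = j
        · subst hi'
          by_contra! hcon
          refine hside ⟨i', hji, fun m hmi hmj => ?_⟩
          simpa [hmi] using hcon m hmj
        · exact ⟨j, Ne.symm hi', by simpa [hji] using hj0⟩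
      have hri : a r i = 0 := by simp [hr]
      have hrt : ProportionalOff a i r t := ⟨c, fun x hx => by simp [hr, hx]⟩
      have hrm : a r m = 0 := (hN.eq_zero_iff hrt hmi).2 hm0
      have hjm : j ≠ m := fun h => hj0 (h ▸ hm0)
      have hrside : IsSide (a r) j := by
        obtain ⟨l, hlj, hl0⟩ := hN.exists_ne_zero r j
        refine ⟨l, hlj, fun x hxj hxl => ?_⟩
        have hli : l ≠ i := fun h => hl0 (h ▸ hri)
        have hlm : l ≠ m := fun h => hl0 (h ▸ hrm)
        rcases eq_or_of_pairwise_ne hji hlj.symm hjm hli.symm hmi.symm hlm x with h | h | h | h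
        · exact absurd h hxj
        · exact h ▸ hri
        · exact absurd h hxl
        · exact h ▸ hrm
      exact ⟨linearClass a j r, ⟨hN.isLinearType12_linearClass (Or.inl hrside),
        (hN.encard_linearClass j r).1 hrside⟩, r, hrt, mem_linearClass a j r⟩

end IsNormalModel

end Normals

/-! ### Normal vectors of hyperplanes -/

section DotKer

variable {F : Type*} [Field F] {n : ℕ}

/-- The functional with the given coefficients. -/
def dotFunctional (v : Fin n → F) : Dual F (Fin n → F) := ∑ i, v i • LinearMap.proj i

theorem dotFunctional_apply (v x : Fin n → F) : dotFunctional v x = ∑ i, v i * x i := by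
  simp [dotFunctional]

theorem dotFunctional_single (v : Fin n → F) (i : Fin n) (c : F) :
    dotFunctional v (Pi.single i c) = v i * c := by
  rw [dotFunctional_apply, Finset.sum_eq_single i (fun j _ hj => by simp [hj]) (by simp)]
  simp

theorem dotFunctional_smul (c : F) (v : Fin n → F) :
    dotFunctional (c • v) = c • dotFunctional v := by
  ext x
  simp [dotFunctional_single]

theorem exists_eq_ker_dotFunctional {Y : Submodule F (Fin n → F)} (hY : finrank F Y + 1 = n) :
    ∃ v : Fin n → F, v ≠ 0 ∧ Y = LinearMap.ker (dotFunctional v) := by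
  have hlt : Y < ⊤ := lt_top_iff_ne_top.2 (ne_top_of_finrank_lt (by omega))
  obtain ⟨f, hf, hYf⟩ := Submodule.exists_le_ker_of_lt_top _ hlt
  have hfv : dotFunctional (fun i => f (Pi.single i 1)) = f := by
    ext i
    simp [dotFunctional_single]
  refine ⟨fun i => f (Pi.single i 1), fun h => hf ?_, ?_⟩
  · rw [← hfv, h]
    ext i
    simp [dotFunctional_single]
  · rw [hfv]
    refine Submodule.eq_of_le_of_finrank_eq hYf ?_
    have := Module.Dual.finrank_ker_add_one_of_ne_zero hf
    rw [finrank_fin_fun] at this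
    omega

/-- A hyperplane lies in `C_i` iff its normal vector is a multiple of `e_i`. -/
theorem not_isDegenerate_ker_dotFunctional_iff {v : Fin n → F} (hv : v ≠ 0) :
    ¬ IsDegenerate (LinearMap.ker (dotFunctional v)) ↔ ∀ i, ∃ j, j ≠ i ∧ v j ≠ 0 := by
  constructor
  · intro hd i
    by_contra! hcon
    refine hd ⟨i, fun x hx => ?_⟩
    rw [LinearMap.mem_ker, dotFunctional_apply,
      Finset.sum_eq_single i (fun j _ hj => by rw [hcon j hj, zero_mul]) (by simp)] at hx
    refine (mul_eq_zero.1 hx).resolve_left fun hi => hv (funext fun j => ?_)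
    by_cases hj : j = i
    · exact hj ▸ hi
    · exact hcon j hj
  · rintro h ⟨i, hi⟩
    obtain ⟨j, hj, hvj⟩ := h i
    have hmem : Pi.single i (v j) - Pi.single j (v i) ∈ LinearMap.ker (dotFunctional v) := by
      rw [LinearMap.mem_ker, map_sub, dotFunctional_single, dotFunctional_single]
      ring
    have h0 : (Pi.single i (v j) - Pi.single j (v i) : Fin n → F) i = 0 := hi hmem
    exact hvj (by simpa [Ne.symm hj] using h0)

/-- The inclusion means `e_i ∈ span {v, w}`. Since `w` is not a multiple of `e_i`, the vector `v`
has a nonzero coefficient in such a combination; conversely `v - c • w` is a nonzero multiple of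
`e_i`. -/
theorem ker_inf_ker_le_coordHyperplane_iff {v w : Fin n → F} {i : Fin n}
    (hw : ∃ j, j ≠ i ∧ w j ≠ 0) (hvw : ∀ c : F, v ≠ c • w) :
    LinearMap.ker (dotFunctional v) ⊓ LinearMap.ker (dotFunctional w) ≤ coordHyperplane F i ↔
      ∃ c, ∀ j, j ≠ i → v j = c * w j := by
  constructor
  · intro hle
    obtain ⟨s, t, hst⟩ := exists_eq_add_of_ker_inf_ker_le hle
    have hj : ∀ j, j ≠ i → 0 = s * v j + t * w j := fun j hj => by
      simpa [dotFunctional_single, Ne.symm hj] using LinearMap.congr_fun hst (Pi.single j 1)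
    have hi : 1 = s * v i + t * w i := by
      simpa [dotFunctional_single] using LinearMap.congr_fun hst (Pi.single i 1)
    have hs : s ≠ 0 := by
      rintro rfl
      obtain ⟨j, hji, hj0⟩ := hw
      have h0 := hj j hji
      rw [zero_mul, zero_add] at h0
      have ht := (mul_eq_zero.1 h0.symm).resolve_right hj0
      simp [ht] at hi
    refine ⟨-(t / s), fun j hji => ?_⟩
    field_simp
    linear_combination -hj j hji
  · rintro ⟨c, hc⟩ x ⟨hx₁, hx₂⟩
    have hne : v i ≠ c * w i := fun h => hvw c <| funext fun j => by
      by_cases hj : j = i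
      · exact hj ▸ h
      · exact hc j hj
    have h1 : dotFunctional (v - c • w) x = 0 := by
      have : dotFunctional (v - c • w) = dotFunctional v - c • dotFunctional w := by
        ext j
        simp [dotFunctional_single]
      rw [this, LinearMap.sub_apply, LinearMap.smul_apply, LinearMap.mem_ker.1 hx₁,
        LinearMap.mem_ker.1 hx₂]
      simp
    rw [dotFunctional_apply, Finset.sum_eq_single i
      (fun j _ hj => by simp [hc j hj]) (by simp)] at h1
    exact (mul_eq_zero.1 h1).resolve_left (sub_ne_zero.2 hne)

end DotKer

/-! ### Linear cliques for `n = 4` -/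

section DimensionFour

variable {F : Type*} [Field F] {W : Type*} {G : SimpleGraph W}
  {ρ : W → Submodule F (Fin 4 → F)} {𝒯 : Set (Set W)}

namespace IsNondegModel

/-- Two distinct hyperplanes of `F^4` always meet in dimension 2, so `Δ_t` is complete and adjacency
in `Δ'_t` means that this intersection is degenerate. The tops over `Y t ⊓ C_i` correspond to the
points on the line from the normal vector of `Y t` to the `i`-th base point. -/
theorem mem_recLinear_iff (hM : IsNondegModel G 2 ρ)
    (h𝒯 : ∀ K, K ∈ 𝒯 ↔ ∃ Y : Submodule F (Fin 4 → F), finrank F Y = 2 + 1 ∧ ¬ IsDegenerate Y ∧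
      K = modelTop ρ Y) (𝔛 : Set 𝒯) :
    𝔛 ∈ recLinear (ENat.card F) (disjointCliqueGraph G 𝒯) ↔
      ∃ X : Submodule F (Fin 4 → F), (finrank F X = 2 ∧ IsDegenerate X) ∧
        𝔛 = topsAbove ρ 2 𝒯 X := by
  choose Y hY hYd hKY using fun K : 𝒯 => (h𝒯 K.1).1 K.2
  choose a ha0 ha using fun K : 𝒯 => exists_eq_ker_dotFunctional (Y := Y K) (by rw [hY])
  have hsupp : ∀ t i, ∃ j, j ≠ i ∧ a t j ≠ 0 := fun t =>
    (not_isDegenerate_ker_dotFunctional_iff (ha0 t)).1 (ha t ▸ hYd t)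
  have hYinj : ∀ {s t}, Y s = Y t → s = t := fun {s t} h =>
    Subtype.ext (by rw [hKY s, hKY t, h])
  have hsmul : ∀ s t (c : F), a s = c • a t → s = t := by
    intro s t c h
    have hc : c ≠ 0 := by
      rintro rfl
      exact ha0 s (by rw [h, zero_smul])
    apply hYinj
    rw [ha s, ha t, h, dotFunctional_smul, LinearMap.ker_smul _ _ hc]
  have hprop : ∀ {s t} i, s ≠ t → (ProportionalOff a i s t ↔ Y s ⊓ Y t ≤ coordHyperplane F i) := by
    intro s t i hst
    rw [ha s, ha t, ker_inf_ker_le_coordHyperplane_iff (hsupp t i)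
      fun c h => hst (hsmul s t c h)]
    rfl
  have hinf : ∀ {s t}, s ≠ t → finrank F (Y s ⊓ Y t : Submodule F (Fin 4 → F)) = 2 := by
    intro s t hst
    have := finrank_inf_add_one_of_le_of_le (hY s) (hY t)
      (by rw [finrank_top, finrank_fin_fun]) le_top le_top fun h => hst (hYinj h)
    omega
  have hN : IsNormalModel (disjointCliqueGraph G 𝒯) a :=
    { three_le_card := hM.three_le_card
      exists_ne_zero := hsupp
      eq_of_smul := hsmul
      surjective := by
        intro v hv
        have hv0 : v ≠ 0 := by
          obtain ⟨j, -, hj⟩ := hv 0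
          exact fun h => hj (by rw [h]; rfl)
        have hf0 : dotFunctional v ≠ 0 := fun h => hv0 (funext fun i => by
          have h1 := LinearMap.congr_fun h (Pi.single i (1 : F))
          simpa [dotFunctional_single] using h1)
        have hfr := Module.Dual.finrank_ker_add_one_of_ne_zero hf0
        rw [finrank_fin_fun] at hfr
        have hfr' : finrank F (LinearMap.ker (dotFunctional v)) = 2 + 1 := by omega
        have hvd := (not_isDegenerate_ker_dotFunctional_iff hv0).2 hv
        let t : 𝒯 := ⟨modelTop ρ _, (h𝒯 _).2 ⟨_, hfr', hvd, rfl⟩⟩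
        have hYt : Y t = LinearMap.ker (dotFunctional v) :=
          (hM.top_eq_iff (hY t) (hYd t) hfr').1 (hKY t).symm
        -- Taking both functionals equal turns the two-kernel lemma into proportionality, with
        -- factor `r + s`.
        obtain ⟨r, s, hrs⟩ := exists_eq_add_of_ker_inf_ker_le (f := dotFunctional v)
          (g := dotFunctional v) (h := dotFunctional (a t)) (by rw [inf_idem, ← ha t, hYt])
        have hat : a t = (r + s) • v := funext fun i => by
          simpa [dotFunctional_single, add_mul] using LinearMap.congr_fun hrs (Pi.single i 1)
        refine ⟨t, r + s, fun h0 => ha0 t ?_, hat⟩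
        rw [hat, h0, zero_smul]
      adj_iff := by
        intro s t
        by_cases hst : s = t
        · simp [hst]
        have h1 : (cliqueGraph G 𝒯).Adj s t :=
          (hM.cliqueGraph_tops_adj_iff (hY s) (hY t) (hYd s) (hYd t) (hKY s) (hKY t)).2 (hinf hst)
        have h2 : s.1 ∩ t.1 = ∅ ↔ IsDegenerate (Y s ⊓ Y t) := by
          rw [hKY s, hKY t, hM.modelTop_inter_eq_empty_iff (hinf hst)]
        change (_ ∧ _) ↔ _
        rw [h2, IsDegenerate]
        simp only [h1, true_and, ne_eq, hst, not_false_eq_true, hprop _ hst] }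
  have hclass : ∀ i t, linearClass a i t = topsAbove ρ 2 𝒯 (Y t ⊓ coordHyperplane F i) := by
    intro i t
    have hX : finrank F (Y t ⊓ coordHyperplane F i : Submodule F (Fin 4 → F)) = 2 := by
      have := finrank_inf_coordHyperplane fun h => hYd t ⟨i, h⟩
      have := hY t
      omega
    ext s
    have h1 : s ∈ topsAbove ρ 2 𝒯 (Y t ⊓ coordHyperplane F i) ↔ Y t ⊓ coordHyperplane F i ≤ Y s := by
      constructor
      · rintro ⟨Y', hle, hY', hY'd, hsY⟩
        rwa [(hM.top_eq_iff (hY s) (hYd s) hY').1 ((hKY s).symm.trans hsY)]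
      · exact fun h => ⟨Y s, h, hY s, hYd s, hKY s⟩
    rw [h1]
    by_cases hst : s = t
    · subst hst
      exact iff_of_true (mem_linearClass a i s) inf_le_left
    · refine (hprop i hst).trans ⟨fun h => ?_, fun h => ?_⟩
      · have := Submodule.eq_of_le_of_finrank_eq (le_inf inf_le_right h) ((hinf hst).trans hX.symm)
        exact this ▸ inf_le_left
      · have := Submodule.eq_of_le_of_finrank_eq (le_inf h inf_le_left) (hX.trans (hinf hst).symm)
        exact this ▸ inf_le_right
  rw [hN.mem_recLinear_iff]
  constructor
  · rintro ⟨i, t, rfl⟩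
    refine ⟨_, ⟨?_, ⟨i, inf_le_right⟩⟩, hclass i t⟩
    have := finrank_inf_coordHyperplane fun h => hYd t ⟨i, h⟩
    have := hY t
    omega
  · rintro ⟨X, ⟨hX, ⟨i, hi⟩⟩, rfl⟩
    obtain ⟨Y₁, -, hX₁, -, h₁, -, h₁d, -⟩ := hM.exists_pair_above hX
    let t : 𝒯 := ⟨modelTop ρ Y₁, (h𝒯 _).2 ⟨Y₁, h₁, h₁d, rfl⟩⟩
    have hYt : Y t = Y₁ := (hM.top_eq_iff (hY t) (hYd t) h₁).1 (hKY t).symm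
    refine ⟨i, t, ?_⟩
    rw [hclass, hYt]
    congr 1
    have h2 := finrank_inf_coordHyperplane fun h => h₁d ⟨i, h⟩
    exact Submodule.eq_of_le_of_finrank_eq (le_inf hX₁ hi) (by omega)

end IsNondegModel

end DimensionFour

/-! ### Assembly of the theorem -/

section Main

variable {F : Type*} [Field F] {n k : ℕ}

theorem isNondegModel_of_iso (hk : 1 < k) (hkn : k + 1 < n)
    (hF : ((n - k : ℕ) : ℕ∞) < ENat.card F) {W : Type*} (G : SimpleGraph W)
    (φ : G ≃g nondegGraph F n k) : IsNondegModel G k fun w => (φ w).1.1 where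
  one_lt := hk
  add_one_lt := hkn
  lt_card := hF
  injective _ _ h := φ.injective (Subtype.ext (Subtype.ext h))
  finrank_eq w := (φ w).1.2
  nondeg w := (φ w).2
  surjective A hA hAd := ⟨φ.symm ⟨⟨A, hA⟩, hAd⟩, by rw [φ.apply_symm_apply]⟩
  adj_iff _ _ := φ.map_adj_iff.symm

end Main

theorem theorem1 {F : Type*} [Field F] (n k : ℕ) (hk : 1 < k) (hkn : k + 1 < n)
    (hF : ((n - k : ℕ) : ℕ∞) < ENat.card F) :
    -- the types of maximal cliques of `Δ_k(F^n)` are determined by the graph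
    (recMaximalStars n k (ENat.card F) (nondegGraph F n k) = maximalStars F n k ∧
      recStars n k (ENat.card F) (nondegGraph F n k) = stars F n k ∧
      recTops n k (ENat.card F) (nondegGraph F n k) = tops F n k) ∧
    -- for `n = 4` so are the linear maximal cliques of `Δ'_t`
    (n = 4 → ∀ 𝔛 : Set (tops F n k),
      𝔛 ∈ recLinear (ENat.card F) (disjointCliqueGraph (nondegGraph F n k) (tops F n k)) ↔
        ∃ X : Grass F n k, IsDegenerate X.1 ∧ 𝔛 = topsThrough X) ∧
    -- the constructions, carried out in any abstract copy `G` of `Δ_k(F^n)`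
    ∀ {W : Type*} (G : SimpleGraph W) (φ : G ≃g nondegGraph F n k),
      (3 ≤ k →
        ∃ Φ : recoverByStars G (recStars n k (ENat.card F) G) ≃g grassmannGraph F n k,
          ∀ w : W, Φ (Sum.inl w) = (φ w).1) ∧
      (k + 3 ≤ n →
        ∃ Φ : recoverByTops G (recStars n k (ENat.card F) G) (recTops n k (ENat.card F) G)
            (specialSets G (recTops n k (ENat.card F) G)) ≃g grassmannGraph F n k,
          ∀ w : W, Φ (Sum.inl w) = (φ w).1) ∧
      (n = 4 →
        ∃ Φ : recoverByTops G (recStars n k (ENat.card F) G) (recTops n k (ENat.card F) G)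
            (recLinear (ENat.card F)
              (disjointCliqueGraph G (recTops n k (ENat.card F) G))) ≃g grassmannGraph F n k,
          ∀ w : W, Φ (Sum.inl w) = (φ w).1) := by
  -- The identity isomorphism makes `Δ_k` its own model; its model stars and tops are then the sets
  -- `starSet` and `topSet` by definition.
  have hM := isNondegModel_of_iso hk hkn hF (nondegGraph F n k) .refl
  have htops : ∀ K, K ∈ tops F n k ↔ ∃ Y : Submodule F (Fin n → F), finrank F Y = k + 1 ∧
      ¬ IsDegenerate Y ∧ K = topSet k Y := by
    intro K
    constructor
    · rintro ⟨hK, Y, hY, rfl⟩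
      rcases hM.isMaxClique_iff.1 hK with ⟨X, hX, h⟩ | ⟨Y', hY', hY'd, h⟩
      · exact absurd h.symm (hM.star_ne_top hX hY)
      · exact ⟨Y', hY', hY'd, h⟩
    · rintro ⟨Y, hY, hYd, rfl⟩
      exact ⟨hM.isMaxClique_top hY hYd, Y, hY, rfl⟩
  refine ⟨⟨?_, ?_, ?_⟩, ?_, ?_⟩
  · ext K
    exact hM.mem_recMaximalStars_iff K
  · ext K
    rw [hM.mem_recStars_iff K]
    constructor
    · rintro ⟨X, hX, rfl⟩
      exact ⟨hM.isMaxClique_star hX, X, hX, rfl⟩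
    · exact fun h => h.2
  · ext K
    rw [hM.mem_recTops_iff K, htops]
    rfl
  · rintro rfl 𝔛
    obtain rfl : k = 2 := by omega
    rw [hM.mem_recLinear_iff htops]
    have hset : ∀ X : Grass F 4 2, topsThrough X =
        topsAbove (fun w : nondegenerate F 4 2 => w.1.1) 2 (tops F 4 2) X.1 := by
      intro X
      ext T
      constructor
      · rintro ⟨Y, hY, hXY, hT⟩
        refine ⟨Y, hXY, hY, ?_, hT⟩
        -- The subspace `Y` is not assumed non-degenerate, but the top `T` determines it.
        obtain ⟨Y', hY', hY'd, hT'⟩ := (htops _).1 T.2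
        rwa [← (hM.top_eq_iff hY' hY'd hY).1 (hT'.symm.trans hT)]
      · rintro ⟨Y, hXY, hY, -, hT⟩
        exact ⟨Y, hY, hXY, hT⟩
    constructor
    · rintro ⟨X, ⟨hX, hXd⟩, rfl⟩
      exact ⟨⟨X, hX⟩, hXd, (hset ⟨X, hX⟩).symm⟩
    · rintro ⟨X, hXd, rfl⟩
      exact ⟨X.1, ⟨X.2, hXd⟩, hset X⟩
  · intro W G φ
    have hG := isNondegModel_of_iso hk hkn hF G φ
    refine ⟨fun hk3 => ?_, fun hkn3 => ?_, fun hn => ?_⟩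
    · obtain ⟨Φ, hΦ⟩ := hG.exists_recoverByStars_iso hG.mem_recStars_iff hk3
      exact ⟨Φ, fun w => Subtype.ext (hΦ w)⟩
    · obtain ⟨Φ, hΦ⟩ := hG.exists_recoverByTops_iso hG.mem_recTops_iff hG.mem_recStars_iff _
        (hG.mem_specialSets_tops_iff hG.mem_recTops_iff hkn3)
      exact ⟨Φ, fun w => Subtype.ext (hΦ w)⟩
    · subst hn
      obtain rfl : k = 2 := by omega
      obtain ⟨Φ, hΦ⟩ := hG.exists_recoverByTops_iso hG.mem_recTops_iff hG.mem_recStars_iff _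
        (hG.mem_recLinear_iff hG.mem_recTops_iff)
      exact ⟨Φ, fun w => Subtype.ext (hΦ w)⟩
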